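/- Let $q\in\mathbb C\setminus\{0\}$ not be a root of unity, write $q^x=e^{x\log q}$ (principal branch) and $[x]_q=\frac{q^x-q^{-x}}{q-q^{-1}}$, $(a;p)_n=\prod_{k=0}^{n-1}(1-p^ka)$. Let $N\ge 0$, $\ell_1,\dots,\ell_N,\delta_1,\dots,\delta_N\in\mathbb C$, where the spins are generic: $q^{4\ell_k+2j}\ne1$ for all $k$ and all integers $j\ge0$. The quantum space is $V_{\ell_1}\otimes\cdots\otimes V_{\ell_N}=\mathbb C[z_1,\dots,z_N]$, with $U_q(s\ell_2)$ acting in the variable $z_k$ by $S_k=z_k\partial_k+\ell_k$, $S_k^-=-\frac1{z_k}[z_k\partial_k]_q$, $S_k^+=z_k[z_k\partial_k+2\ell_k]_q$. The Lax and transfer matrices are $$L_k(u)=\begin{pmatrix}[u+S_k]_q&S_k^-\\ S_k^+&[u-S_k]_q\end{pmatrix},\qquad \mathbf t(u)=\operatorname{tr}_{\mathbb C^2}L_1(u+\delta_1)\cdots L_N(u+\delta_N).$$ Let $\mathbf u_{ij}=\frac{z_j}{z_i}(1-q^{-2z_i\partial_i})$, $\mathbf v_i=q^{2z_i\partial_i}$;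 on polynomials the series $\mathbf e_{q^2}(x\mathbf u_{ij})=\sum_n\frac{x^n\mathbf u_{ij}^n}{(q^2;q^2)_n}$ and $\mathbf e^{-1}_{q^2}(x\mathbf u_{ij})=\sum_n\frac{(-1)^nq^{n(n-1)}x^n\mathbf u_{ij}^n}{(q^2;q^2)_n}$ are locally finite. Let $D_i(\alpha;x,y)$ be the operator $\frac{\mathbf e_{q^2}(q^y)}{\mathbf e_{q^2}(q^x)}\,\mathbf v_i^{\alpha}\,\frac{\mathbf e_{q^2}(q^x\mathbf v_i)}{\mathbf e_{q^2}(q^y\mathbf v_i)}$, i.e. the operator acting on monomials of degree $a$ in $z_i$ by $q^{2\alpha a}(q^x;q^2)_a/(q^y;q^2)_a$. Put $$\mathcal R^-_{ij}(u_+,u_-|v_-)=\mathbf e_{q^2}(q^{u_--u_++2}\mathbf u_{ij})\,D_i\big(\tfrac{v_--u_-}2;2u_+-2v_-,2u_+-2u_-\big)\,\mathbf e_{q^2}^{-1}(q^{v_--u_++2}\mathbf u_{ij}),$$ $$\mathcal R^+_{ij}(u_+|v_+,v_-)=\mathbf e_{q^2}(q^{v_--v_++2}\mathbf u_{ji})\,D_j\big(\tfrac{v_+-u_+}2;2u_+-2v_-,2v_+-2v_-\big)\,\mathbf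 e_{q^2}^{-1}(q^{v_--u_++2}\mathbf u_{ji}).$$ With an auxiliary space $V_0=V_{\ell_0}=\mathbb C[z_0]$ and $P_{k0}$ the exchange of $z_k$ and $z_0$, let $$\mathbb R_{k0}(w)=P_{k0}\,\mathcal R^+_{k0}(w+\ell_k\,|\,\ell_0,\,w-\ell_k)\,\mathcal R^-_{k0}(w+\ell_k,\,w-\ell_k\,|\,-\ell_0),$$ $$\mathbf Q(u,\ell_0)=\operatorname{tr}_{V_0}\mathbb R_{10}(u+\delta_1)\cdots\mathbb R_{N0}(u+\delta_N),$$ where $\operatorname{tr}_{V_0}A$ is the operator $\Psi\mapsto\sum_{m\ge0}\big(\text{coefficient of }z_0^m\text{ in }A(z_0^m\Psi)\big)$ on $\mathbb C[z_1,\dots,z_N]$, with (unconditional) coefficientwise convergence. Write $\mathbf Q(u_1|u_2)=\mathbf Q(u,\ell_0)$ for $u_1=1+u-\ell_0$, $u_2=u+\ell_0$. Call $u_1$ regular if $q^{2+2\ell_k-2u_1-2\delta_k+2j}\ne1$ for all $k$ and all integers $j\ge0$ (so that the $\mathbb R_{k0}$ have no poles), and let $\mathcal D$ be the set of $(u_1,u_2)\in\mathbb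 C^2$ such that $u_1$ is regular and the trace defining $\mathbf Q(u_1|u_2)$ converges. Let $\Delta_\pm(u)=\prod_{k=1}^N[u+\delta_k\pm\ell_k]_q$. **Theorem.** The operators $\mathbf Q(u_1|u_2)$ are two-parametric Baxter operators: 1. (Convergence.) If $|q|<1$ and $|q^{\ell_1+\dots+\ell_N}|<1$, or $|q|>1$ and $|q^{\ell_1+\dots+\ell_N}|>1$, then $(u_1,u_2)\in\mathcal D$ for every regular $u_1$ and every $u_2$. 2. (Commutativity.) For $(u_1,u_2),(v_1,v_2)\in\mathcal D$ and $v\in\mathbb C$: $\mathbf Q(u_1|u_2)\mathbf Q(v_1|v_2)=\mathbf Q(v_1|v_2)\mathbf Q(u_1|u_2)$ and $\mathbf Q(u_1|u_2)\mathbf t(v)=\mathbf t(v)\mathbf Q(u_1|u_2)$. 3. (Baxter relation in $u_2$.) If $(u_1,u),(u_1,u+1),(u_1,u-1)\in\mathcal D$, then $$\mathbf Q(u_1|u)\,\mathbf t(u)=\Delta_+(u)\,\mathbf Q(u_1|u+1)+\Delta_-(u)\,\mathbf Q(u_1|u-1).$$ 4. (Baxter relation in $u_1$.) If $(u,u_2),(u-1,u_2),(u+1,u_2)\in\mathcal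 D$, then $\Delta_-(u-1)\ne0$ and $$\mathbf t(u)\,\mathbf Q(u|u_2)=\frac{\Delta_+(u-1)\Delta_-(u)}{\Delta_-(u-1)}\,\mathbf Q(u-1|u_2)+\Delta_-(u)\,\mathbf Q(u+1|u_2).$$ -/

import Mathlib

open scoped BigOperators

noncomputable section

namespace XXZ

/-- The `q`-number `[x]_q = (q^x - q^(-x)) / (q - q⁻¹)`. -/
def qNum (q x : ℂ) : ℂ := (q ^ x - q ^ (-x)) / (q - q⁻¹)

/-- The finite `q`-product `(a; p)_n = ∏_{k < n} (1 - p^k a)`. -/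
def qPoch (a p : ℂ) (n : ℕ) : ℂ := ∏ k ∈ Finset.range n, (1 - p ^ k * a)

/-! ### Operators on polynomials in variables `z_i`, `i : σ` -/

/-- Linear operators on the space of polynomials `ℂ[z_i : i ∈ σ]`. -/
abbrev Op (σ : Type) : Type := Module.End ℂ (MvPolynomial σ ℂ)

/-- The linear operator with prescribed values on the monomials `z^s`. -/
def onMonomials {σ : Type} (f : (σ →₀ ℕ) → MvPolynomial σ ℂ) : Op σ :=
  (MvPolynomial.basisMonomials σ ℂ).constr ℂ f

/-- The function `f (z_i ∂_i)` of the Euler operator: `z^s ↦ f (s_i) z^s`. -/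
def eulerFun {σ : Type} (i : σ) (f : ℕ → ℂ) : Op σ :=
  onMonomials fun s => MvPolynomial.monomial s (f (s i))

/-- Multiplication by `z_i`. -/
def mulZ {σ : Type} (i : σ) : Op σ := LinearMap.mulLeft ℂ (MvPolynomial.X i)

open Classical in
/-- Division by `z_i`. It is only ever applied to polynomials without terms of degree zero
in `z_i`; on such terms we let it be zero. -/
def divZ {σ : Type} (i : σ) : Op σ :=
  onMonomials fun s =>
    if s i = 0 then 0 else MvPolynomial.monomial (s - Finsupp.single i 1) 1

/-- The permutation operator exchanging `z_i` and `z_j`. -/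
def perm {σ : Type} [DecidableEq σ] (i j : σ) : Op σ :=
  (MvPolynomial.rename (Equiv.swap i j)).toLinearMap

/-! ### The representation of spin `ℓ` and the Lax matrix -/

/-- `S₋ = - z⁻¹ [z∂]_q` in the variable `z_i`. -/
def sMinus {σ : Type} (q : ℂ) (i : σ) : Op σ := -(divZ i * eulerFun i fun a => qNum q a)

/-- `S₊ = z [z∂ + 2ℓ]_q` in the variable `z_i`. -/
def sPlus {σ : Type} (q ℓ : ℂ) (i : σ) : Op σ := mulZ i * eulerFun i fun a => qNum q (a + 2 * ℓ)

/-- The Lax matrix `L(u)` acting on the variable `z_i` in the representation of spin `ℓ`, with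
diagonal entries `[u + S]_q`, `[u - S]_q`, where `S = z∂ + ℓ`. -/
def lax {σ : Type} (q ℓ : ℂ) (i : σ) (u : ℂ) : Matrix (Fin 2) (Fin 2) (Op σ) :=
  !![eulerFun i fun a => qNum q (u + (a + ℓ)), sMinus q i;
     sPlus q ℓ i, eulerFun i fun a => qNum q (u - (a + ℓ))]

/-! ### The `R`-operator -/

/-- The Weyl operator `𝐮_ij = (z_j / z_i) (1 - q^(-2 z_i ∂_i))`. -/
def weylU {σ : Type} (q : ℂ) (i j : σ) : Op σ :=
  mulZ j * divZ i * eulerFun i fun a => 1 - q ^ (-2 * (a : ℂ))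

/-- The `q`-exponential `𝐞_{q²}(x 𝐮_ij) = ∑_n x^n 𝐮_ij^n / (q²; q²)_n`. For `i ≠ j` the operator
`𝐮_ij` lowers the degree in `z_i` by one and kills constants in `z_i`, so on `z^s` only the terms
with `n ≤ s_i` are present. -/
def qExp {σ : Type} (q : ℂ) (i j : σ) (x : ℂ) : Op σ :=
  onMonomials fun s => ∑ n ∈ Finset.range (s i + 1),
    (x ^ n / qPoch (q ^ 2) (q ^ 2) n) • (weylU q i j ^ n) (MvPolynomial.monomial s 1)

/-- The inverse `q`-exponential
`𝐞_{q²}⁻¹(x 𝐮_ij) = ∑_n (-1)^n q^(n(n-1)) x^n 𝐮_ij^n / (q²; q²)_n`. -/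
def qExpInv {σ : Type} (q : ℂ) (i j : σ) (x : ℂ) : Op σ :=
  onMonomials fun s => ∑ n ∈ Finset.range (s i + 1),
    ((-1) ^ n * q ^ (n * (n - 1)) * x ^ n / qPoch (q ^ 2) (q ^ 2) n) •
      (weylU q i j ^ n) (MvPolynomial.monomial s 1)

/-- With `𝐯_i = q^(2 z_i ∂_i)`, the normalized diagonal operator
`(𝐞_{q²}(q^y) / 𝐞_{q²}(q^x)) · 𝐯_i^α · 𝐞_{q²}(q^x 𝐯_i) / 𝐞_{q²}(q^y 𝐯_i)`.
Since `𝐞_p(p c) = (1 - c) 𝐞_p(c)`, one has `𝐞_p(p^a c) / 𝐞_p(c) = (c; p)_a`, so that its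
eigenvalue on monomials of degree `a` in `z_i` is
`q^(2 α a) (q^x; q²)_a / (q^y; q²)_a`. -/
def diagFactor {σ : Type} (q : ℂ) (i : σ) (α x y : ℂ) : Op σ :=
  eulerFun i fun a =>
    q ^ (2 * α * a) * (qPoch (q ^ x) (q ^ 2) a / qPoch (q ^ y) (q ^ 2) a)

/-- The factor `ℛ⁻_ij(u₊, u₋ | v₋)`. -/
def Rminus {σ : Type} (q : ℂ) (i j : σ) (up um vm : ℂ) : Op σ :=
  qExp q i j (q ^ (um - up + 2)) *
    diagFactor q i ((vm - um) / 2) (2 * up - 2 * vm) (2 * up - 2 * um) *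
      qExpInv q i j (q ^ (vm - up + 2))

/-- The factor `ℛ⁺_ij(u₊ | v₊, v₋)`. -/
def Rplus {σ : Type} (q : ℂ) (i j : σ) (up vp vm : ℂ) : Op σ :=
  qExp q j i (q ^ (vm - vp + 2)) *
    diagFactor q j ((vp - up) / 2) (2 * up - 2 * vm) (2 * vp - 2 * vm) *
      qExpInv q j i (q ^ (2 + vm - up))

/-- `Ř_ij(u₊, u₋ | v₊, v₋) = ℛ⁺_ij(u₊ | v₊, u₋) ℛ⁻_ij(u₊, u₋ | v₋)`. -/
def Rcheck {σ : Type} (q : ℂ) (i j : σ) (up um vp vm : ℂ) : Op σ :=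
  Rplus q i j up vp um * Rminus q i j up um vm

/-- `ℝ_ij(w) = P_ij Ř_ij` for spins `ℓ`, `ℓ'` in the variables `z_i`, `z_j` and difference `w` of
the spectral parameters: `u_± = w ± ℓ`, `v_± = ± ℓ'`. -/
def Rop {σ : Type} [DecidableEq σ] (q : ℂ) (i j : σ) (ℓ ℓ' w : ℂ) : Op σ :=
  perm i j * Rcheck q i j (w + ℓ) (w - ℓ) ℓ' (-ℓ')

/-! ### The periodic chain

The quantum space `V_{ℓ₁} ⊗ ⋯ ⊗ V_{ℓ_N}` is `ℂ[z_k : k ∈ Fin N]`. Adjoining the auxiliary space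
`V₀` gives polynomials in the variables indexed by `Option (Fin N)`, with `z₀` the one at `none`. -/

/-- The transfer matrix `t(u) = tr L_1(u + δ_1) ⋯ L_N(u + δ_N)`. -/
def transfer {N : ℕ} (q : ℂ) (ℓ δ : Fin N → ℂ) (u : ℂ) : Op (Fin N) :=
  Matrix.trace (List.ofFn fun k => lax q (ℓ k) k (u + δ k)).prod

/-- The product `ℝ_{10}(u + δ_1) ⋯ ℝ_{N0}(u + δ_N)`. -/
def monodromy {N : ℕ} (q : ℂ) (ℓ δ : Fin N → ℂ) (u ℓ₀ : ℂ) : Op (Option (Fin N)) :=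
  (List.ofFn fun k => Rop q (some k) none (ℓ k) ℓ₀ (u + δ k)).prod

/-- The `m`-th diagonal term of the partial trace over `V₀`: the coefficient of `z₀^m` in
`A (z₀^m Ψ)`. -/
def auxDiag {N : ℕ} (A : Op (Option (Fin N))) (m : ℕ) (Ψ : MvPolynomial (Fin N) ℂ) :
    MvPolynomial (Fin N) ℂ :=
  (MvPolynomial.optionEquivLeft ℂ (Fin N)
    (A (MvPolynomial.X none ^ m * MvPolynomial.rename some Ψ))).coeff m

/-- The series `∑_m` of diagonal terms converges (coefficientwise) to `T`, that is
`T = tr_{V₀} A`. -/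
def HasAuxTrace {N : ℕ} (A : Op (Option (Fin N))) (T : Op (Fin N)) : Prop :=
  ∀ (Ψ : MvPolynomial (Fin N) ℂ) (s : Fin N →₀ ℕ),
    HasSum (fun m => (auxDiag A m Ψ).coeff s) ((T Ψ).coeff s)

open Classical in
/-- The partial trace over `V₀` (zero if the series does not converge). -/
def auxTrace {N : ℕ} (A : Op (Option (Fin N))) : Op (Fin N) :=
  if h : ∃ T, HasAuxTrace A T then h.choose else 0

/-- The generalized transfer matrix
`Q(u, ℓ₀) = tr_{V₀} ℝ_{10}(u + δ_1) ⋯ ℝ_{N0}(u + δ_N)`. -/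
def genTransfer {N : ℕ} (q : ℂ) (ℓ δ : Fin N → ℂ) (u ℓ₀ : ℂ) : Op (Fin N) :=
  auxTrace (monodromy q ℓ δ u ℓ₀)

/-- `Q(u₁ | u₂) = Q(u, ℓ₀)` for the solution `u`, `ℓ₀` of `u₁ = 1 + u - ℓ₀`, `u₂ = u + ℓ₀`. -/
def baxterQ {N : ℕ} (q : ℂ) (ℓ δ : Fin N → ℂ) (u₁ u₂ : ℂ) : Op (Fin N) :=
  genTransfer q ℓ δ ((u₁ + u₂ - 1) / 2) ((1 + u₂ - u₁) / 2)

/-- `u₁` is not a pole: no denominator `(q^(2 + 2ℓ_k - 2u₁ - 2δ_k); q²)_j` of the operators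
`ℝ_{k0}` vanishes. -/
def Regular {N : ℕ} (q : ℂ) (ℓ δ : Fin N → ℂ) (u₁ : ℂ) : Prop :=
  ∀ (k : Fin N) (j : ℕ), q ^ (2 + 2 * ℓ k - 2 * u₁ - 2 * δ k + 2 * j) ≠ 1

/-- The set of parameters `(u₁, u₂)` at which `Q(u₁ | u₂)` is defined: the operators `ℝ_{k0}` have
no pole and the trace over `V₀` converges. -/
def domainQ {N : ℕ} (q : ℂ) (ℓ δ : Fin N → ℂ) : Set (ℂ × ℂ) :=
  {w | Regular q ℓ δ w.1 ∧
    ∃ T, HasAuxTrace (monodromy q ℓ δ ((w.1 + w.2 - 1) / 2) ((1 + w.2 - w.1) / 2)) T}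

/-- `Δ₊(u) = ∏_k [u + δ_k + ℓ_k]_q`. -/
def deltaPlus {N : ℕ} (q : ℂ) (ℓ δ : Fin N → ℂ) (u : ℂ) : ℂ := ∏ k, qNum q (u + δ k + ℓ k)

/-- `Δ₋(u) = ∏_k [u + δ_k - ℓ_k]_q`. -/
def deltaMinus {N : ℕ} (q : ℂ) (ℓ δ : Fin N → ℂ) (u : ℂ) : ℂ := ∏ k, qNum q (u + δ k - ℓ k)

end XXZ

end

/-!
# Two-parametric Baxter operators of the inhomogeneous XXZ chain

All operators in question are explicit enough for a verification on monomials, and the theorem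
follows from identities between matrix elements graded by the degree in the auxiliary variable `z₀`.

*Closed form.* By the `q`-Chu–Vandermonde sum, `ℛ⁻_ij` sends `z_i^a` to a multiple of the coefficient
of `t^a` in a product of two `q`-binomial series, in `z_i t` and in `z_j t` (`Rminus_X_pow`), and it is
linear over the other variables. Relations between `ℛ⁻` and the entries of a Lax matrix thus become
polynomial consequences of the functional equations of these series; `ℛ⁺` is `ℛ⁻` with the variables
exchanged and the signs of the parameters reversed (`Rplus_eq_Rminus`).

*Local relations.* `ℛ⁻` and `ℛ⁺` exchange parameters in a product of two Lax matrices
(`Rminus_intertwines`, `Rplus_intertwines`). Moreover, a product of a Lax matrix at the special point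
`u₂` or `u₁` with `ℝ_{k0}(u₁ | u₂)` becomes triangular after a gauge transformation in `z₀`, with shifted
operators on the diagonal (`siteR_mul_lax`, `lax_mul_siteR`). Operators of different sites commute, so
that these relations hold for the whole chain (`chainR_intertwines`,
`chainR_mul_chainLax_mul_gaugeG`, `chainLax_mul_chainR_mul_gaugeG`).

*Traces.* The trace over `V₀` is a series, and cyclicity cannot be taken for granted. It holds degree by
degree, however, if `(z₀^d, 0)` and `(0, z₀^(d+1))` are grouped together: the gauge matrix and the Lax
matrix in the auxiliary space mix only these two (`auxCoeff_gauge`, `auxCoeff_laxPM`). This gives finite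
relations between the terms `Q_d` of the trace, which are summed afterwards
(`HasOpSum.add_eq_add`): the two Baxter relations and
`Q_d A + Q_{d+1} D = A Q_d + D Q_{d+1}`, where `A = A(v)`, `D = D(v)` are the diagonal entries of the chain
of Lax matrices.

*Commutativity.* The last relation says that the formal series `∑_d x^d Q_d` commutes with `D + x A`.
On polynomials of fixed degree, `D` is triangular (`coeff_prod_lax_one_one`), and for generic
inhomogeneities and `v` its diagonal entries are distinct. Then its commutant consists of polynomials in
`D`, and all formal series commuting with `D + x A` commute with each other
(`powerSeries_commute_of_commute_pencil`). Hence `∑_{d + e = n} Q_d Q'_e = ∑_{d + e = n} Q'_d Q_e` for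
generic inhomogeneities, then for all of them by continuity, and a Cauchy product yields `Q Q' = Q' Q`.

*Convergence.* The matrix elements of `ℝ_{k0}` at fixed degrees in `z_k` grow in the degree in `z₀` with a
rate arbitrarily close to `|q^(2 ℓ_k)|` if `|q| < 1` and to `|q^(-2 ℓ_k)|` if `|q| > 1`
(`exists_siteR_bound`). As the degree is conserved, those of the product grow with the product of these
rates (`exists_prod_siteR_bound`), and the trace converges geometrically.
-/

open scoped BigOperators

noncomputable section

namespace XXZ

/-! ### `q`-Pochhammer symbols and `q`-binomial series -/

lemma qPoch_zero (a p : ℂ) : qPoch a p 0 = 1 := by simp [qPoch]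

lemma qPoch_succ (a p : ℂ) (n : ℕ) : qPoch a p (n + 1) = qPoch a p n * (1 - p ^ n * a) :=
  Finset.prod_range_succ _ _

lemma qPoch_succ' (a p : ℂ) (n : ℕ) : qPoch a p (n + 1) = (1 - a) * qPoch (a * p) p n := by
  unfold qPoch
  rw [Finset.prod_range_succ']
  simp only [pow_zero, one_mul]
  rw [mul_comm]
  congr 1
  refine Finset.prod_congr rfl fun k _ => ?_
  ring

lemma qPoch_self_ne_zero {p : ℂ} (hp : ∀ n : ℕ, 0 < n → p ^ n ≠ 1) (n : ℕ) : qPoch p p n ≠ 0 := by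
  unfold qPoch
  refine Finset.prod_ne_zero_iff.mpr fun k _ h => hp (k + 1) k.succ_pos ?_
  rw [pow_succ]
  linear_combination -h

/-- The coefficient `(A; p)_n / (p; p)_n` of the `q`-binomial series. -/
def qCoeff (p A : ℂ) (n : ℕ) : ℂ := qPoch A p n / qPoch p p n

lemma qCoeff_zero (p A : ℂ) : qCoeff p A 0 = 1 := by simp [qCoeff, qPoch_zero]

lemma qCoeff_succ {p : ℂ} (hp : ∀ n : ℕ, 0 < n → p ^ n ≠ 1) (A : ℂ) (n : ℕ) :
    qCoeff p A (n + 1) * (1 - p ^ (n + 1)) = qCoeff p A n * (1 - p ^ n * A) := by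
  have h := qPoch_self_ne_zero hp n
  have h' : 1 - p ^ n * p ≠ 0 := by
    rw [← pow_succ]; exact sub_ne_zero.mpr (hp (n + 1) n.succ_pos).symm
  unfold qCoeff
  rw [qPoch_succ, qPoch_succ, pow_succ]
  field_simp

lemma qCoeff_mul_base (p A : ℂ) (n : ℕ) :
    (1 - A) * qCoeff p (A * p) n = qCoeff p A n * (1 - p ^ n * A) := by
  unfold qCoeff
  rw [← mul_div_assoc, ← qPoch_succ', qPoch_succ]
  ring

lemma qCoeff_div_base {p : ℂ} (hp0 : p ≠ 0) (hp : ∀ n : ℕ, 0 < n → p ^ n ≠ 1) (A : ℂ) (n : ℕ) :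
    qCoeff p (A / p) (n + 1) = qCoeff p A (n + 1) - A / p * qCoeff p A n := by
  have h := qPoch_self_ne_zero hp n
  have h' : 1 - p ^ n * p ≠ 0 := by
    rw [← pow_succ]; exact sub_ne_zero.mpr (hp (n + 1) n.succ_pos).symm
  unfold qCoeff
  rw [qPoch_succ' (A / p), div_mul_cancel₀ _ hp0, qPoch_succ A, qPoch_succ p p]
  generalize p ^ n = P at *
  rw [mul_comm] at h'
  rw [mul_comm P p]
  field_simp
  ring

section Series

variable {R : Type*} [CommRing R]

/-- The linear series `x t`. -/
def lin (x : R) : PowerSeries R := PowerSeries.X * PowerSeries.C x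

lemma coeff_lin_mul (x : R) (n : ℕ) (f : PowerSeries R) :
    PowerSeries.coeff (n + 1) (lin x * f) = x * PowerSeries.coeff n f := by
  rw [lin, mul_assoc, PowerSeries.coeff_succ_X_mul, PowerSeries.coeff_C_mul]

lemma coeff_zero_lin_mul (x : R) (f : PowerSeries R) :
    PowerSeries.coeff 0 (lin x * f) = 0 := by
  rw [lin, mul_assoc, PowerSeries.coeff_zero_X_mul]

lemma lin_mul (x y : R) : lin (x * y) = PowerSeries.C x * lin y := by
  rw [lin, lin, map_mul]; ring

variable [Algebra ℂ R]

/-- The `q`-binomial series `∑_n (A; p)_n / (p; p)_n x^n t^n` in the variable `t`, that is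
`(A x t; p)_∞ / (x t; p)_∞` if `|p| < 1`. -/
def qSer (p A : ℂ) (x : R) : PowerSeries R := PowerSeries.mk fun n => qCoeff p A n • x ^ n

/-- A complex number as a constant power series. -/
def cst (R : Type*) [CommRing R] [Algebra ℂ R] : ℂ →+* PowerSeries R :=
  (PowerSeries.C (R := R)).comp (algebraMap ℂ R)

lemma coeff_cst_mul (c : ℂ) (n : ℕ) (f : PowerSeries R) :
    PowerSeries.coeff n (cst R c * f) = c • PowerSeries.coeff n f := by
  simp [cst, Algebra.smul_def]

lemma lin_smul (c : ℂ) (x : R) : lin (c • x) = cst R c * lin x := by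
  rw [Algebra.smul_def, lin_mul]; rfl

lemma coeff_qSer (p A : ℂ) (x : R) (n : ℕ) :
    PowerSeries.coeff n (qSer p A x) = qCoeff p A n • x ^ n := by simp [qSer]

/-- The functional equation `(1 - x t) Φ_A(x t) = (1 - A x t) Φ_A(p x t)`. -/
lemma qSer_functional {p : ℂ} (hp : ∀ n : ℕ, 0 < n → p ^ n ≠ 1) (A : ℂ) (x : R) :
    (1 - lin x) * qSer p A x = (1 - cst R A * lin x) * qSer p A (p • x) := by
  ext n
  rw [sub_mul, sub_mul, one_mul, one_mul, map_sub, map_sub, mul_assoc, coeff_cst_mul]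
  cases n with
  | zero => simp [coeff_zero_lin_mul, coeff_qSer]
  | succ n =>
    rw [coeff_lin_mul, coeff_lin_mul]
    simp only [coeff_qSer, smul_pow, mul_smul_comm, ← pow_succ', smul_smul, ← sub_smul]
    congr 1
    linear_combination qCoeff_succ hp A n

/-- The contiguous relation raising the parameter, `(1 - A) Φ_{Ap}(x t) = Φ_A(x t) - A Φ_A(p x t)`. -/
lemma qSer_mul_base (p A : ℂ) (x : R) :
    (1 - cst R A) * qSer p (A * p) x = qSer p A x - cst R A * qSer p A (p • x) := by
  ext n
  rw [sub_mul, one_mul, map_sub, map_sub, coeff_cst_mul, coeff_cst_mul]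
  simp only [coeff_qSer, smul_pow, smul_smul, ← sub_smul]
  congr 1
  linear_combination qCoeff_mul_base p A n

/-- The contiguous relation lowering the parameter, `Φ_{A/p}(x t) = (1 - (A / p) x t) Φ_A(x t)`. -/
lemma qSer_div_base {p : ℂ} (hp0 : p ≠ 0) (hp : ∀ n : ℕ, 0 < n → p ^ n ≠ 1) (A : ℂ) (x : R) :
    qSer p (A / p) x = (1 - cst R (A / p) * lin x) * qSer p A x := by
  ext n
  rw [sub_mul, one_mul, map_sub, mul_assoc, coeff_cst_mul]
  cases n with
  | zero => simp [coeff_zero_lin_mul, coeff_qSer, qCoeff_zero]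
  | succ n =>
    rw [coeff_lin_mul]
    simp only [coeff_qSer, mul_smul_comm, ← pow_succ', smul_smul, ← sub_smul]
    rw [qCoeff_div_base hp0 hp]

/-- `Φ_{A/p}(p x t) = (1 - x t) Φ_A(x t)`, from the lowering relation and the functional equation. -/
lemma qSer_div_base_shift {p : ℂ} (hp0 : p ≠ 0) (hp : ∀ n : ℕ, 0 < n → p ^ n ≠ 1) (A : ℂ) (x : R) :
    qSer p (A / p) (p • x) = (1 - lin x) * qSer p A x := by
  rw [qSer_div_base hp0 hp, qSer_functional hp]
  rw [lin_smul, ← mul_assoc, ← map_mul, div_mul_cancel₀ _ hp0]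

/-- The coefficient of `t^a` in the product `Φ_A(x t) Φ_B(y t)`, a homogeneous polynomial in `x`
and `y` (for `A = B` a continuous `q`-ultraspherical polynomial in homogeneous coordinates). -/
def qHerm (p A B : ℂ) (x y : R) (a : ℕ) : R := PowerSeries.coeff a (qSer p A x * qSer p B y)

lemma qHerm_eq_sum (p A B : ℂ) (x y : R) (a : ℕ) :
    qHerm p A B x y a = ∑ n ∈ Finset.HasAntidiagonal.antidiagonal a,
      (qCoeff p A n.1 * qCoeff p B n.2) • (x ^ n.1 * y ^ n.2) := by
  simp only [qHerm, PowerSeries.coeff_mul, coeff_qSer, smul_mul_smul_comm]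

lemma qHerm_smul_smul (p A B r : ℂ) (x y : R) (a : ℕ) :
    qHerm p A B (r • x) (r • y) a = r ^ a • qHerm p A B x y a := by
  rw [qHerm_eq_sum, qHerm_eq_sum, Finset.smul_sum]
  refine Finset.sum_congr rfl fun n hn => ?_
  rw [Finset.HasAntidiagonal.mem_antidiagonal] at hn
  rw [smul_pow, smul_pow, smul_mul_smul_comm, ← pow_add, hn, smul_comm]

end Series

/-! ### Operators linear over the remaining variables -/

section Operators

variable {σ : Type}

open MvPolynomial

lemma onMonomials_monomial (f : (σ →₀ ℕ) → MvPolynomial σ ℂ) (s : σ →₀ ℕ) :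
    onMonomials f (monomial s 1) = f s := by
  have := (MvPolynomial.basisMonomials σ ℂ).constr_basis ℂ f s
  rwa [MvPolynomial.coe_basisMonomials] at this

lemma monomial_eq_smul (s : σ →₀ ℕ) (c : ℂ) :
    monomial s c = c • (monomial s 1 : MvPolynomial σ ℂ) := by
  rw [smul_monomial, smul_eq_mul, mul_one]

lemma op_ext {A B : Op σ} (h : ∀ s, A (monomial s 1) = B (monomial s 1)) : A = B := by
  refine (MvPolynomial.basisMonomials σ ℂ).ext fun s => ?_
  simpa using h s

lemma eulerFun_monomial (i : σ) (f : ℕ → ℂ) (s : σ →₀ ℕ) (c : ℂ) :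
    eulerFun i f (monomial s c) = monomial s (f (s i) * c) := by
  rw [monomial_eq_smul, map_smul, eulerFun, onMonomials_monomial, smul_monomial, smul_eq_mul,
    mul_comm]

lemma coeff_eulerFun (i : σ) (f : ℕ → ℂ) (s : σ →₀ ℕ) (Φ : MvPolynomial σ ℂ) :
    coeff s (eulerFun i f Φ) = f (s i) * coeff s Φ := by
  classical
  induction Φ using MvPolynomial.induction_on' with
  | monomial t c =>
    rw [eulerFun_monomial, coeff_monomial, coeff_monomial]
    split_ifs with h
    · rw [h]
    · simp
  | add a b ha hb => rw [map_add, coeff_add, ha, hb, coeff_add, mul_add]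

lemma eulerFun_mul (i : σ) (f g : ℕ → ℂ) :
    eulerFun i f * eulerFun i g = eulerFun i fun a => f a * g a := by
  refine op_ext fun s => ?_
  simp [Module.End.mul_apply, eulerFun_monomial]

lemma eulerFun_smul (i : σ) (c : ℂ) (f : ℕ → ℂ) :
    c • eulerFun i f = eulerFun i fun a => c * f a := by
  refine op_ext fun s => ?_
  simp [eulerFun_monomial, smul_monomial]

@[simp] lemma mulZ_apply (i : σ) (Φ : MvPolynomial σ ℂ) : mulZ i Φ = X i * Φ := rfl

/-- An operator is *linear away from `z_i`* if it commutes with the multiplication by all the other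
variables. -/
def LinearAway (i : σ) (A : Op σ) : Prop := ∀ l, l ≠ i → Commute A (mulZ l)

namespace LinearAway

variable {i : σ} {A B : Op σ}

lemma mul (hA : LinearAway i A) (hB : LinearAway i B) : LinearAway i (A * B) :=
  fun l hl => (hA l hl).mul_left (hB l hl)

lemma add (hA : LinearAway i A) (hB : LinearAway i B) : LinearAway i (A + B) :=
  fun l hl => (hA l hl).add_left (hB l hl)

lemma sub (hA : LinearAway i A) (hB : LinearAway i B) : LinearAway i (A - B) :=
  fun l hl => (hA l hl).sub_left (hB l hl)

lemma neg (hA : LinearAway i A) : LinearAway i (-A) := fun l hl => (hA l hl).neg_left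

lemma smul (c : ℂ) (hA : LinearAway i A) : LinearAway i (c • A) :=
  fun l hl => (hA l hl).smul_left c

lemma pow (hA : LinearAway i A) (n : ℕ) : LinearAway i (A ^ n) :=
  fun l hl => (hA l hl).pow_left n

lemma apply_X_mul (hA : LinearAway i A) {l : σ} (hl : l ≠ i) (Φ : MvPolynomial σ ℂ) :
    A (X l * Φ) = X l * A Φ := LinearMap.congr_fun (hA l hl) Φ

lemma apply_X_pow_mul (hA : LinearAway i A) {l : σ} (hl : l ≠ i) (n : ℕ) (Φ : MvPolynomial σ ℂ) :
    A (X l ^ n * Φ) = X l ^ n * A Φ := by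
  induction n generalizing Φ with
  | zero => simp
  | succ n ih => rw [pow_succ, mul_assoc, ih, hA.apply_X_mul hl, mul_assoc]

/-- Operators that are linear away from `z_i` are determined by their values on powers of `z_i`. -/
lemma ext (hA : LinearAway i A) (hB : LinearAway i B) (h : ∀ a, A (X i ^ a) = B (X i ^ a)) :
    A = B := by
  have key : ∀ Φ : MvPolynomial σ ℂ, ∀ a, A (X i ^ a * Φ) = B (X i ^ a * Φ) := by
    intro Φ
    induction Φ using MvPolynomial.induction_on with
    | C c =>
      intro a
      rw [mul_comm, ← smul_eq_C_mul, map_smul, map_smul, h]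
    | add p q hp hq => intro a; rw [mul_add, map_add, map_add, hp, hq]
    | mul_X p l hp =>
      intro a
      by_cases hl : l = i
      · subst hl
        rw [mul_comm p, ← mul_assoc, ← pow_succ, hp]
      · rw [← mul_assoc, mul_comm, hA.apply_X_mul hl, hB.apply_X_mul hl, hp]
  refine LinearMap.ext fun Φ => ?_
  simpa using key Φ 0

lemma mulZ (l : σ) : LinearAway i (mulZ l : Op σ) := fun l' _ => by
  refine LinearMap.ext fun Φ => ?_
  simp only [Module.End.mul_apply, mulZ_apply]
  ring

lemma of_monomial (h : ∀ l, l ≠ i → ∀ s,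
    A (monomial (Finsupp.single l 1 + s) 1) = X l * A (monomial s 1)) : LinearAway i A := by
  intro l hl
  refine op_ext fun s => ?_
  rw [Module.End.mul_apply, Module.End.mul_apply, mulZ_apply, mulZ_apply, ← h l hl]
  rw [X, monomial_mul, one_mul]

lemma eulerFun (f : ℕ → ℂ) : LinearAway i (eulerFun i f) := by
  refine of_monomial fun l hl s => ?_
  rw [eulerFun_monomial, eulerFun_monomial, X, monomial_mul]
  simp [hl]

lemma divZ : LinearAway i (divZ i) := by
  refine of_monomial fun l hl s => ?_
  rw [XXZ.divZ, onMonomials_monomial, onMonomials_monomial]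
  have hs : (Finsupp.single l 1 + s : σ →₀ ℕ) i = s i := by simp [hl]
  by_cases h : s i = 0
  · rw [if_pos (hs.trans h), if_pos h, mul_zero]
  · rw [if_neg (fun h' => h (hs.symm.trans h')), if_neg h, X, monomial_mul, one_mul]
    refine congrArg (fun t => monomial t (1 : ℂ)) (Finsupp.ext fun k => ?_)
    by_cases hk : k = i
    · subst hk; simp [hl]
    · simp [Ne.symm hk]

lemma weylU (q : ℂ) (j : σ) : LinearAway i (weylU q i j) :=
  ((mulZ j).mul divZ).mul (eulerFun _)

lemma sum_pow (hA : LinearAway i A) (c : ℕ → ℂ) :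
    LinearAway i (onMonomials fun s => ∑ n ∈ Finset.range (s i + 1),
      c n • (A ^ n) (monomial s 1)) := by
  refine of_monomial fun l hl s => ?_
  rw [onMonomials_monomial, onMonomials_monomial, Finset.mul_sum]
  have : (Finsupp.single l 1 + s : σ →₀ ℕ) i = s i := by simp [hl]
  rw [this]
  refine Finset.sum_congr rfl fun n _ => ?_
  rw [mul_smul_comm, ← (hA.pow n).apply_X_mul hl, X, monomial_mul, one_mul]

lemma qExp (q : ℂ) (j : σ) (x : ℂ) : LinearAway i (qExp q i j x) := sum_pow (weylU q j) _

lemma qExpInv (q : ℂ) (j : σ) (x : ℂ) : LinearAway i (qExpInv q i j x) := sum_pow (weylU q j) _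

lemma Rminus (q : ℂ) (j : σ) (up um vm : ℂ) : LinearAway i (Rminus q i j up um vm) :=
  ((qExp q j _).mul (eulerFun _)).mul (qExpInv q j _)

lemma sMinus (q : ℂ) : LinearAway i (sMinus q i) := (divZ.mul (eulerFun _)).neg

end LinearAway

lemma eulerFun_X_pow (i : σ) (f : ℕ → ℂ) (a : ℕ) :
    eulerFun i f (X i ^ a) = f a • X i ^ a := by
  rw [X_pow_eq_monomial, eulerFun_monomial, smul_monomial]
  simp

lemma divZ_X_pow_succ (i : σ) (a : ℕ) : divZ i (X i ^ (a + 1) : MvPolynomial σ ℂ) = X i ^ a := by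
  rw [X_pow_eq_monomial, divZ, onMonomials_monomial, X_pow_eq_monomial]
  simp

lemma divZ_one (i : σ) : divZ i (1 : MvPolynomial σ ℂ) = 0 := by
  have : (1 : MvPolynomial σ ℂ) = monomial 0 1 := rfl
  rw [this, divZ, onMonomials_monomial]
  simp

/-- Multiplication by `z_i` undoes the division, if there are no terms of degree zero. -/
lemma mulZ_mul_divZ_mul_eulerFun (i : σ) (f : ℕ → ℂ) (hf : f 0 = 0) :
    mulZ i * divZ i * eulerFun i f = eulerFun i f := by
  refine (((LinearAway.mulZ i).mul .divZ).mul (.eulerFun f)).ext (.eulerFun f) fun a => ?_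
  rw [Module.End.mul_apply, Module.End.mul_apply, eulerFun_X_pow, map_smul]
  cases a with
  | zero => simp [hf]
  | succ a => rw [divZ_X_pow_succ, map_smul, mulZ_apply, pow_succ']

end Operators

/-! ### The factors of the `R`-operator in closed form -/

section ClosedForm

open MvPolynomial

/-- The eigenvalue `∏_{r < n} (1 - p^(-(m + r + 1)))` by which the `n`-th power of the Weyl operator
multiplies `z_i^(m + n)`, before `z_i^n` is replaced with `z_j^n`. -/
def weylFactor (p : ℂ) (m n : ℕ) : ℂ := ∏ r ∈ Finset.range n, (1 - (p ^ (m + r + 1))⁻¹)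

lemma weylFactor_succ (p : ℂ) (m n : ℕ) :
    weylFactor p m (n + 1) = weylFactor p m n * (1 - (p ^ (m + n + 1))⁻¹) :=
  Finset.prod_range_succ _ _

lemma weylFactor_succ' (p : ℂ) (m n : ℕ) :
    weylFactor p m (n + 1) = (1 - (p ^ (m + 1))⁻¹) * weylFactor p (m + 1) n := by
  unfold weylFactor
  rw [Finset.prod_range_succ', mul_comm]
  congr 1
  refine Finset.prod_congr rfl fun r _ => ?_
  rw [show m + (r + 1) + 1 = m + 1 + r + 1 by ring]

lemma weylFactor_add (p : ℂ) (m k n : ℕ) :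
    weylFactor p m (k + n) = weylFactor p m k * weylFactor p (m + k) n := by
  unfold weylFactor
  rw [Finset.prod_range_add]
  simp only [add_assoc]

/-- A sum over triples with sum `a`, arranged in two ways. -/
lemma sum_antidiagonal_assoc {M : Type*} [AddCommMonoid M] (F : ℕ → ℕ → ℕ → M) (a : ℕ) :
    ∑ x ∈ Finset.HasAntidiagonal.antidiagonal a,
        ∑ y ∈ Finset.HasAntidiagonal.antidiagonal x.1, F y.1 y.2 x.2 =
      ∑ x ∈ Finset.HasAntidiagonal.antidiagonal a,
        ∑ y ∈ Finset.HasAntidiagonal.antidiagonal x.2, F x.1 y.1 y.2 := by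
  rw [Finset.sum_sigma', Finset.sum_sigma']
  refine Finset.sum_nbij' (fun z => ⟨(z.2.1, z.2.2 + z.1.2), (z.2.2, z.1.2)⟩)
    (fun z => ⟨(z.1.1 + z.2.1, z.2.2), (z.1.1, z.2.1)⟩) ?_ ?_ ?_ ?_ ?_
  · rintro ⟨⟨x, y⟩, ⟨z, w⟩⟩ h
    simp only [Finset.mem_sigma, Finset.HasAntidiagonal.mem_antidiagonal] at h ⊢
    exact ⟨by omega, trivial⟩
  · rintro ⟨⟨x, y⟩, ⟨z, w⟩⟩ h
    simp only [Finset.mem_sigma, Finset.HasAntidiagonal.mem_antidiagonal] at h ⊢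
    exact ⟨by omega, trivial⟩
  · rintro ⟨⟨x, y⟩, ⟨z, w⟩⟩ h
    simp only [Finset.mem_sigma, Finset.HasAntidiagonal.mem_antidiagonal] at h
    simp [h.2]
  · rintro ⟨⟨x, y⟩, ⟨z, w⟩⟩ h
    simp only [Finset.mem_sigma, Finset.HasAntidiagonal.mem_antidiagonal] at h
    simp [h.2]
  · rintro ⟨⟨x, y⟩, ⟨z, w⟩⟩ h
    rfl

variable {σ : Type}

lemma q_cpow_neg_two_mul {q : ℂ} (a : ℕ) : q ^ (-2 * (a : ℂ)) = ((q ^ 2) ^ a)⁻¹ := by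
  rw [← pow_mul, neg_mul, Complex.cpow_neg]
  congr 1
  exact_mod_cast Complex.cpow_natCast q (2 * a)

/-- `𝐮_ij^n` transfers `n` powers from `z_i` to `z_j`. -/
lemma weylU_pow_X_pow {q : ℂ} {i j : σ} (hij : i ≠ j) (m n : ℕ) :
    (weylU q i j ^ n) (X i ^ (m + n)) =
      weylFactor (q ^ 2) m n • (X i ^ m * X j ^ n : MvPolynomial σ ℂ) := by
  induction n with
  | zero => simp [weylFactor]
  | succ n ih =>
    rw [pow_succ, Module.End.mul_apply]
    have h1 : weylU q i j (X i ^ (m + (n + 1))) =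
        (1 - ((q ^ 2) ^ (m + n + 1))⁻¹) • (X j * X i ^ (m + n) : MvPolynomial σ ℂ) := by
      rw [weylU, Module.End.mul_apply, Module.End.mul_apply, eulerFun_X_pow, map_smul, map_smul,
        ← add_assoc, divZ_X_pow_succ, q_cpow_neg_two_mul, mulZ_apply]
    rw [h1, map_smul, ((LinearAway.weylU q j).pow n).apply_X_mul hij.symm, ih, weylFactor_succ,
      mul_smul_comm, smul_smul, mul_comm (weylFactor _ _ _)]
    congr 1
    ring

lemma sum_weylU_X_pow {q : ℂ} {i j : σ} (hij : i ≠ j) (c : ℕ → ℂ) (a : ℕ) :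
    (onMonomials fun s => ∑ n ∈ Finset.range (s i + 1), c n • (weylU q i j ^ n) (monomial s 1))
      (X i ^ a) = ∑ x ∈ Finset.HasAntidiagonal.antidiagonal a,
        (c x.2 * weylFactor (q ^ 2) x.1 x.2) • (X i ^ x.1 * X j ^ x.2 : MvPolynomial σ ℂ) := by
  rw [X_pow_eq_monomial, onMonomials_monomial, Finsupp.single_eq_same, ← X_pow_eq_monomial,
    ← Finset.Nat.sum_antidiagonal_swap, Finset.Nat.sum_antidiagonal_eq_sum_range_succ_mk]
  refine Finset.sum_congr rfl fun n hn => ?_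
  have hn' : n ≤ a := Nat.lt_succ_iff.mp (Finset.mem_range.mp hn)
  obtain ⟨m, rfl⟩ := Nat.exists_eq_add_of_le' hn'
  simp only [Prod.fst_swap, Prod.snd_swap, Nat.add_sub_cancel]
  rw [weylU_pow_X_pow hij, smul_smul]

/-- The normalization `(p; p)_a / (C; p)_a`. -/
def qNorm (p C : ℂ) (a : ℕ) : ℂ := qPoch p p a / qPoch C p a

/-- The coefficient of `z_i^m z_j^b` in the image of `z_i^(m + b)` under `ℛ⁻_ij`. -/
def rCoeff (p α β : ℂ) (m b : ℕ) : ℂ :=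
  qNorm p (α ^ 2 * β ^ 2) (m + b) * (qCoeff p (α ^ 2) m * qCoeff p (β ^ 2) b) * (β ^ m * α ^ b)

/-- The terms of the `q`-Chu–Vandermonde sum evaluated below. -/
def vanderSum (p α β : ℂ) (m b : ℕ) : ℂ :=
  ∑ x ∈ Finset.HasAntidiagonal.antidiagonal b,
    ((p / (α * β)) ^ x.1 / qPoch p p x.1) *
      ((-1) ^ x.2 * p ^ (x.2 * (x.2 - 1) / 2) * (p / α) ^ x.2 / qPoch p p x.2) *
      (β ^ (m + x.1) * (qPoch (α ^ 2) p (m + x.1) / qPoch (α ^ 2 * β ^ 2) p (m + x.1)))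

/-- The recursion of the sum, from splitting `1 - p^(b+1) = (1 - p^k) + p^k (1 - p^n)` in the term with
`k + n = b + 1`. -/
lemma vanderSum_succ {p : ℂ} (hp : ∀ n : ℕ, 0 < n → p ^ n ≠ 1) (α β : ℂ) (m b : ℕ) :
    (1 - p ^ (b + 1)) * vanderSum p α β m (b + 1) =
      p / (α * β) * vanderSum p α β (m + 1) b - p / α * p ^ b * vanderSum p α β m b := by
  set e : ℕ → ℂ := fun k => (p / (α * β)) ^ k / qPoch p p k with he
  set f : ℕ → ℂ := fun n => (-1) ^ n * p ^ (n * (n - 1) / 2) * (p / α) ^ n / qPoch p p n with hf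
  set D : ℕ → ℂ := fun a => β ^ a * (qPoch (α ^ 2) p a / qPoch (α ^ 2 * β ^ 2) p a) with hD
  have hS : ∀ m b, vanderSum p α β m b =
      ∑ x ∈ Finset.HasAntidiagonal.antidiagonal b, e x.1 * f x.2 * D (m + x.1) := fun _ _ => rfl
  have h1 : ∀ n, 1 - p ^ (n + 1) ≠ 0 := fun n => sub_ne_zero.mpr (hp (n + 1) n.succ_pos).symm
  have he' : ∀ k, (1 - p ^ (k + 1)) * e (k + 1) = p / (α * β) * e k := by
    intro k
    have := h1 k
    have h2 := qPoch_self_ne_zero hp k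
    simp only [he]
    rw [qPoch_succ, pow_succ (p / (α * β)), show 1 - p ^ k * p = 1 - p ^ (k + 1) by rw [pow_succ]]
    generalize p / (α * β) = x
    generalize 1 - p ^ (k + 1) = d at *
    field_simp
  have hf' : ∀ n, (1 - p ^ (n + 1)) * f (n + 1) = -(p / α) * p ^ n * f n := by
    intro n
    have := h1 n
    have h2 := qPoch_self_ne_zero hp n
    have h3 : (n + 1) * (n + 1 - 1) / 2 = n + n * (n - 1) / 2 := by
      rw [← Finset.sum_range_id, ← Finset.sum_range_id, Finset.sum_range_succ, add_comm]
    simp only [hf]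
    rw [qPoch_succ, pow_succ (p / α), show 1 - p ^ n * p = 1 - p ^ (n + 1) by rw [pow_succ], h3,
      pow_add p n (n * (n - 1) / 2), pow_succ (-1 : ℂ)]
    generalize p / α = x
    generalize 1 - p ^ (n + 1) = d at *
    field_simp
  have hsplit : (1 - p ^ (b + 1)) * vanderSum p α β m (b + 1) =
      (∑ x ∈ Finset.HasAntidiagonal.antidiagonal (b + 1),
        ((1 - p ^ x.1) * e x.1) * f x.2 * D (m + x.1)) +
      ∑ x ∈ Finset.HasAntidiagonal.antidiagonal (b + 1),
        e x.1 * ((1 - p ^ x.2) * f x.2) * (p ^ x.1 * D (m + x.1)) := by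
    rw [hS, Finset.mul_sum, ← Finset.sum_add_distrib]
    refine Finset.sum_congr rfl fun x hx => ?_
    rw [← Finset.HasAntidiagonal.mem_antidiagonal.mp hx, pow_add]
    ring
  rw [hsplit, Finset.Nat.sum_antidiagonal_succ, Finset.Nat.sum_antidiagonal_succ', hS, hS,
    Finset.mul_sum, Finset.mul_sum, sub_eq_add_neg (∑ i ∈ _, _), ← Finset.sum_neg_distrib]
  simp only [he', hf', pow_zero, sub_self, zero_mul, mul_zero, zero_add]
  congr 1
  · refine Finset.sum_congr rfl fun x _ => ?_
    rw [add_right_comm m 1, add_assoc m]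
    ring
  · refine Finset.sum_congr rfl fun x hx => ?_
    rw [← Finset.HasAntidiagonal.mem_antidiagonal.mp hx, pow_add]
    ring

/-- The `q`-Chu–Vandermonde evaluation that gives the matrix elements of `ℛ⁻_ij`. Both sides satisfy
the same recursion in `b`. -/
lemma vanderSum_mul_weylFactor {p α β : ℂ} (hp0 : p ≠ 0) (hp : ∀ n : ℕ, 0 < n → p ^ n ≠ 1)
    (hα : α ≠ 0) (hβ : β ≠ 0) (hC : ∀ n, qPoch (α ^ 2 * β ^ 2) p n ≠ 0) (m b : ℕ) :
    vanderSum p α β m b * weylFactor p m b = rCoeff p α β m b := by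
  have h1 : ∀ n, 1 - p ^ (n + 1) ≠ 0 := fun n => sub_ne_zero.mpr (hp (n + 1) n.succ_pos).symm
  have hCs : ∀ n, 1 - p ^ n * (α ^ 2 * β ^ 2) ≠ 0 := fun n => by
    have := hC (n + 1)
    rw [qPoch_succ] at this
    exact right_ne_zero_of_mul this
  induction b generalizing m with
  | zero =>
    have := hC m
    have := qPoch_self_ne_zero hp m
    simp only [vanderSum, rCoeff, weylFactor, qNorm, qCoeff, Finset.HasAntidiagonal.antidiagonal]
    simp [qPoch_zero]
    field_simp
  | succ b ih =>
    have hrec := vanderSum_succ hp α β m b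
    have e1 := ih m
    have e2 := ih (m + 1)
    have hw1 := weylFactor_succ p m b
    have hw2 := weylFactor_succ' p m b
    have hQA := qCoeff_succ hp (α ^ 2) m
    have hQB := qCoeff_succ hp (β ^ 2) b
    have hN : qNorm p (α ^ 2 * β ^ 2) (m + b + 1) * (1 - p ^ (m + b) * (α ^ 2 * β ^ 2)) =
        qNorm p (α ^ 2 * β ^ 2) (m + b) * (1 - p ^ (m + b + 1)) := by
      unfold qNorm
      have hc := hCs (m + b)
      have := hC (m + b)
      rw [qPoch_succ, qPoch_succ, show 1 - p ^ (m + b) * p = 1 - p ^ (m + b + 1) by rw [pow_succ]]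
      generalize 1 - p ^ (m + b) * (α ^ 2 * β ^ 2) = d at *
      field_simp
    refine mul_left_cancel₀ (h1 b) ?_
    rw [← mul_assoc, hrec, sub_mul, mul_assoc (p / (α * β)), mul_assoc (p / α * p ^ b)]
    nth_rewrite 1 [hw2]
    rw [hw1, mul_left_comm (vanderSum p α β (m + 1) b), e2, ← mul_assoc (vanderSum p α β m b), e1]
    unfold rCoeff
    rw [show m + 1 + b = m + b + 1 by ring, show m + (b + 1) = m + b + 1 by ring]
    set w := qNorm p (α ^ 2 * β ^ 2) (m + b)
    set w' := qNorm p (α ^ 2 * β ^ 2) (m + b + 1)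
    set hA := qCoeff p (α ^ 2) m
    set hA' := qCoeff p (α ^ 2) (m + 1)
    set hB := qCoeff p (β ^ 2) b
    set hB' := qCoeff p (β ^ 2) (b + 1)
    have i1 : 1 - (p ^ (m + 1))⁻¹ = -(p ^ (m + 1))⁻¹ * (1 - p ^ (m + 1)) := by
      field_simp; ring
    have i2 : 1 - (p ^ (m + b + 1))⁻¹ = -(p ^ (m + b + 1))⁻¹ * (1 - p ^ (m + b + 1)) := by
      field_simp; ring
    rw [i1, i2]
    have s1 : p / (α * β) * (-(p ^ (m + 1))⁻¹ * (1 - p ^ (m + 1)) *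
        (w' * (hA' * hB) * (β ^ (m + 1) * α ^ b))) =
        -(p ^ m)⁻¹ * α⁻¹ * (w' * (hA' * (1 - p ^ (m + 1)) * hB) * (β ^ m * α ^ b)) := by
      field_simp
      ring
    have s2 : p / α * p ^ b * (w * (hA * hB) * (β ^ m * α ^ b) *
        (-(p ^ (m + b + 1))⁻¹ * (1 - p ^ (m + b + 1)))) =
        -(p ^ m)⁻¹ * α⁻¹ * ((w * (1 - p ^ (m + b + 1))) * (hA * hB) * (β ^ m * α ^ b)) := by
      field_simp
      ring
    have s3 : (1 - p ^ (b + 1)) * (w' * (hA * hB') * (β ^ m * α ^ (b + 1))) =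
        w' * (hA * (hB' * (1 - p ^ (b + 1)))) * (β ^ m * α ^ (b + 1)) := by ring
    rw [s1, s2, s3, hQA, hQB, ← hN]
    field_simp
    ring

set_option maxHeartbeats 1000000 in
/-- `ℛ⁻_ij` on powers of `z_i`, as a sum over monomials. -/
lemma Rminus_X_pow_eq_sum {q : ℂ} (hq0 : q ≠ 0) (hq : ∀ n : ℕ, 0 < n → (q ^ 2) ^ n ≠ 1) {i j : σ}
    (hij : i ≠ j) (up um vm : ℂ)
    (hC : ∀ n, qPoch ((q ^ (up - vm)) ^ 2 * (q ^ (vm - um)) ^ 2) (q ^ 2) n ≠ 0) (a : ℕ) :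
    Rminus q i j up um vm (X i ^ a) = ∑ x ∈ Finset.HasAntidiagonal.antidiagonal a,
      rCoeff (q ^ 2) (q ^ (up - vm)) (q ^ (vm - um)) x.1 x.2 •
        (X i ^ x.1 * X j ^ x.2 : MvPolynomial σ ℂ) := by
  set p := q ^ 2 with hp
  set α := q ^ (up - vm) with hα
  set β := q ^ (vm - um) with hβ
  have hα0 : α ≠ 0 := by rw [hα]; simp [Complex.cpow_eq_zero_iff, hq0]
  have hβ0 : β ≠ 0 := by rw [hβ]; simp [Complex.cpow_eq_zero_iff, hq0]
  have hq2 : q ^ (2 : ℂ) = p := by exact_mod_cast Complex.cpow_natCast q 2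
  have hx : q ^ (um - up + 2) = p / (α * β) := by
    rw [Complex.cpow_add _ _ hq0, hq2, hα, hβ, ← Complex.cpow_add _ _ hq0, div_eq_mul_inv,
      ← Complex.cpow_neg, mul_comm]
    congr 2
    ring
  have hx' : q ^ (vm - up + 2) = p / α := by
    rw [Complex.cpow_add _ _ hq0, hq2, hα, div_eq_mul_inv, ← Complex.cpow_neg, mul_comm]
    congr 2
    ring
  have hA : q ^ (2 * up - 2 * vm) = α ^ 2 := by
    rw [hα, ← Complex.cpow_nat_mul]; congr 1; push_cast; ring
  have hCe : q ^ (2 * up - 2 * um) = α ^ 2 * β ^ 2 := by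
    rw [hα, hβ, ← mul_pow, ← Complex.cpow_add _ _ hq0, ← Complex.cpow_nat_mul]
    congr 1; push_cast; ring
  have hD : ∀ n : ℕ, q ^ (2 * ((vm - um) / 2) * n) = β ^ n := fun n => by
    rw [hβ, ← Complex.cpow_nat_mul]; congr 1; ring
  have hqq : ∀ n : ℕ, q ^ (n * (n - 1)) = p ^ (n * (n - 1) / 2) := fun n => by
    rw [hp, ← pow_mul, Nat.mul_div_cancel' (Nat.even_mul_pred_self n).two_dvd]
  rw [Rminus, Module.End.mul_apply, Module.End.mul_apply, qExpInv, sum_weylU_X_pow hij, map_sum,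
    map_sum]
  have hterm : ∀ x : ℕ × ℕ, ∀ c : ℂ, qExp q i j (q ^ (um - up + 2))
      (diagFactor q i ((vm - um) / 2) (2 * up - 2 * vm) (2 * up - 2 * um)
        (c • (X i ^ x.1 * X j ^ x.2 : MvPolynomial σ ℂ))) =
      ∑ y ∈ Finset.HasAntidiagonal.antidiagonal x.1,
        (c * (β ^ x.1 * (qPoch (α ^ 2) p x.1 / qPoch (α ^ 2 * β ^ 2) p x.1)) *
          ((p / (α * β)) ^ y.2 / qPoch p p y.2) * weylFactor p y.1 y.2) •
            (X i ^ y.1 * X j ^ (y.2 + x.2)) := by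
    intro x c
    rw [map_smul, map_smul, diagFactor, mul_comm (X i ^ x.1),
      (LinearAway.eulerFun _).apply_X_pow_mul hij.symm, eulerFun_X_pow, mul_smul_comm, map_smul,
      (LinearAway.qExp q j _).apply_X_pow_mul hij.symm, qExp, sum_weylU_X_pow hij, Finset.mul_sum,
      smul_smul, Finset.smul_sum]
    refine Finset.sum_congr rfl fun y _ => ?_
    rw [mul_smul_comm, smul_smul, hx, hA, hCe, hD, ← mul_assoc]
    congr 1
    ring
  simp only [hterm]
  set F : ℕ → ℕ → ℕ → MvPolynomial σ ℂ := fun m k n =>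
    ((((-1) ^ n * p ^ (n * (n - 1) / 2) * (p / α) ^ n / qPoch p p n) * weylFactor p (m + k) n) *
      (β ^ (m + k) * (qPoch (α ^ 2) p (m + k) / qPoch (α ^ 2 * β ^ 2) p (m + k))) *
      ((p / (α * β)) ^ k / qPoch p p k) * weylFactor p m k) • (X i ^ m * X j ^ (k + n)) with hF
  have h1 : ∀ x ∈ Finset.HasAntidiagonal.antidiagonal a,
      ∑ y ∈ Finset.HasAntidiagonal.antidiagonal x.1,
        ((-1) ^ x.2 * q ^ (x.2 * (x.2 - 1)) * (q ^ (vm - up + 2)) ^ x.2 / qPoch p p x.2 *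
          weylFactor p x.1 x.2 *
          (β ^ x.1 * (qPoch (α ^ 2) p x.1 / qPoch (α ^ 2 * β ^ 2) p x.1)) *
          ((p / (α * β)) ^ y.2 / qPoch p p y.2) * weylFactor p y.1 y.2) •
            (X i ^ y.1 * X j ^ (y.2 + x.2) : MvPolynomial σ ℂ) =
      ∑ y ∈ Finset.HasAntidiagonal.antidiagonal x.1, F y.1 y.2 x.2 := by
    intro x _
    refine Finset.sum_congr rfl fun y hy => ?_
    rw [← Finset.HasAntidiagonal.mem_antidiagonal.mp hy, hqq, hx']
  refine (Finset.sum_congr rfl h1).trans ((sum_antidiagonal_assoc F a).trans ?_)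
  refine Finset.sum_congr rfl fun x _ => ?_
  rw [← vanderSum_mul_weylFactor (pow_ne_zero 2 hq0) hq hα0 hβ0 hC, vanderSum, Finset.sum_mul,
    Finset.sum_smul]
  refine Finset.sum_congr rfl fun y hy => ?_
  have hy' := Finset.HasAntidiagonal.mem_antidiagonal.mp hy
  simp only [hF]
  rw [← hy', weylFactor_add]
  congr 1
  ring

/-- The closed form of `ℛ⁻_ij` on powers of `z_i`: up to normalization, the coefficient of `t^a` in a
product of two `q`-binomial series in `z_i t` and `z_j t`. -/
lemma Rminus_X_pow {q : ℂ} (hq0 : q ≠ 0) (hq : ∀ n : ℕ, 0 < n → (q ^ 2) ^ n ≠ 1) {i j : σ}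
    (hij : i ≠ j) (up um vm : ℂ)
    (hC : ∀ n, qPoch ((q ^ (up - vm)) ^ 2 * (q ^ (vm - um)) ^ 2) (q ^ 2) n ≠ 0) (a : ℕ) :
    Rminus q i j up um vm (X i ^ a) =
      qNorm (q ^ 2) ((q ^ (up - vm)) ^ 2 * (q ^ (vm - um)) ^ 2) a •
        qHerm (q ^ 2) ((q ^ (up - vm)) ^ 2) ((q ^ (vm - um)) ^ 2)
          (q ^ (vm - um) • X i) (q ^ (up - vm) • (X j : MvPolynomial σ ℂ)) a := by
  rw [Rminus_X_pow_eq_sum hq0 hq hij up um vm hC, qHerm_eq_sum, Finset.smul_sum]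
  refine Finset.sum_congr rfl fun x hx => ?_
  rw [smul_pow, smul_pow, smul_mul_smul_comm, smul_smul, smul_smul, rCoeff,
    Finset.HasAntidiagonal.mem_antidiagonal.mp hx, ← mul_assoc]

end ClosedForm

/-! ### Polynomial identities behind the intertwining and gauge relations -/

/-! Here `F`, `P` stand for a `q`-binomial series at `β x t` and at `q² β x t`, and `G`, `Q` for one at
`α y t` and at `q² α y t`, with parameters `α²` and `β²`. The hypotheses `hF` and `hG` are their
functional equations. Primed constants are inverses, primed series have contiguous parameters. -/

section Ring

variable {S : Type*} [CommRing S] {F P G Q t x y α β : S}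

/-- For `Rminus_top` with `r = q`. -/
lemma ring_top_neg {W U' : S} (hF : F - P = t * (β * x) * (F - α ^ 2 * P))
    (hG : G - Q = t * (α * y) * (G - β ^ 2 * Q)) :
    x * (α * β * W * (P * Q) - U' * (F * G)) +
        β * W * (x * (t * y) * (F * G - α ^ 2 * β ^ 2 * (P * Q))) =
      x * ((α * β * W * P - U' * F) * G) - W * (y * ((P - F) * G)) := by
  linear_combination (-x * (α * β * W) * P) * hG + (-W * y * G) * hF

/-- For `Rminus_top` with `r = q⁻¹`. -/
lemma ring_top_pos {U U' : S} (hF : F - P = t * (β * x) * (F - α ^ 2 * P))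
    (hG : G - Q = t * (α * y) * (G - β ^ 2 * Q)) :
    x * (U * (P * Q) - U' * (F * G)) +
        α * U' * (x * (t * y) * (F * G - α ^ 2 * β ^ 2 * (P * Q))) =
      x * ((U * P - U' * F) * Q) - α * β * U' * (y * ((P - F) * Q)) := by
  linear_combination (-x * U' * F) * hG + (-(α * β * U') * y * Q) * hF

/-- For `Rminus_bot` with `r = q`. -/
lemma ring_bot_neg {c W W' : S} (hc : c * α * β = 1) (hw : W * W' = 1)
    (hF : F - P = t * (β * x) * (F - α ^ 2 * P))
    (hG : G - Q = t * (α * y) * (G - β ^ 2 * Q)) :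
    -c * (F * G - P * Q) + β * W * (t * y * (W * (F * G) - W' * (P * Q))) =
      t * x * ((α * P - c * β * F) * G) + W * (t * y * ((β * W * F - c * α * W' * P) * G)) := by
  linear_combination (-c * G) * hF + (-c * P) * hG +
    (t * x * P * G * α + t * y * P * Q * β) * hc +
    (-(t * y * P * Q * β) + t * y * P * G * c * α) * hw

/-- For `Rminus_bot` with `r = q⁻¹`. -/
lemma ring_bot_pos {c W W' : S} (hc : c * α * β = 1) (hw : W * W' = 1)
    (hF : F - P = t * (β * x) * (F - α ^ 2 * P))
    (hG : G - Q = t * (α * y) * (G - β ^ 2 * Q)) :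
    -c * (F * G - P * Q) + c * α * W' * (t * y * (W * (F * G) - W' * (P * Q))) =
      t * x * ((α * P - c * β * F) * Q) + W' * (t * y * ((β * W * F - c * α * W' * P) * Q)) := by
  linear_combination (-c * F) * hG + (-c * Q) * hF +
    (t * x * P * Q * α + t * y * F * Q * β) * hc +
    (t * y * F * G * c * α - t * y * F * Q * β) * hw

/-- For `Rminus_gauge_one`. -/
lemma ring_gauge_one {α' F' : S} (hα : α * α' = 1)
    (hG : G - Q = t * (α * y) * (G - β ^ 2 * Q)) (hF' : (1 - α ^ 2) * F' = F - α ^ 2 * P) :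
    α * (P * Q) - α' * (F * G) + t * y * (F * G - α ^ 2 * β ^ 2 * (P * Q)) =
      (α - α') * (F' * ((1 - t * (α * y)) * G)) := by
  linear_combination (-α * P) * hG + (α' * (1 - t * (α * y)) * G) * hF' +
    (-t * y * F * G - α * P * (1 - t * (α * y)) * G + α * F' * (1 - t * (α * y)) * G) * hα

/-- For `Rminus_gauge_two`. -/
lemma ring_gauge_two {β' G' : S} (hβ : β * β' = 1)
    (hF : F - P = t * (β * x) * (F - α ^ 2 * P)) (hG' : (1 - β ^ 2) * G' = G - β ^ 2 * Q) :
    β' * (F * G) - β * (P * Q) - t * x * (F * G - α ^ 2 * β ^ 2 * (P * Q)) =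
      (β' - β) * ((1 - t * (β * x)) * F * G') := by
  linear_combination (β * Q) * hF + (-β' * (1 - t * (β * x)) * F) * hG' +
    (t * x * F * G + β * Q * (1 - t * (β * x)) * F - β * G' * (1 - t * (β * x)) * F) * hβ

/-- For `Rminus_gauge_zero`. -/
lemma ring_gauge_zero {α' β' : S} (hα : α * α' = 1) (hβ : β * β' = 1)
    (hF : F - P = t * (β * x) * (F - α ^ 2 * P))
    (hG : G - Q = t * (α * y) * (G - β ^ 2 * Q)) :
    -(α' * β') * (F * G - P * Q) + t * y * (β' * (F * G) - β * (P * Q)) =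
      t * x * (α * (P * Q) - α' * (F * G)) +
        t * x * (t * y) * (F * G - α ^ 2 * β ^ 2 * (P * Q)) := by
  linear_combination (-(α' * β') * (G - t * (α * y) * G)) * hF +
    (-(α' * β') * (P - t * (β * x) * α ^ 2 * P)) * hG -
    α' * (F * G * t * x) * hβ - β' * (F * G * t * y) * hα +
    (F * G * t ^ 2 * x * y + P * Q * t * y * β + P * Q * t * α * x -
      P * Q * t ^ 2 * x * y * β ^ 2 * α ^ 2) * (β * β' * hα + hβ)

end Ring

/-! ### Intertwining relations for `ℛ⁻` and the columns of a Lax matrix -/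

section Site

open MvPolynomial

variable {σ : Type}

/-- The operator `r^(z_i ∂_i)`, rescaling the variable `z_i` by `r`. -/
def tScale (i : σ) (r : ℂ) : Op σ := eulerFun i fun a => r ^ a

lemma tScale_qHerm_left {i j : σ} (hij : i ≠ j) (r p A B c d : ℂ) (a : ℕ) :
    tScale i r (qHerm p A B (c • X i) (d • (X j : MvPolynomial σ ℂ)) a) =
      qHerm p A B (r • c • X i) (d • X j) a := by
  rw [qHerm_eq_sum, qHerm_eq_sum, map_sum]
  refine Finset.sum_congr rfl fun n _ => ?_
  rw [smul_pow, smul_pow, smul_pow, smul_pow, smul_mul_smul_comm, map_smul, map_smul,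
    mul_comm (X i ^ n.1), tScale, (LinearAway.eulerFun _).apply_X_pow_mul hij.symm, eulerFun_X_pow]
  simp only [smul_mul_assoc, mul_smul_comm, smul_smul]
  rw [mul_comm (X j ^ _)]
  congr 1
  ring

lemma tScale_qHerm_right {i j : σ} (hij : i ≠ j) (r p A B c d : ℂ) (a : ℕ) :
    tScale j r (qHerm p A B (c • X i) (d • (X j : MvPolynomial σ ℂ)) a) =
      qHerm p A B (c • X i) (r • d • X j) a := by
  rw [qHerm_eq_sum, qHerm_eq_sum, map_sum]
  refine Finset.sum_congr rfl fun n _ => ?_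
  rw [smul_pow, smul_pow, smul_pow, smul_pow, smul_mul_smul_comm, map_smul, map_smul,
    tScale, (LinearAway.eulerFun _).apply_X_pow_mul hij, eulerFun_X_pow]
  simp only [smul_mul_assoc, mul_smul_comm, smul_smul]
  congr 1
  ring

lemma tScale_X_pow_of_ne {i j : σ} (hij : i ≠ j) (r : ℂ) (a : ℕ) :
    tScale j r (X i ^ a : MvPolynomial σ ℂ) = X i ^ a := by
  have := (LinearAway.eulerFun (i := j) fun a => r ^ a).apply_X_pow_mul hij a 1
  have h1 := eulerFun_X_pow j (fun a => r ^ a) 0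
  rw [pow_zero, pow_zero, one_smul] at h1
  rwa [mul_one, h1, mul_one] at this

lemma eulerFun_sub (i : σ) (f g : ℕ → ℂ) :
    eulerFun i f - eulerFun i g = eulerFun i fun a => f a - g a := by
  refine op_ext fun s => ?_
  simp [eulerFun_monomial]

lemma eulerFun_qNum_add {q : ℂ} (hq0 : q ≠ 0) (i : σ) (u : ℂ) :
    eulerFun i (fun a => qNum q (u + a)) =
      (q - q⁻¹)⁻¹ • (q ^ u • tScale i q - (q ^ u)⁻¹ • tScale i q⁻¹) := by
  rw [tScale, tScale, eulerFun_smul, eulerFun_smul, eulerFun_sub, eulerFun_smul]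
  congr 1
  funext a
  rw [qNum, Complex.cpow_neg, Complex.cpow_add _ _ hq0, Complex.cpow_natCast, inv_pow]
  ring

lemma eulerFun_qNum_sub {q : ℂ} (hq0 : q ≠ 0) (i : σ) (u : ℂ) :
    eulerFun i (fun a => qNum q (u - a)) =
      (q - q⁻¹)⁻¹ • (q ^ u • tScale i q⁻¹ - (q ^ u)⁻¹ • tScale i q) := by
  rw [tScale, tScale, eulerFun_smul, eulerFun_smul, eulerFun_sub, eulerFun_smul]
  congr 1
  funext a
  rw [qNum, Complex.cpow_neg, Complex.cpow_sub _ _ hq0, Complex.cpow_natCast, inv_pow, inv_div]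
  ring

lemma eulerFun_qNum (q : ℂ) (i : σ) :
    eulerFun i (fun a => qNum q a) = (q - q⁻¹)⁻¹ • (tScale i q - tScale i q⁻¹) := by
  rw [tScale, tScale, eulerFun_sub, eulerFun_smul]
  congr 1
  funext a
  rw [qNum, Complex.cpow_neg, Complex.cpow_natCast, inv_pow]
  ring

/-- The Lax matrix in terms of `u_± = u ± ℓ`. -/
def laxPM (q : ℂ) (i : σ) (up um : ℂ) : Matrix (Fin 2) (Fin 2) (Op σ) :=
  !![eulerFun i fun a => qNum q (up + a), sMinus q i;
     mulZ i * eulerFun i fun a => qNum q (up - um + a), eulerFun i fun a => qNum q (um - a)]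

lemma lax_eq_laxPM (q ℓ : ℂ) (i : σ) (u : ℂ) : lax q ℓ i u = laxPM q i (u + ℓ) (u - ℓ) := by
  have h1 : (fun a : ℕ => qNum q (u + (a + ℓ))) = fun a : ℕ => qNum q (u + ℓ + a) := by
    funext a; congr 1; ring
  have h2 : (fun a : ℕ => qNum q (a + 2 * ℓ)) = fun a : ℕ => qNum q (u + ℓ - (u - ℓ) + a) := by
    funext a; congr 1; ring
  have h3 : (fun a : ℕ => qNum q (u - (a + ℓ))) = fun a : ℕ => qNum q (u - ℓ - a) := by
    funext a; congr 1; ring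
  rw [lax, laxPM, sPlus, h1, h2, h3]

/-- `(q^(2 up - 2 um); q²)_n ≠ 0` for all `n`, so that `ℛ⁻(up, um | vm)` has no pole. -/
def NoPole (q up um : ℂ) : Prop := ∀ j : ℕ, q ^ (2 * up - 2 * um + 2 * j) ≠ 1

lemma NoPole.qPoch_ne_zero {q up um : ℂ} (hq0 : q ≠ 0) (h : NoPole q up um) (vm : ℂ) (n : ℕ) :
    qPoch ((q ^ (up - vm)) ^ 2 * (q ^ (vm - um)) ^ 2) (q ^ 2) n ≠ 0 := by
  refine Finset.prod_ne_zero_iff.mpr fun k _ h0 => h k ?_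
  rw [← mul_pow, ← Complex.cpow_add _ _ hq0, ← pow_mul, ← Complex.cpow_natCast q (2 * k),
    ← Complex.cpow_nat_mul, ← Complex.cpow_add _ _ hq0] at h0
  rw [← sub_eq_zero, ← neg_eq_zero, neg_sub, ← h0]
  congr 2
  push_cast
  ring

lemma sq_pow_ne_one {q : ℂ} (hq : ∀ n : ℕ, 0 < n → q ^ n ≠ 1) (n : ℕ) (hn : 0 < n) :
    (q ^ 2) ^ n ≠ 1 := by
  rw [← pow_mul]; exact hq _ (by omega)

variable {q up um vm : ℂ} {i j : σ}

/-! In the closed form `Rminus_X_pow`, `wt` is the normalization, and `serF`, `serG` are the two series,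
in `z_i` and `z_j`. The series `serP`, `serQ` arise from them by the rescaling `z ↦ q² z`, and `cc`
embeds the complex numbers as constants. -/

local notation "κ" => (q - q⁻¹)⁻¹
local notation "α" => q ^ (up - vm)
local notation "β" => q ^ (vm - um)
local notation "wt" => qNorm (q ^ 2) (α ^ 2 * β ^ 2)
local notation "serF" => qSer (q ^ 2) (α ^ 2) (β • (X i : MvPolynomial σ ℂ))
local notation "serP" => qSer (q ^ 2) (α ^ 2) (q ^ 2 • β • (X i : MvPolynomial σ ℂ))
local notation "serG" => qSer (q ^ 2) (β ^ 2) (α • (X j : MvPolynomial σ ℂ))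
local notation "serQ" => qSer (q ^ 2) (β ^ 2) (q ^ 2 • α • (X j : MvPolynomial σ ℂ))
local notation "cc" => cst (MvPolynomial σ ℂ)

lemma coeff_serP_serQ (a : ℕ) : PowerSeries.coeff a (serP * serQ) =
    (q ^ 2) ^ a • PowerSeries.coeff a (serF * serG) := qHerm_smul_smul _ _ _ _ _ _ _

/-- The closed form of `ℛ⁻_ij` in the notation above. -/
lemma Rminus_X_pow' (hq0 : q ≠ 0) (hq : ∀ n : ℕ, 0 < n → q ^ n ≠ 1) (hij : i ≠ j)
    (hC : NoPole q up um) (a : ℕ) :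
    Rminus q i j up um vm (X i ^ a) = wt a • PowerSeries.coeff a (serF * serG) :=
  Rminus_X_pow hq0 (sq_pow_ne_one hq) hij up um vm (hC.qPoch_ne_zero hq0 vm) a

/-- The ratio of consecutive normalization factors; the denominator is nonzero away from the poles. -/
lemma qNorm_succ (hq0 : q ≠ 0) (hC : NoPole q up um) (a : ℕ) :
    wt (a + 1) * (1 - (q ^ 2) ^ a * (α ^ 2 * β ^ 2)) = wt a * (1 - (q ^ 2) ^ (a + 1)) := by
  have h1 := hC.qPoch_ne_zero hq0 vm a
  have h2 := hC.qPoch_ne_zero hq0 vm (a + 1)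
  rw [qPoch_succ] at h2
  have h3 := right_ne_zero_of_mul h2
  unfold qNorm
  rw [qPoch_succ, qPoch_succ, show 1 - (q ^ 2) ^ a * q ^ 2 = 1 - (q ^ 2) ^ (a + 1) by
    rw [pow_succ (q ^ 2)]]
  generalize 1 - (q ^ 2) ^ a * (α ^ 2 * β ^ 2) = d at *
  field_simp

/-- The diagonal entry `[u + z_i ∂_i]` of the Lax matrix followed by `ℛ⁻`. As the coefficient of `t^a`
is homogeneous of degree `a`, the factor `q^(2a)` turns `serF * serG` into `serP * serQ`. -/
lemma Rminus_diag_add (hq0 : q ≠ 0) (hq : ∀ n : ℕ, 0 < n → q ^ n ≠ 1) (hij : i ≠ j)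
    (hC : NoPole q up um) (u : ℂ) (a : ℕ) :
    Rminus q i j up um vm (eulerFun i (fun a => qNum q (u + a)) (X i ^ a)) =
      (κ * (q ^ a)⁻¹ * wt a) •
        PowerSeries.coeff a (cc (q ^ u) * (serP * serQ) - cc (q ^ u)⁻¹ * (serF * serG)) := by
  rw [eulerFun_X_pow, map_smul, Rminus_X_pow' hq0 hq hij hC, map_sub, coeff_cst_mul, coeff_cst_mul,
    coeff_serP_serQ, smul_smul, smul_smul, ← sub_smul, smul_smul]
  congr 1
  rw [qNum, Complex.cpow_neg, Complex.cpow_add _ _ hq0, Complex.cpow_natCast, div_eq_mul_inv]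
  generalize (q - q⁻¹)⁻¹ = k
  have : (q ^ u) ≠ 0 := by simp [Complex.cpow_eq_zero_iff, hq0]
  rw [← pow_mul, mul_comm 2 a, pow_mul]
  field_simp

lemma Rminus_diag_sub (hq0 : q ≠ 0) (hq : ∀ n : ℕ, 0 < n → q ^ n ≠ 1) (hij : i ≠ j)
    (hC : NoPole q up um) (u : ℂ) (a : ℕ) :
    Rminus q i j up um vm (eulerFun i (fun a => qNum q (u - a)) (X i ^ a)) =
      (κ * (q ^ a)⁻¹ * wt a) •
        PowerSeries.coeff a (cc (q ^ u) * (serF * serG) - cc (q ^ u)⁻¹ * (serP * serQ)) := by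
  rw [eulerFun_X_pow, map_smul, Rminus_X_pow' hq0 hq hij hC, map_sub, coeff_cst_mul, coeff_cst_mul,
    coeff_serP_serQ, smul_smul, smul_smul, ← sub_smul, smul_smul]
  congr 1
  rw [qNum, Complex.cpow_neg, Complex.cpow_sub _ _ hq0, Complex.cpow_natCast, div_eq_mul_inv]
  generalize (q - q⁻¹)⁻¹ = k
  have : (q ^ u) ≠ 0 := by simp [Complex.cpow_eq_zero_iff, hq0]
  rw [← pow_mul, mul_comm 2 a, pow_mul]
  field_simp

/-- The lower left entry of the Lax matrix followed by `ℛ⁻`. -/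
lemma Rminus_raise (hq0 : q ≠ 0) (hq : ∀ n : ℕ, 0 < n → q ^ n ≠ 1) (hij : i ≠ j)
    (hC : NoPole q up um) (a : ℕ) :
    Rminus q i j up um vm ((mulZ i * eulerFun i fun a => qNum q (up - um + a)) (X i ^ a)) =
      (κ * (q ^ a)⁻¹ * wt a) •
        PowerSeries.coeff (a + 1) (-cc (α * β)⁻¹ * (serF * serG - serP * serQ)) := by
  rw [Module.End.mul_apply, eulerFun_X_pow, map_smul, map_smul, mulZ_apply, ← pow_succ',
    Rminus_X_pow' hq0 hq hij hC, ← map_neg, coeff_cst_mul, map_sub,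
    coeff_serP_serQ, smul_smul]
  nth_rewrite 2 [← one_smul ℂ (PowerSeries.coeff (a + 1) (serF * serG))]
  rw [← sub_smul, smul_smul, smul_smul]
  congr 1
  rw [show κ * (q ^ a)⁻¹ * wt a * -(α * β)⁻¹ * (1 - (q ^ 2) ^ (a + 1)) =
    κ * (q ^ a)⁻¹ * (-(α * β)⁻¹ * (wt a * (1 - (q ^ 2) ^ (a + 1)))) by ring, ← qNorm_succ hq0 hC]
  have hc : q ^ (up - um) = α * β := by
    rw [← Complex.cpow_add _ _ hq0]; congr 1; ring
  rw [qNum, Complex.cpow_neg, Complex.cpow_add _ _ hq0, Complex.cpow_natCast, div_eq_mul_inv, hc]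
  have h1 : α ≠ 0 := by simp [Complex.cpow_eq_zero_iff, hq0]
  have h2 : β ≠ 0 := by simp [Complex.cpow_eq_zero_iff, hq0]
  generalize (q - q⁻¹)⁻¹ = k
  generalize wt (a + 1) = w
  generalize α = x at *
  generalize β = y at *
  field_simp
  ring

/-- The entry `S₋` of the Lax matrix followed by `ℛ⁻`. It lowers the degree, so that the series acquires
a factor `Z t`. -/
lemma mul_Rminus_lower (hq0 : q ≠ 0) (hq : ∀ n : ℕ, 0 < n → q ^ n ≠ 1) (hij : i ≠ j)
    (hC : NoPole q up um) (Z : MvPolynomial σ ℂ) (a : ℕ) :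
    Z * Rminus q i j up um vm (sMinus q i (X i ^ a)) =
      (κ * (q ^ a)⁻¹ * wt a) •
        PowerSeries.coeff a (lin Z * (serF * serG - cc (α ^ 2 * β ^ 2) * (serP * serQ))) := by
  rw [sMinus, LinearMap.neg_apply, Module.End.mul_apply, eulerFun_X_pow, map_smul]
  cases a with
  | zero => simp [coeff_zero_lin_mul, divZ_one]
  | succ a =>
    rw [divZ_X_pow_succ, map_neg, map_smul, Rminus_X_pow' hq0 hq hij hC, coeff_lin_mul, map_sub,
      coeff_cst_mul, coeff_serP_serQ, smul_smul]
    nth_rewrite 2 [← one_smul ℂ (PowerSeries.coeff a (serF * serG))]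
    rw [smul_smul, ← sub_smul, mul_smul_comm, smul_smul, ← neg_smul, mul_smul_comm]
    congr 1
    rw [show κ * (q ^ (a + 1))⁻¹ * wt (a + 1) * (1 - α ^ 2 * β ^ 2 * (q ^ 2) ^ a) =
      κ * (q ^ (a + 1))⁻¹ * (wt (a + 1) * (1 - (q ^ 2) ^ a * (α ^ 2 * β ^ 2))) by ring,
      qNorm_succ hq0 hC, qNum, Complex.cpow_neg, Complex.cpow_natCast, div_eq_mul_inv]
    generalize (q - q⁻¹)⁻¹ = k
    generalize wt a = w
    field_simp
    ring

/-- The functional equation of the first factor of the generating function. -/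
lemma serF_functional (hq : ∀ n : ℕ, 0 < n → q ^ n ≠ 1) : serF - serP =
    PowerSeries.X * (cc β * PowerSeries.C (X i)) * (serF - cc α ^ 2 * serP) := by
  have h := qSer_functional (sq_pow_ne_one hq) (α ^ 2) (β • (X i : MvPolynomial σ ℂ))
  rw [lin_smul, map_pow] at h
  unfold lin at h
  linear_combination h

/-- The functional equation of the second factor of the generating function. -/
lemma serG_functional (hq : ∀ n : ℕ, 0 < n → q ^ n ≠ 1) : serG - serQ =
    PowerSeries.X * (cc α * PowerSeries.C (X j)) * (serG - cc β ^ 2 * serQ) := by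
  have h := qSer_functional (sq_pow_ne_one hq) (β ^ 2) (α • (X j : MvPolynomial σ ℂ))
  rw [lin_smul, map_pow] at h
  unfold lin at h
  linear_combination h

lemma coeff_C_mul' (Z : MvPolynomial σ ℂ) (a : ℕ) (f : PowerSeries (MvPolynomial σ ℂ)) :
    Z * PowerSeries.coeff a f = PowerSeries.coeff a (PowerSeries.C Z * f) :=
  (PowerSeries.coeff_C_mul _ _ _).symm

/-- Multiplication by `z_i` clears the division in `S₋`. -/
lemma X_mul_sMinus (Φ : MvPolynomial σ ℂ) :
    X i * sMinus q i Φ = -eulerFun i (fun a => qNum q a) Φ := by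
  have h := mulZ_mul_divZ_mul_eulerFun i (fun a => qNum q a) (by simp [qNum])
  have h' := LinearMap.congr_fun h Φ
  rw [← h', sMinus, LinearMap.neg_apply, mul_neg]
  rfl

/-- The image of `z_i^a` under the conjugate of `ℛ⁻` by a rescaling of `z_j`. -/
lemma conj_Rminus_X_pow (hq0 : q ≠ 0) (hq : ∀ n : ℕ, 0 < n → q ^ n ≠ 1) (hij : i ≠ j)
    (hC : NoPole q up um) (r : ℂ) (a : ℕ) :
    (tScale j r⁻¹ * Rminus q i j up um vm * tScale j r) (X i ^ a) =
      wt a • qHerm (q ^ 2) (α ^ 2) (β ^ 2) (β • X i) (r⁻¹ • α • (X j : MvPolynomial σ ℂ)) a := by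
  rw [Module.End.mul_apply, Module.End.mul_apply, tScale_X_pow_of_ne hij,
    Rminus_X_pow' hq0 hq hij hC, map_smul, ← qHerm, tScale_qHerm_right hij]

/-- The definition of `qHerm`, as a rewriting rule. -/
lemma qHerm_eq_coeff (p A B : ℂ) {R : Type*} [CommRing R] [Algebra ℂ R] (x y : R) (a : ℕ) :
    qHerm p A B x y a = PowerSeries.coeff a (qSer p A x * qSer p B y) := rfl

/-- The effect of the rescalings `q^(± z_i ∂_i)` on the conjugate of `ℛ⁻` in the closed form. -/
lemma tScale_conj (hq0 : q ≠ 0) (hij : i ≠ j) {r e : ℂ} (A B c d : ℂ) (a : ℕ)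
    (hr : (r = q ∧ e = 1) ∨ (r = q⁻¹ ∧ e = q ^ 2)) :
    tScale i q (qHerm (q ^ 2) A B (c • X i) (r⁻¹ • d • (X j : MvPolynomial σ ℂ)) a) =
      (q ^ a)⁻¹ • PowerSeries.coeff a
        (qSer (q ^ 2) A (q ^ 2 • c • X i) * qSer (q ^ 2) B (e • d • X j)) ∧
    tScale i q⁻¹ (qHerm (q ^ 2) A B (c • X i) (r⁻¹ • d • (X j : MvPolynomial σ ℂ)) a) =
      (q ^ a)⁻¹ • PowerSeries.coeff a
        (qSer (q ^ 2) A (c • X i) * qSer (q ^ 2) B (e • d • X j)) := by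
  simp only [smul_smul r⁻¹, tScale_qHerm_left hij, ← inv_pow, ← qHerm_eq_coeff,
    ← qHerm_smul_smul]
  simp only [smul_smul]
  rcases hr with ⟨rfl, rfl⟩ | ⟨rfl, rfl⟩ <;> constructor <;> congr 2 <;> field_simp

lemma qNum_add_apply_of_scale (hq0 : q ≠ 0) {Φ f g : MvPolynomial σ ℂ} (u : ℂ)
    (h1 : tScale i q Φ = f) (h0 : tScale i q⁻¹ Φ = g) :
    eulerFun i (fun a => qNum q (u + a)) Φ = κ • (q ^ u • f - (q ^ u)⁻¹ • g) := by
  rw [eulerFun_qNum_add hq0, LinearMap.smul_apply, LinearMap.sub_apply, LinearMap.smul_apply,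
    LinearMap.smul_apply, h1, h0]

lemma qNum_sub_apply_of_scale (hq0 : q ≠ 0) {Φ f g : MvPolynomial σ ℂ} (u : ℂ)
    (h1 : tScale i q Φ = f) (h0 : tScale i q⁻¹ Φ = g) :
    eulerFun i (fun a => qNum q (u - a)) Φ = κ • (q ^ u • g - (q ^ u)⁻¹ • f) := by
  rw [eulerFun_qNum_sub hq0, LinearMap.smul_apply, LinearMap.sub_apply, LinearMap.smul_apply,
    LinearMap.smul_apply, h1, h0]

lemma X_mul_sMinus_of_scale {Φ f g : MvPolynomial σ ℂ}
    (h1 : tScale i q Φ = f) (h0 : tScale i q⁻¹ Φ = g) :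
    X i * sMinus q i Φ = -(κ • (f - g)) := by
  rw [X_mul_sMinus, eulerFun_qNum, LinearMap.smul_apply, LinearMap.sub_apply, h1, h0]

lemma tScale_X_mul (j : σ) (r : ℂ) (Φ : MvPolynomial σ ℂ) :
    tScale j r (X j * Φ) = r • (X j * tScale j r Φ) := by
  have h : tScale j r * mulZ j = r • (mulZ j * tScale j r) := by
    refine ((LinearAway.eulerFun _).mul (.mulZ j)).ext
      (((LinearAway.mulZ j).mul (.eulerFun _)).smul r) fun a => ?_
    rw [LinearMap.smul_apply, Module.End.mul_apply, Module.End.mul_apply, mulZ_apply, ← pow_succ',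
      tScale, eulerFun_X_pow, eulerFun_X_pow, map_smul, mulZ_apply, smul_smul, ← pow_succ',
      ← pow_succ']
  exact LinearMap.congr_fun h Φ

lemma linearAway_tScale_conj {r : ℂ} (hr : r ≠ 0) {A : Op σ} (hA : LinearAway i A) :
    LinearAway i (tScale j r⁻¹ * A * tScale j r) := by
  intro l hl
  by_cases hlj : l = j
  · subst hlj
    refine LinearMap.ext fun Φ => ?_
    simp only [Module.End.mul_apply, mulZ_apply]
    rw [tScale_X_mul, map_smul, hA.apply_X_mul hl, map_smul, tScale_X_mul, smul_smul,
      mul_inv_cancel₀ hr, one_smul]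
  · have h1 : ∀ s : ℂ, Commute (tScale j s) (mulZ l : Op σ) := fun s =>
      LinearAway.eulerFun _ l hlj
    exact ((h1 _).mul_left (hA l hl)).mul_left (h1 _)

section Abstract

variable {Φ : MvPolynomial σ ℂ} {F P G : PowerSeries (MvPolynomial σ ℂ)} {c : ℂ} {a : ℕ}

/-- The operator of the top row of the intertwining relation, applied to `Φ`, if the rescalings of `Φ`
in `z_i` are known as coefficients of series. -/
lemma X_mul_top_of_scale (hq0 : q ≠ 0) (u cw : ℂ)
    (h1 : tScale i q Φ = c • PowerSeries.coeff a (P * G))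
    (h0 : tScale i q⁻¹ Φ = c • PowerSeries.coeff a (F * G)) :
    X i * (eulerFun i (fun a => qNum q (u + a)) + cw • (mulZ j * sMinus q i)) Φ =
      (κ * c) • PowerSeries.coeff a
        (PowerSeries.C (X i) * ((cc (q ^ u) * P - cc (q ^ u)⁻¹ * F) * G) -
          cc cw * (PowerSeries.C (X j) * ((P - F) * G))) := by
  rw [LinearMap.add_apply,
    LinearMap.smul_apply, Module.End.mul_apply, mulZ_apply, qNum_add_apply_of_scale hq0 u h1 h0,
    mul_add, mul_smul_comm, mul_smul_comm, mul_left_comm (X i) (X j),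
    X_mul_sMinus_of_scale h1 h0]
  simp only [map_sub, coeff_cst_mul, sub_mul, mul_assoc, mul_sub, ← coeff_C_mul', smul_sub,
    mul_smul_comm, mul_neg, smul_neg, smul_smul]
  module

/-- The operator of the bottom row of the intertwining relation, applied to `Φ`, if the rescalings of
`Φ` in `z_i` are known as coefficients of series. -/
lemma bot_of_scale (hq0 : q ≠ 0) (u v cw : ℂ)
    (h1 : tScale i q Φ = c • PowerSeries.coeff a (P * G))
    (h0 : tScale i q⁻¹ Φ = c • PowerSeries.coeff a (F * G)) :
    (mulZ i * eulerFun i (fun a => qNum q (u + a)) +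
        cw • (mulZ j * eulerFun i (fun a => qNum q (v - a)))) Φ =
      (κ * c) • PowerSeries.coeff (a + 1)
        (lin (X i) * ((cc (q ^ u) * P - cc (q ^ u)⁻¹ * F) * G) +
          cc cw * (lin (X j) * ((cc (q ^ v) * F - cc (q ^ v)⁻¹ * P) * G))) := by
  rw [LinearMap.add_apply,
    LinearMap.smul_apply, Module.End.mul_apply, Module.End.mul_apply, mulZ_apply, mulZ_apply,
    qNum_add_apply_of_scale hq0 u h1 h0, qNum_sub_apply_of_scale hq0 v h1 h0]
  simp only [map_sub, map_add, coeff_lin_mul, coeff_cst_mul, sub_mul, mul_assoc, mul_sub, smul_sub,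
    mul_smul_comm, smul_add, smul_smul]
  module

end Abstract

/-- The operator of the top row of the intertwining relation followed by `ℛ⁻`. -/
lemma X_mul_top_lhs (hq0 : q ≠ 0) (hq : ∀ n : ℕ, 0 < n → q ^ n ≠ 1) (hij : i ≠ j)
    (hC : NoPole q up um) (u cv : ℂ) (a : ℕ) :
    (Rminus q i j up um vm * (eulerFun i (fun a => qNum q (u + a)) +
      cv • (mulZ j * sMinus q i))) (X i ^ a) = (κ * (q ^ a)⁻¹ * wt a) • PowerSeries.coeff a
        ((cc (q ^ u) * (serP * serQ) - cc (q ^ u)⁻¹ * (serF * serG)) +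
          cc cv * (lin (X j) * (serF * serG - cc (α ^ 2 * β ^ 2) * (serP * serQ)))) := by
  rw [Module.End.mul_apply, LinearMap.add_apply, map_add, Rminus_diag_add hq0 hq hij hC,
    LinearMap.smul_apply, map_smul, Module.End.mul_apply, mulZ_apply,
    (LinearAway.Rminus (i := i) q j up um vm).apply_X_mul hij.symm,
    mul_Rminus_lower hq0 hq hij hC, smul_comm cv, ← smul_add, ← coeff_cst_mul, ← map_add]

/-- The operator of the bottom row of the intertwining relation followed by `ℛ⁻`. -/
lemma bot_lhs (hq0 : q ≠ 0) (hq : ∀ n : ℕ, 0 < n → q ^ n ≠ 1) (hij : i ≠ j)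
    (hC : NoPole q up um) (u cv : ℂ) (a : ℕ) :
    (Rminus q i j up um vm * (mulZ i * eulerFun i (fun a => qNum q (up - um + a)) +
      cv • (mulZ j * eulerFun i (fun a => qNum q (u - a))))) (X i ^ a) =
      (κ * (q ^ a)⁻¹ * wt a) • PowerSeries.coeff (a + 1)
        (-cc (α * β)⁻¹ * (serF * serG - serP * serQ) +
          cc cv * (lin (X j) *
            (cc (q ^ u) * (serF * serG) - cc (q ^ u)⁻¹ * (serP * serQ)))) := by
  rw [Module.End.mul_apply, LinearMap.add_apply, map_add, Rminus_raise hq0 hq hij hC,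
    LinearMap.smul_apply, map_smul, Module.End.mul_apply, mulZ_apply,
    (LinearAway.Rminus (i := i) q j up um vm).apply_X_mul hij.symm,
    Rminus_diag_sub hq0 hq hij hC, mul_smul_comm, smul_comm cv, ← smul_add, ← coeff_lin_mul,
    ← coeff_cst_mul, ← map_add]

set_option maxHeartbeats 1000000 in
/-- The top row of the intertwining relation; `r = q` and `r = q⁻¹` give its two halves. -/
lemma Rminus_top (hq0 : q ≠ 0) (hq : ∀ n : ℕ, 0 < n → q ^ n ≠ 1) (hij : i ≠ j)
    (hC : NoPole q up um) {r cv cw : ℂ}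
    (hr : (r = q ∧ cv = q ^ vm ∧ cw = q ^ um) ∨
      (r = q⁻¹ ∧ cv = (q ^ vm)⁻¹ ∧ cw = (q ^ um)⁻¹)) :
    Rminus q i j up um vm * (eulerFun i (fun a => qNum q (up + a)) + cv • (mulZ j * sMinus q i)) =
      (eulerFun i (fun a => qNum q (up + a)) + cw • (mulZ j * sMinus q i)) *
        (tScale j r⁻¹ * Rminus q i j up um vm * tScale j r) := by
  have hR := LinearAway.Rminus (i := i) q j up um vm
  have hL : ∀ c : ℂ, LinearAway i
      (eulerFun i (fun a => qNum q (up + a)) + c • (mulZ j * sMinus q i)) := fun c =>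
    (LinearAway.eulerFun _).add (((LinearAway.mulZ j).mul (.sMinus q)).smul c)
  have hr0 : r ≠ 0 := by rcases hr with ⟨rfl, _⟩ | ⟨rfl, _⟩ <;> simp [hq0]
  refine (hR.mul (hL cv)).ext ((hL cw).mul (linearAway_tScale_conj hr0 hR)) fun a => ?_
  -- multiplication by `z_i` clears the division in `S₋`
  refine X_mul_cancel_left_iff.mp (?_ : X i * _ = X i * _)
  obtain ⟨e, he⟩ : ∃ e, (r = q ∧ e = 1 ∧ cv = q ^ vm ∧ cw = q ^ um) ∨
      (r = q⁻¹ ∧ e = q ^ 2 ∧ cv = (q ^ vm)⁻¹ ∧ cw = (q ^ um)⁻¹) := by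
    rcases hr with h | h
    exacts [⟨1, Or.inl ⟨h.1, rfl, h.2⟩⟩, ⟨q ^ 2, Or.inr ⟨h.1, rfl, h.2⟩⟩]
  obtain ⟨h1, h0⟩ := tScale_conj (i := i) (j := j) hq0 hij (α ^ 2) (β ^ 2) β α a
    (he.imp (fun h => ⟨h.1, h.2.1⟩) (fun h => ⟨h.1, h.2.1⟩))
  rw [X_mul_top_lhs hq0 hq hij hC, Module.End.mul_apply, conj_Rminus_X_pow hq0 hq hij hC,
    mul_smul_comm, coeff_C_mul', map_smul _ (wt a), mul_smul_comm (wt a) (X i),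
    X_mul_top_of_scale (j := j) hq0 up cw h1 h0, smul_smul (wt a), mul_comm (wt a)]
  congr 2
  have hF := serF_functional (up := up) (um := um) (vm := vm) (i := i) hq
  have hG := serG_functional (up := up) (um := um) (vm := vm) (j := j) hq
  have hU : q ^ up ≠ 0 := by simp [Complex.cpow_eq_zero_iff, hq0]
  have hW : q ^ um ≠ 0 := by simp [Complex.cpow_eq_zero_iff, hq0]
  have hV : q ^ vm ≠ 0 := by simp [Complex.cpow_eq_zero_iff, hq0]
  have hα : α = q ^ up * (q ^ vm)⁻¹ := by rw [Complex.cpow_sub _ _ hq0, div_eq_mul_inv]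
  have hβ : β = q ^ vm * (q ^ um)⁻¹ := by rw [Complex.cpow_sub _ _ hq0, div_eq_mul_inv]
  rw [map_mul cc (α ^ 2), map_pow, map_pow, lin]
  rcases he with ⟨-, rfl, rfl, rfl⟩ | ⟨-, rfl, rfl, rfl⟩
  · have e1 : cc (q ^ up) = cc α * cc β * cc (q ^ um) := by
      rw [← map_mul, ← map_mul, hα, hβ]; congr 1; field_simp
    have e2 : cc (q ^ vm) = cc β * cc (q ^ um) := by
      rw [← map_mul, hβ]; congr 1; field_simp
    rw [e1, e2, one_smul]
    clear h1 h0 hr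
    generalize serF = F, serP = P, serG = G, serQ = Q at hF hG ⊢
    linear_combination ring_top_neg (W := cc (q ^ um)) (U' := cc (q ^ up)⁻¹) hF hG
  · have e1 : cc (q ^ um)⁻¹ = cc α * cc β * cc (q ^ up)⁻¹ := by
      rw [← map_mul, ← map_mul, hα, hβ]; congr 1; field_simp
    have e2 : cc (q ^ vm)⁻¹ = cc α * cc (q ^ up)⁻¹ := by
      rw [← map_mul, hα]; congr 1; field_simp
    rw [e1, e2]
    clear h1 h0 hr
    generalize serF = F, serP = P, serG = G, serQ = Q at hF hG ⊢
    linear_combination ring_top_pos (U := cc (q ^ up)) (U' := cc (q ^ up)⁻¹) hF hG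

set_option maxHeartbeats 1000000 in
/-- The bottom row of the intertwining relation; `r = q` and `r = q⁻¹` give its two halves. -/
lemma Rminus_bot (hq0 : q ≠ 0) (hq : ∀ n : ℕ, 0 < n → q ^ n ≠ 1) (hij : i ≠ j)
    (hC : NoPole q up um) {r cv cw : ℂ}
    (hr : (r = q ∧ cv = q ^ vm ∧ cw = q ^ um) ∨
      (r = q⁻¹ ∧ cv = (q ^ vm)⁻¹ ∧ cw = (q ^ um)⁻¹)) :
    Rminus q i j up um vm * (mulZ i * eulerFun i (fun a => qNum q (up - um + a)) +
        cv • (mulZ j * eulerFun i (fun a => qNum q (um - a)))) =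
      (mulZ i * eulerFun i (fun a => qNum q (up - vm + a)) +
        cw • (mulZ j * eulerFun i (fun a => qNum q (vm - a)))) *
        (tScale j r⁻¹ * Rminus q i j up um vm * tScale j r) := by
  have hR := LinearAway.Rminus (i := i) q j up um vm
  have hL : ∀ c u v : ℂ, LinearAway i (mulZ i * eulerFun i (fun a => qNum q (u + a)) +
        c • (mulZ j * eulerFun i (fun a => qNum q (v - a)))) := fun c u v =>
    ((LinearAway.mulZ i).mul (.eulerFun _)).add (((LinearAway.mulZ j).mul (.eulerFun _)).smul c)
  have hr0 : r ≠ 0 := by rcases hr with ⟨rfl, _⟩ | ⟨rfl, _⟩ <;> simp [hq0]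
  refine (hR.mul (hL cv (up - um) um)).ext ((hL cw (up - vm) vm).mul (linearAway_tScale_conj hr0 hR)) fun a => ?_
  obtain ⟨e, he⟩ : ∃ e, (r = q ∧ e = 1 ∧ cv = q ^ vm ∧ cw = q ^ um) ∨
      (r = q⁻¹ ∧ e = q ^ 2 ∧ cv = (q ^ vm)⁻¹ ∧ cw = (q ^ um)⁻¹) := by
    rcases hr with h | h
    exacts [⟨1, Or.inl ⟨h.1, rfl, h.2⟩⟩, ⟨q ^ 2, Or.inr ⟨h.1, rfl, h.2⟩⟩]
  obtain ⟨h1, h0⟩ := tScale_conj (i := i) (j := j) hq0 hij (α ^ 2) (β ^ 2) β α a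
    (he.imp (fun h => ⟨h.1, h.2.1⟩) (fun h => ⟨h.1, h.2.1⟩))
  rw [bot_lhs hq0 hq hij hC, Module.End.mul_apply, conj_Rminus_X_pow hq0 hq hij hC,
    LinearMap.map_smul _ (wt a), bot_of_scale (j := j) hq0 (up - vm) vm cw h1 h0,
    smul_smul (wt a),
    mul_comm (wt a)]
  refine congrArg (fun f => (κ * (q ^ a)⁻¹ * wt a) • PowerSeries.coeff (a + 1) f) ?_
  have hF := serF_functional (up := up) (um := um) (vm := vm) (i := i) hq
  have hG := serG_functional (up := up) (um := um) (vm := vm) (j := j) hq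
  have hU : q ^ up ≠ 0 := by simp [Complex.cpow_eq_zero_iff, hq0]
  have hW : q ^ um ≠ 0 := by simp [Complex.cpow_eq_zero_iff, hq0]
  have hV : q ^ vm ≠ 0 := by simp [Complex.cpow_eq_zero_iff, hq0]
  have hα : α = q ^ up * (q ^ vm)⁻¹ := by rw [Complex.cpow_sub _ _ hq0, div_eq_mul_inv]
  have hβ : β = q ^ vm * (q ^ um)⁻¹ := by rw [Complex.cpow_sub _ _ hq0, div_eq_mul_inv]
  have hα0 : α ≠ 0 := by simp [Complex.cpow_eq_zero_iff, hq0]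
  have hβ0 : β ≠ 0 := by simp [Complex.cpow_eq_zero_iff, hq0]
  have e1 : cc (q ^ vm) = cc β * cc (q ^ um) := by
    rw [← map_mul, hβ]; congr 1; field_simp
  have e2 : cc (q ^ vm)⁻¹ = cc (α * β)⁻¹ * cc α * cc (q ^ um)⁻¹ := by
    rw [← map_mul, ← map_mul, hα, hβ]; congr 1; field_simp
  have e3 : cc α⁻¹ = cc (α * β)⁻¹ * cc β := by
    rw [← map_mul]; congr 1; field_simp
  have hc : cc (α * β)⁻¹ * cc α * cc β = 1 := by
    rw [← map_mul, ← map_mul, ← map_one cc]; congr 1; field_simp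
  have hw : cc (q ^ um) * cc (q ^ um)⁻¹ = 1 := by
    rw [← map_mul, mul_inv_cancel₀ hW, map_one]
  rw [e3, lin, lin]
  rcases he with ⟨-, rfl, rfl, rfl⟩ | ⟨-, rfl, rfl, rfl⟩
  · rw [e2, e1, one_smul]
    clear h1 h0 hr
    generalize serF = F, serP = P, serG = G, serQ = Q at hF hG ⊢
    linear_combination ring_bot_neg hc hw hF hG
  · rw [e2, e1]
    clear h1 h0 hr
    generalize serF = F, serP = P, serG = G, serQ = Q at hF hG ⊢
    linear_combination ring_bot_pos hc hw hF hG

end Site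

/-! ### Operators supported on a set of variables -/

section Local

open MvPolynomial

variable {σ : Type}

/-- An operator is *local* on a set `S` of variables if it commutes with the multiplication by all
the other variables and preserves the polynomials in the variables of `S`. -/
def LocalOn (S : Set σ) (A : Op σ) : Prop :=
  (∀ l, l ∉ S → Commute A (mulZ l)) ∧ ∀ f ∈ supported ℂ S, A f ∈ supported ℂ S

/-- An operator commuting with the multiplication by the variables outside `S` is linear over the
polynomials in them. -/
lemma apply_mul_of_commute {S : Set σ} {A : Op σ} (hA : ∀ l, l ∉ S → Commute A (mulZ l))
    {f : MvPolynomial σ ℂ} (hf : f ∈ supported ℂ Sᶜ) (Φ : MvPolynomial σ ℂ) :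
    A (f * Φ) = f * A Φ := by
  induction hf using Algebra.adjoin_induction generalizing Φ with
  | mem x hx =>
    obtain ⟨l, hl, rfl⟩ := hx
    exact LinearMap.congr_fun (hA l hl) Φ
  | algebraMap r => rw [← Algebra.smul_def, ← Algebra.smul_def, map_smul]
  | add x y _ _ hx hy => rw [add_mul, add_mul, map_add, hx, hy]
  | mul x y _ _ hx hy => rw [mul_assoc, hx, hy, mul_assoc]

lemma supported_compl_of_disjoint {S T : Set σ} (h : Disjoint S T) {f : MvPolynomial σ ℂ}
    (hf : f ∈ supported ℂ T) : f ∈ supported ℂ Sᶜ :=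
  supported_mono (Set.subset_compl_iff_disjoint_left.mpr h) hf

/-- Operators that are local on disjoint sets of variables commute. -/
lemma LocalOn.commute {S T : Set σ} {A B : Op σ} (hA : LocalOn S A) (hB : LocalOn T B)
    (h : Disjoint S T) : Commute A B := by
  have key : ∀ Φ : MvPolynomial σ ℂ, ∀ f ∈ supported ℂ S, ∀ g ∈ supported ℂ T,
      A (B (f * g * Φ)) = B (A (f * g * Φ)) := by
    intro Φ
    induction Φ using MvPolynomial.induction_on with
    | C c =>
      intro f hf g hg
      rw [mul_comm, ← smul_eq_C_mul, map_smul, map_smul, map_smul, map_smul,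
        apply_mul_of_commute hB.1 (supported_compl_of_disjoint h.symm hf), mul_comm f,
        apply_mul_of_commute hA.1 (supported_compl_of_disjoint h (hB.2 g hg)), mul_comm f,
        apply_mul_of_commute hA.1 (supported_compl_of_disjoint h hg), mul_comm g,
        apply_mul_of_commute hB.1 (supported_compl_of_disjoint h.symm (hA.2 f hf)), mul_comm]
    | add p r hp hr =>
      intro f hf g hg
      simp only [mul_add, map_add, hp f hf g hg, hr f hf g hg]
    | mul_X p l hp =>
      intro f hf g hg
      by_cases hS : l ∈ S
      · rw [show f * g * (p * X l) = f * X l * g * p by ring]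
        exact hp _ (mul_mem hf (X_mem_supported.mpr hS)) g hg
      · by_cases hT : l ∈ T
        · rw [show f * g * (p * X l) = f * (g * X l) * p by ring]
          exact hp f hf _ (mul_mem hg (X_mem_supported.mpr hT))
        · rw [show f * g * (p * X l) = X l * (f * g * p) by ring]
          have hA' : ∀ Φ, A (X l * Φ) = X l * A Φ := LinearMap.congr_fun (hA.1 l hS)
          have hB' : ∀ Φ, B (X l * Φ) = X l * B Φ := LinearMap.congr_fun (hB.1 l hT)
          rw [hB', hA', hA', hB', hp f hf g hg]
  refine LinearMap.ext fun Φ => ?_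
  simpa using key Φ 1 (one_mem _) 1 (one_mem _)

namespace LocalOn

variable {S : Set σ} {A B : Op σ}

lemma mul (hA : LocalOn S A) (hB : LocalOn S B) : LocalOn S (A * B) :=
  ⟨fun l hl => (hA.1 l hl).mul_left (hB.1 l hl), fun f hf => hA.2 _ (hB.2 f hf)⟩

lemma neg (hA : LocalOn S A) : LocalOn S (-A) :=
  ⟨fun l hl => (hA.1 l hl).neg_left, fun f hf => neg_mem (hA.2 f hf)⟩

lemma mulZ {i : σ} (hi : i ∈ S) : LocalOn S (mulZ i : Op σ) :=
  ⟨fun _ _ => LinearMap.ext fun _ => mul_left_comm _ _ _,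
    fun _ hf => mul_mem (X_mem_supported.mpr hi) hf⟩

lemma perm [DecidableEq σ] {i j : σ} (hi : i ∈ S) (hj : j ∈ S) : LocalOn S (perm i j) := by
  refine ⟨fun l hl => LinearMap.ext fun Φ => ?_, fun f hf => ?_⟩
  · have h : Equiv.swap i j l = l := Equiv.swap_apply_of_ne_of_ne (fun h => hl (h ▸ hi))
      fun h => hl (h ▸ hj)
    simp [XXZ.perm, h]
  · rw [mem_supported] at hf ⊢
    intro l hl
    obtain ⟨k, hk, rfl⟩ := Finset.mem_image.mp (vars_rename _ _ hl)
    rcases eq_or_ne k i with rfl | h1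
    · rwa [Equiv.swap_apply_left]
    · rcases eq_or_ne k j with rfl | h2
      · rwa [Equiv.swap_apply_right]
      · rw [Equiv.swap_apply_of_ne_of_ne h1 h2]
        exact hf hk

end LocalOn

lemma LinearAway.localOn {S : Set σ} {i : σ} {A : Op σ} (hA : LinearAway i A) (hi : i ∈ S)
    (h : ∀ a, A (X i ^ a) ∈ supported ℂ S) : LocalOn S A := by
  refine ⟨fun l hl => hA l fun h => hl (h ▸ hi), fun f hf => ?_⟩
  have key : ∀ m ∈ Submonoid.closure (X '' S : Set (MvPolynomial σ ℂ)), ∀ a,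
      A (X i ^ a * m) ∈ supported ℂ S := by
    intro m hm
    induction hm using Submonoid.closure_induction_left with
    | one => intro a; simpa using h a
    | mul_left x hx m _ ih =>
      obtain ⟨l, hl, rfl⟩ := hx
      intro a
      by_cases hli : l = i
      · subst hli
        rw [← mul_assoc, ← pow_succ]
        exact ih _
      · rw [mul_left_comm, hA.apply_X_mul hli]
        exact mul_mem (X_mem_supported.mpr hl) (ih a)
  have hf' : f ∈ Submodule.span ℂ
      (Submonoid.closure (X '' S : Set (MvPolynomial σ ℂ)) : Set (MvPolynomial σ ℂ)) := by
    rwa [← Algebra.adjoin_eq_span]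
  clear hf
  induction hf' using Submodule.span_induction with
  | mem x hx => simpa using key x hx 0
  | zero => simp
  | add x y _ _ hx hy => rw [map_add]; exact add_mem hx hy
  | smul c x _ hx => rw [map_smul]; exact Subalgebra.smul_mem _ hx c

lemma localOn_eulerFun {S : Set σ} {i : σ} (hi : i ∈ S) (f : ℕ → ℂ) : LocalOn S (eulerFun i f) :=
  (LinearAway.eulerFun f).localOn hi fun a => by
    rw [eulerFun_X_pow]
    exact Subalgebra.smul_mem _ (pow_mem (X_mem_supported.mpr hi) _) _

lemma localOn_divZ {S : Set σ} {i : σ} (hi : i ∈ S) : LocalOn S (divZ i) :=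
  LinearAway.divZ.localOn hi fun a => by
    cases a with
    | zero => rw [pow_zero, divZ_one]; exact zero_mem _
    | succ a => rw [divZ_X_pow_succ]; exact pow_mem (X_mem_supported.mpr hi) _

lemma localOn_sMinus {S : Set σ} {i : σ} (hi : i ∈ S) (q : ℂ) : LocalOn S (sMinus q i) :=
  ((localOn_divZ hi).mul (localOn_eulerFun hi _)).neg

lemma laxPM_zero_zero (q : ℂ) (i : σ) (up um : ℂ) :
    laxPM q i up um 0 0 = eulerFun i fun a => qNum q (up + a) := rfl

lemma laxPM_zero_one (q : ℂ) (i : σ) (up um : ℂ) : laxPM q i up um 0 1 = sMinus q i := rfl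

lemma laxPM_one_zero (q : ℂ) (i : σ) (up um : ℂ) :
    laxPM q i up um 1 0 = mulZ i * eulerFun i fun a => qNum q (up - um + a) := rfl

lemma laxPM_one_one (q : ℂ) (i : σ) (up um : ℂ) :
    laxPM q i up um 1 1 = eulerFun i fun a => qNum q (um - a) := rfl

lemma localOn_laxPM {S : Set σ} {i : σ} (hi : i ∈ S) (q up um : ℂ) (a b : Fin 2) :
    LocalOn S (laxPM q i up um a b) := by
  have h : ∀ a b, LocalOn S (laxPM q i up um a b) := by
    simp only [Fin.forall_fin_two, laxPM_zero_zero, laxPM_zero_one, laxPM_one_zero, laxPM_one_one]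
    exact ⟨⟨localOn_eulerFun hi _, localOn_sMinus hi q⟩,
      (LocalOn.mulZ hi).mul (localOn_eulerFun hi _), localOn_eulerFun hi _⟩
  exact h a b

lemma localOn_Rminus {S : Set σ} {i j : σ} (hi : i ∈ S) (hj : j ∈ S) {q : ℂ} (hij : i ≠ j)
    (up um vm : ℂ) : LocalOn S (Rminus q i j up um vm) := by
  have h : ∀ c : ℕ → ℂ, LocalOn S (onMonomials fun s => ∑ n ∈ Finset.range (s i + 1),
      c n • (weylU q i j ^ n) (monomial s 1)) := fun c =>
    (LinearAway.sum_pow (LinearAway.weylU q j) c).localOn hi fun a => by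
      rw [sum_weylU_X_pow hij]
      exact sum_mem fun x _ => Subalgebra.smul_mem _ (mul_mem
        (pow_mem (X_mem_supported.mpr hi) _) (pow_mem (X_mem_supported.mpr hj) _)) _
  exact ((h _).mul (localOn_eulerFun hi _)).mul (h _)

end Local

/-! ### The intertwining relations for products of Lax matrices -/

section RLL

open MvPolynomial

variable {σ : Type} {q : ℂ} {i j : σ}

lemma qNum_neg (q x : ℂ) : qNum q (-x) = -qNum q x := by
  rw [qNum, qNum, neg_neg, ← neg_div, neg_sub]

lemma op_neg (A : Op σ) : -A = (-1 : ℂ) • A := (neg_one_smul ℂ A).symm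

lemma mulZ_injective (i : σ) : Function.Injective fun A : Op σ => mulZ i * A := fun _ _ h =>
  LinearMap.ext fun Φ => mul_left_cancel₀ (X_ne_zero i) (LinearMap.congr_fun h Φ)

lemma tScale_mul_tScale_inv (j : σ) {r : ℂ} (hr : r ≠ 0) : tScale j r * tScale j r⁻¹ = 1 := by
  rw [tScale, tScale, eulerFun_mul]
  refine op_ext fun s => ?_
  rw [eulerFun_monomial]
  simp [hr]

lemma laxPM_neg_zero_zero (vp vm : ℂ) : laxPM q j (-vm) (-vp) 0 0 =
    (-1 : ℂ) • laxPM q j vp vm 1 1 := by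
  rw [laxPM_zero_zero, laxPM_one_one, eulerFun_smul]
  congr 1; funext a
  rw [neg_one_mul, ← qNum_neg]; congr 1; ring

lemma laxPM_neg_one_one (vp vm : ℂ) : laxPM q j (-vm) (-vp) 1 1 =
    (-1 : ℂ) • laxPM q j vp vm 0 0 := by
  rw [laxPM_zero_zero, laxPM_one_one, eulerFun_smul]
  congr 1; funext a
  rw [neg_one_mul, ← qNum_neg]; congr 1; ring

lemma laxPM_neg_one_zero (vp vm : ℂ) : laxPM q j (-vm) (-vp) 1 0 = laxPM q j vp vm 1 0 := by
  rw [laxPM_one_zero, laxPM_one_zero, show -vm - -vp = vp - vm by ring]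

lemma laxPM_zero_zero_eq (hq0 : q ≠ 0) (up um : ℂ) : laxPM q j up um 0 0 =
    (q - q⁻¹)⁻¹ • (q ^ up • tScale j q - (q ^ up)⁻¹ • tScale j q⁻¹) :=
  eulerFun_qNum_add hq0 j up

lemma laxPM_one_one_eq (hq0 : q ≠ 0) (up um : ℂ) : laxPM q j up um 1 1 =
    (q - q⁻¹)⁻¹ • (q ^ um • tScale j q⁻¹ - (q ^ um)⁻¹ • tScale j q) :=
  eulerFun_qNum_sub hq0 j um

lemma laxPM_one_zero_eq (hq0 : q ≠ 0) (up um : ℂ) : laxPM q j up um 1 0 =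
    (q - q⁻¹)⁻¹ • (mulZ j * ((q ^ up * (q ^ um)⁻¹) • tScale j q -
      ((q ^ up)⁻¹ * q ^ um) • tScale j q⁻¹)) := by
  rw [laxPM_one_zero, eulerFun_qNum_add hq0, mul_smul_comm, Complex.cpow_sub _ _ hq0, inv_div,
    div_eq_mul_inv, div_eq_inv_mul]

lemma mulZ_mul_laxPM_zero_one (up um : ℂ) : mulZ j * laxPM q j up um 0 1 =
    (q - q⁻¹)⁻¹ • (tScale j q⁻¹ - tScale j q) := by
  have h := mulZ_mul_divZ_mul_eulerFun j (fun a => qNum q a) (by simp [qNum])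
  rw [laxPM_zero_one, sMinus, op_neg, mul_smul_comm, ← mul_assoc, h, eulerFun_qNum]
  module

/-- The intertwining relation for the combinations of the columns of the Lax matrix by which it
enters the product with a second one. -/
lemma Rminus_mul_laxPM (hq0 : q ≠ 0) (hq : ∀ n : ℕ, 0 < n → q ^ n ≠ 1) (hij : i ≠ j)
    {up um : ℂ} (vm : ℂ) (hC : NoPole q up um) (a : Fin 2) {r cv cw : ℂ}
    (hr : (r = q⁻¹ ∧ cv = q ^ vm ∧ cw = q ^ um) ∨ (r = q ∧ cv = (q ^ vm)⁻¹ ∧ cw = (q ^ um)⁻¹)) :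
    Rminus q i j up um vm *
        ((laxPM q i up um a 0 + cv • (mulZ j * laxPM q i up um a 1)) * tScale j r) =
      (laxPM q i up vm a 0 + cw • (mulZ j * laxPM q i up vm a 1)) * tScale j r *
        Rminus q i j up um vm := by
  have hr' : (r⁻¹ = q ∧ cv = q ^ vm ∧ cw = q ^ um) ∨
      (r⁻¹ = q⁻¹ ∧ cv = (q ^ vm)⁻¹ ∧ cw = (q ^ um)⁻¹) :=
    hr.imp (fun h => ⟨by rw [h.1, inv_inv], h.2⟩) fun h => ⟨by rw [h.1], h.2⟩
  have hr0 : r ≠ 0 := by rcases hr with ⟨rfl, _⟩ | ⟨rfl, _⟩ <;> simp [hq0]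
  have key : ∀ {L L' : Op σ}, Rminus q i j up um vm * L =
      L' * (tScale j r⁻¹⁻¹ * Rminus q i j up um vm * tScale j r⁻¹) →
      Rminus q i j up um vm * (L * tScale j r) = L' * tScale j r * Rminus q i j up um vm := by
    intro L L' h
    have h1 := tScale_mul_tScale_inv j (inv_ne_zero hr0)
    rw [inv_inv] at h1 h
    rw [← mul_assoc, h]
    simp only [mul_assoc, h1, mul_one]
  have h0 := key (Rminus_top hq0 hq hij hC hr')
  have h1 := key (Rminus_bot hq0 hq hij hC hr')
  revert a
  simp only [Fin.forall_fin_two]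
  exact ⟨h0, h1⟩

/-! The columns of a product `L L'` of Lax matrices, where `A` and `B` form a row of `L`, depend on
`L` only through the combinations `A + q^(± v₋) z_j B` in `Rminus_mul_laxPM`, with `v₋` the parameter of
`L'`. The same holds for the rows and the second factor. -/

section Products

variable {A B : Op σ} (up um : ℂ)

lemma mul_laxPM_col_zero (hq0 : q ≠ 0) (hB : Commute B (mulZ j)) :
    A * laxPM q j up um 0 0 + B * laxPM q j up um 1 0 = (q - q⁻¹)⁻¹ •
      (q ^ up • ((A + (q ^ um)⁻¹ • (mulZ j * B)) * tScale j q) -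
        (q ^ up)⁻¹ • ((A + q ^ um • (mulZ j * B)) * tScale j q⁻¹)) := by
  rw [laxPM_zero_zero_eq hq0, laxPM_one_zero_eq hq0, mul_smul_comm, mul_smul_comm, ← smul_add,
    ← mul_assoc, hB.eq]
  congr 1
  simp only [mul_sub, add_mul, mul_smul_comm, smul_mul_assoc, mul_assoc, smul_add, smul_smul]
  module

lemma mul_laxPM_col_one (hq0 : q ≠ 0) (hA : Commute A (mulZ j)) :
    mulZ j * (A * laxPM q j up um 0 1 + B * laxPM q j up um 1 1) = (q - q⁻¹)⁻¹ •
      ((A + q ^ um • (mulZ j * B)) * tScale j q⁻¹ -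
        (A + (q ^ um)⁻¹ • (mulZ j * B)) * tScale j q) := by
  rw [mul_add, ← mul_assoc, ← hA.eq, mul_assoc, mulZ_mul_laxPM_zero_one, laxPM_one_one_eq hq0,
    mul_smul_comm, mul_smul_comm, mul_smul_comm, ← smul_add]
  congr 1
  simp only [mul_sub, add_mul, mul_smul_comm, smul_mul_assoc, mul_assoc]
  module

lemma laxPM_row_zero_mul (hq0 : q ≠ 0) (hA : ∀ r, Commute A (tScale j r))
    (hB : ∀ r, Commute B (tScale j r)) :
    mulZ j * (laxPM q j up um 0 0 * A + laxPM q j up um 0 1 * B) = (q - q⁻¹)⁻¹ •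
      (((-1 : ℂ) • B + q ^ up • (mulZ j * A)) * tScale j q -
        ((-1 : ℂ) • B + (q ^ up)⁻¹ • (mulZ j * A)) * tScale j q⁻¹) := by
  rw [mul_add, ← mul_assoc _ _ B, mulZ_mul_laxPM_zero_one, laxPM_zero_zero_eq hq0,
    smul_mul_assoc, smul_mul_assoc, mul_smul_comm, ← smul_add]
  congr 1
  simp only [mul_sub, sub_mul, add_mul, mul_smul_comm, smul_mul_assoc, mul_assoc, (hA _).eq,
    (hB _).eq]
  module

lemma laxPM_row_one_mul (hq0 : q ≠ 0) (hA : ∀ r, Commute A (tScale j r))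
    (hB : ∀ r, Commute B (tScale j r)) :
    laxPM q j up um 1 0 * A + laxPM q j up um 1 1 * B = (q - q⁻¹)⁻¹ •
      ((q ^ um)⁻¹ • (((-1 : ℂ) • B + q ^ up • (mulZ j * A)) * tScale j q) -
        q ^ um • (((-1 : ℂ) • B + (q ^ up)⁻¹ • (mulZ j * A)) * tScale j q⁻¹)) := by
  rw [laxPM_one_zero_eq hq0, laxPM_one_one_eq hq0,
    smul_mul_assoc, smul_mul_assoc, ← smul_add]
  congr 1
  simp only [mul_sub, sub_mul, add_mul, mul_smul_comm, smul_mul_assoc, mul_assoc, (hA _).eq,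
    (hB _).eq, smul_add, smul_smul]
  module

end Products

/-- `ℛ⁻` exchanges the parameters `u₋` and `v₋` in a product of two Lax matrices. -/
theorem Rminus_intertwines (hq0 : q ≠ 0) (hq : ∀ n : ℕ, 0 < n → q ^ n ≠ 1) (hij : i ≠ j)
    {up um : ℂ} (vp vm : ℂ) (hC : NoPole q up um) :
    Matrix.scalar (Fin 2) (Rminus q i j up um vm) * (laxPM q i up um * laxPM q j vp vm) =
      laxPM q i up vm * laxPM q j vp um * Matrix.scalar (Fin 2) (Rminus q i j up um vm) := by
  have hz : ∀ u v a b, Commute (laxPM q i u v a b) (mulZ j) := fun u v a b =>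
    (localOn_laxPM (Set.mem_singleton i) q u v a b).1 j hij.symm
  have hR : Commute (mulZ j) (Rminus q i j up um vm) :=
    ((LinearAway.Rminus (i := i) q j up um vm) j hij.symm).symm
  have h1 := fun a => Rminus_mul_laxPM hq0 hq hij vm hC a (Or.inl ⟨rfl, rfl, rfl⟩)
  have h2 := fun a => Rminus_mul_laxPM hq0 hq hij vm hC a (Or.inr ⟨rfl, rfl, rfl⟩)
  generalize Rminus q i j up um vm = R at *
  have c0 : ∀ a, R * (laxPM q i up um * laxPM q j vp vm) a 0 =
      (laxPM q i up vm * laxPM q j vp um) a 0 * R := by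
    intro a
    rw [Matrix.mul_apply, Matrix.mul_apply, Fin.sum_univ_two, Fin.sum_univ_two,
      mul_laxPM_col_zero _ _ hq0 (hz _ _ _ _), mul_laxPM_col_zero _ _ hq0 (hz _ _ _ _),
      mul_smul_comm, mul_sub, mul_smul_comm, mul_smul_comm, h1, h2, smul_mul_assoc, sub_mul,
      smul_mul_assoc, smul_mul_assoc]
  -- multiplication by `z_j` clears the division in `S₋`
  have c1 : ∀ a, R * (laxPM q i up um * laxPM q j vp vm) a 1 =
      (laxPM q i up vm * laxPM q j vp um) a 1 * R := by
    intro a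
    refine mulZ_injective j ?_
    dsimp only
    rw [← mul_assoc, hR.eq, mul_assoc, ← mul_assoc (mulZ j),
      Matrix.mul_apply, Matrix.mul_apply, Fin.sum_univ_two, Fin.sum_univ_two,
      mul_laxPM_col_one _ _ hq0 (hz _ _ _ _), mul_laxPM_col_one _ _ hq0 (hz _ _ _ _),
      mul_smul_comm, mul_sub, h1, h2, smul_mul_assoc, sub_mul]
  refine Matrix.ext fun a b => ?_
  rw [Matrix.scalar_apply, Matrix.diagonal_mul, Matrix.mul_diagonal]
  exact (Fin.forall_fin_two (p := fun b =>
    R * (laxPM q i up um * laxPM q j vp vm) a b = (laxPM q i up vm * laxPM q j vp um) a b * R)).mpr ⟨c0 a, c1 a⟩ b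

/-- `ℛ⁺` is `ℛ⁻` with the two variables exchanged and the signs of the parameters reversed. -/
lemma Rplus_eq_Rminus (q : ℂ) (i j : σ) (up vp vm : ℂ) :
    Rplus q i j up vp vm = Rminus q j i (-vm) (-vp) (-up) := by
  rw [Rplus, Rminus, show -vp - -vm + 2 = vm - vp + 2 by ring,
    show (-up - -vp) / 2 = (vp - up) / 2 by ring, show 2 * -vm - 2 * -up = 2 * up - 2 * vm by ring,
    show 2 * -vm - 2 * -vp = 2 * vp - 2 * vm by ring, show -up - -vm + 2 = 2 + vm - up by ring]

/-- `ℛ⁺` exchanges the parameters `u₊` and `v₊` in a product of two Lax matrices. -/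
theorem Rplus_intertwines (hq0 : q ≠ 0) (hq : ∀ n : ℕ, 0 < n → q ^ n ≠ 1) (hij : i ≠ j)
    (up um : ℂ) {vp vm : ℂ} (hC : NoPole q vp vm) :
    Matrix.scalar (Fin 2) (Rplus q i j up vp vm) * (laxPM q i up um * laxPM q j vp vm) =
      laxPM q i vp um * laxPM q j up vm * Matrix.scalar (Fin 2) (Rplus q i j up vp vm) := by
  rw [Rplus_eq_Rminus]
  have hC' : NoPole q (-vm) (-vp) := fun n => by
    rw [show 2 * -vm - 2 * -vp + 2 * (n : ℂ) = 2 * vp - 2 * vm + 2 * n by ring]; exact hC n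
  have hT : ∀ u v a b r, Commute (laxPM q j u v a b) (tScale i r) := fun u v a b r =>
    (localOn_laxPM (Set.mem_singleton j) q u v a b).commute
      (localOn_eulerFun (Set.mem_singleton i) _) (Set.disjoint_singleton.mpr hij.symm)
  have hR : Commute (mulZ i) (Rminus q j i (-vm) (-vp) (-up)) :=
    ((LinearAway.Rminus (i := j) q i _ _ _) i hij).symm
  have h1 := fun a => Rminus_mul_laxPM hq0 hq hij.symm (-up) hC' a (Or.inl ⟨rfl, rfl, rfl⟩)
  have h2 := fun a => Rminus_mul_laxPM hq0 hq hij.symm (-up) hC' a (Or.inr ⟨rfl, rfl, rfl⟩)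
  simp only [Complex.cpow_neg, inv_inv, Fin.forall_fin_two, laxPM_neg_zero_zero,
    laxPM_neg_one_one, laxPM_neg_one_zero] at h1 h2
  have e : ∀ (A B : Op σ) (c : ℂ), (-1 : ℂ) • A + c • (mulZ i * B) =
      (-1 : ℂ) • (A + c • (mulZ i * ((-1 : ℂ) • B))) := by
    intro A B c
    rw [mul_smul_comm]
    module
  have k : ∀ b, Rminus q j i (-vm) (-vp) (-up) * (((-1 : ℂ) • laxPM q j vp vm 1 b +
        (q ^ up)⁻¹ • (mulZ i * laxPM q j vp vm 0 b)) * tScale i q⁻¹) =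
      ((-1 : ℂ) • laxPM q j up vm 1 b + (q ^ vp)⁻¹ • (mulZ i * laxPM q j up vm 0 b)) * tScale i q⁻¹ *
        Rminus q j i (-vm) (-vp) (-up) ∧ Rminus q j i (-vm) (-vp) (-up) * (((-1 : ℂ) • laxPM q j vp vm 1 b +
        q ^ up • (mulZ i * laxPM q j vp vm 0 b)) * tScale i q) =
      ((-1 : ℂ) • laxPM q j up vm 1 b + q ^ vp • (mulZ i * laxPM q j up vm 0 b)) * tScale i q *
        Rminus q j i (-vm) (-vp) (-up) := by
    simp only [Fin.forall_fin_two]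
    refine ⟨⟨?_, ?_⟩, h1.1, h2.1⟩
    · rw [e, e, smul_mul_assoc, mul_smul_comm, h1.2, smul_mul_assoc, smul_mul_assoc]
    · rw [e, e, smul_mul_assoc, mul_smul_comm, h2.2, smul_mul_assoc, smul_mul_assoc]
  generalize Rminus q j i (-vm) (-vp) (-up) = R at *
  -- multiplication by `z_i` clears the division in `S₋`
  have c0 : ∀ b, R * (laxPM q i up um * laxPM q j vp vm) 0 b =
      (laxPM q i vp um * laxPM q j up vm) 0 b * R := by
    intro b
    refine mulZ_injective i ?_
    dsimp only
    rw [← mul_assoc, hR.eq, mul_assoc, ← mul_assoc (mulZ i),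
      Matrix.mul_apply, Matrix.mul_apply, Fin.sum_univ_two, Fin.sum_univ_two,
      laxPM_row_zero_mul _ _ hq0 (hT _ _ _ _) (hT _ _ _ _),
      laxPM_row_zero_mul _ _ hq0 (hT _ _ _ _) (hT _ _ _ _),
      mul_smul_comm, mul_sub, (k b).1, (k b).2, smul_mul_assoc, sub_mul]
  have c1 : ∀ b, R * (laxPM q i up um * laxPM q j vp vm) 1 b =
      (laxPM q i vp um * laxPM q j up vm) 1 b * R := by
    intro b
    rw [Matrix.mul_apply, Matrix.mul_apply, Fin.sum_univ_two, Fin.sum_univ_two,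
      laxPM_row_one_mul _ _ hq0 (hT _ _ _ _) (hT _ _ _ _),
      laxPM_row_one_mul _ _ hq0 (hT _ _ _ _) (hT _ _ _ _),
      mul_smul_comm, mul_sub, mul_smul_comm, mul_smul_comm, (k b).1, (k b).2, smul_mul_assoc,
      sub_mul, smul_mul_assoc, smul_mul_assoc]
  refine Matrix.ext fun a b => ?_
  rw [Matrix.scalar_apply, Matrix.diagonal_mul, Matrix.mul_diagonal]
  exact (Fin.forall_fin_two (p := fun a =>
    R * (laxPM q i up um * laxPM q j vp vm) a b = (laxPM q i vp um * laxPM q j up vm) a b * R)).mpr ⟨c0 b, c1 b⟩ a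

end RLL

/-! ### The product of `ℛ⁻` with a Lax matrix after a gauge transformation -/

/-! The Lax matrix is taken at the spectral parameter at which `u₊`, `u₋` become `u₊ - v₋`, `u₋ - v₋`, and
is multiplied from both sides by unipotent matrices with the lower left entry `± z_i` or `z_j`. -/

section Gauge

open MvPolynomial

variable {σ : Type} {q up um vm : ℂ} {i j : σ}

local notation "κ" => (q - q⁻¹)⁻¹
local notation "α" => q ^ (up - vm)
local notation "β" => q ^ (vm - um)
local notation "wt" => qNorm (q ^ 2) (α ^ 2 * β ^ 2)
local notation "serF" => qSer (q ^ 2) (α ^ 2) (β • (X i : MvPolynomial σ ℂ))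
local notation "serP" => qSer (q ^ 2) (α ^ 2) (q ^ 2 • β • (X i : MvPolynomial σ ℂ))
local notation "serG" => qSer (q ^ 2) (β ^ 2) (α • (X j : MvPolynomial σ ℂ))
local notation "serQ" => qSer (q ^ 2) (β ^ 2) (q ^ 2 • α • (X j : MvPolynomial σ ℂ))
local notation "cc" => cst (MvPolynomial σ ℂ)

/-- The closed form of `ℛ⁻(up, um | vm - 1)` in terms of the parameters of `ℛ⁻(up, um | vm)`. -/
lemma Rminus_sub_one_X_pow (hq0 : q ≠ 0) (hq : ∀ n : ℕ, 0 < n → q ^ n ≠ 1) (hij : i ≠ j)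
    (hC : NoPole q up um) (a : ℕ) : Rminus q i j up um (vm - 1) (X i ^ a) =
      ((q ^ a)⁻¹ * wt a) • PowerSeries.coeff a (qSer (q ^ 2) (α ^ 2 * q ^ 2) (β • X i) *
        qSer (q ^ 2) (β ^ 2 / q ^ 2) (q ^ 2 • α • (X j : MvPolynomial σ ℂ))) := by
  have h1 : q ^ (up - (vm - 1)) = α * q := by
    rw [show up - (vm - 1) = up - vm + 1 by ring, Complex.cpow_add _ _ hq0, Complex.cpow_one]
  have h2 : q ^ (vm - 1 - um) = β * q⁻¹ := by
    rw [show vm - 1 - um = vm - um - 1 by ring, Complex.cpow_sub _ _ hq0, Complex.cpow_one,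
      div_eq_mul_inv]
  have h3 := qHerm_smul_smul (q ^ 2) (α ^ 2 * q ^ 2) (β ^ 2 / q ^ 2) q⁻¹ (β • (X i : MvPolynomial σ ℂ))
    (q ^ 2 • α • X j) a
  rw [qHerm, qHerm, inv_pow] at h3
  rw [Rminus_X_pow' hq0 hq hij hC, h1, h2, mul_comm (q ^ a)⁻¹, mul_smul (wt a), ← h3,
    show (α * q) ^ 2 * (β * q⁻¹) ^ 2 = α ^ 2 * β ^ 2 by field_simp,
    show (α * q) ^ 2 = α ^ 2 * q ^ 2 by field_simp, show (β * q⁻¹) ^ 2 = β ^ 2 / q ^ 2 by field_simp,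
    show (β * q⁻¹) • (X i : MvPolynomial σ ℂ) = q⁻¹ • β • X i by
      simp only [smul_smul]; congr 1; field_simp,
    show (α * q) • (X j : MvPolynomial σ ℂ) = q⁻¹ • q ^ 2 • α • X j by
      simp only [smul_smul]; congr 1; field_simp]

/-- The closed form of `ℛ⁻(up, um | vm + 1)` in terms of the parameters of `ℛ⁻(up, um | vm)`. -/
lemma Rminus_add_one_X_pow (hq0 : q ≠ 0) (hq : ∀ n : ℕ, 0 < n → q ^ n ≠ 1) (hij : i ≠ j)
    (hC : NoPole q up um) (a : ℕ) : Rminus q i j up um (vm + 1) (X i ^ a) =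
      ((q ^ a)⁻¹ * wt a) • PowerSeries.coeff a (qSer (q ^ 2) (α ^ 2 / q ^ 2) (q ^ 2 • β • X i) *
        qSer (q ^ 2) (β ^ 2 * q ^ 2) (α • (X j : MvPolynomial σ ℂ))) := by
  have h1 : q ^ (up - (vm + 1)) = α * q⁻¹ := by
    rw [show up - (vm + 1) = up - vm - 1 by ring, Complex.cpow_sub _ _ hq0, Complex.cpow_one,
      div_eq_mul_inv]
  have h2 : q ^ (vm + 1 - um) = β * q := by
    rw [show vm + 1 - um = vm - um + 1 by ring, Complex.cpow_add _ _ hq0, Complex.cpow_one]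
  have h3 := qHerm_smul_smul (q ^ 2) (α ^ 2 / q ^ 2) (β ^ 2 * q ^ 2) q⁻¹ (q ^ 2 • β • (X i : MvPolynomial σ ℂ))
    (α • X j) a
  rw [qHerm, qHerm, inv_pow] at h3
  rw [Rminus_X_pow' hq0 hq hij hC, h1, h2, mul_comm (q ^ a)⁻¹, mul_smul (wt a), ← h3,
    show (α * q⁻¹) ^ 2 * (β * q) ^ 2 = α ^ 2 * β ^ 2 by field_simp,
    show (α * q⁻¹) ^ 2 = α ^ 2 / q ^ 2 by field_simp, show (β * q) ^ 2 = β ^ 2 * q ^ 2 by field_simp,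
    show (β * q) • (X i : MvPolynomial σ ℂ) = q⁻¹ • q ^ 2 • β • X i by
      simp only [smul_smul]; congr 1; field_simp,
    show (α * q⁻¹) • (X j : MvPolynomial σ ℂ) = q⁻¹ • α • X j by
      simp only [smul_smul]; congr 1; field_simp]

lemma cpow_ne_zero' (hq0 : q ≠ 0) (x : ℂ) : q ^ x ≠ 0 := by
  simp [Complex.cpow_eq_zero_iff, hq0]

lemma qNum_eq (q x : ℂ) : qNum q x = (q - q⁻¹)⁻¹ * (q ^ x - (q ^ x)⁻¹) := by
  rw [qNum, Complex.cpow_neg, div_eq_inv_mul]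

/-- The image of `z_i^a` under the upper left entry of the gauged product. -/
lemma gauge_entry_one_X_pow (hq0 : q ≠ 0) (hq : ∀ n : ℕ, 0 < n → q ^ n ≠ 1) (hij : i ≠ j)
    (hC : NoPole q up um) (a : ℕ) :
    (Rminus q i j up um vm * (eulerFun i (fun a => qNum q (up - vm + a)) +
      mulZ j * sMinus q i)) (X i ^ a) = (κ * (q ^ a)⁻¹ * wt a) • PowerSeries.coeff a
        ((cc α * (serP * serQ) - cc α⁻¹ * (serF * serG)) +
          lin (X j) * (serF * serG - cc (α ^ 2 * β ^ 2) * (serP * serQ))) := by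
  have h := X_mul_top_lhs (vm := vm) hq0 hq hij hC (up - vm) 1 a
  rwa [one_smul, map_one, one_mul] at h

/-- The upper left entry of the gauged product lowers `vm`. -/
lemma Rminus_gauge_one (hq0 : q ≠ 0) (hq : ∀ n : ℕ, 0 < n → q ^ n ≠ 1) (hij : i ≠ j)
    (hC : NoPole q up um) :
    Rminus q i j up um vm * (eulerFun i (fun a => qNum q (up - vm + a)) + mulZ j * sMinus q i) =
      qNum q (up - vm) • Rminus q i j up um (vm - 1) := by
  have hR := fun v => LinearAway.Rminus (i := i) q j up um v
  refine ((hR vm).mul ((LinearAway.eulerFun _).add ((LinearAway.mulZ j).mul (.sMinus q)))).ext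
    ((hR _).smul _) fun a => ?_
  rw [gauge_entry_one_X_pow hq0 hq hij hC, LinearMap.smul_apply,
    Rminus_sub_one_X_pow hq0 hq hij hC, smul_smul (qNum q _), qNum_eq,
    show κ * (α - α⁻¹) * ((q ^ a)⁻¹ * wt a) = κ * (q ^ a)⁻¹ * wt a * (α - α⁻¹) by ring,
    mul_smul _ (α - α⁻¹), ← coeff_cst_mul (α - α⁻¹)]
  refine congrArg (fun f : PowerSeries (MvPolynomial σ ℂ) =>
    (κ * (q ^ a)⁻¹ * wt a) • PowerSeries.coeff a f) ?_
  have hG := serG_functional (up := up) (um := um) (vm := vm) (j := j) hq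
  have hF' := qSer_mul_base (q ^ 2) (α ^ 2) (β • (X i : MvPolynomial σ ℂ))
  have hG' := qSer_div_base_shift (pow_ne_zero 2 hq0) (sq_pow_ne_one hq) (β ^ 2)
    (α • (X j : MvPolynomial σ ℂ))
  have hα : cc α * cc α⁻¹ = 1 := by
    rw [← map_mul, mul_inv_cancel₀ (cpow_ne_zero' hq0 _), map_one]
  rw [hG', lin_smul]
  generalize serF = F, serP = P, serG = G, serQ = Q,
    qSer (q ^ 2) (α ^ 2 * q ^ 2) (β • (X i : MvPolynomial σ ℂ)) = F' at hF' hG ⊢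
  simp only [map_mul, map_pow, map_sub, lin] at hF' ⊢
  linear_combination ring_gauge_one hα hG hF'

/-- The lower right entry of the gauged product raises `vm`. -/
lemma Rminus_gauge_two (hq0 : q ≠ 0) (hq : ∀ n : ℕ, 0 < n → q ^ n ≠ 1) (hij : i ≠ j)
    (hC : NoPole q up um) :
    Rminus q i j up um vm * eulerFun i (fun a => qNum q (um - vm - a)) -
        mulZ i * (Rminus q i j up um vm * sMinus q i) =
      qNum q (um - vm) • Rminus q i j up um (vm + 1) := by
  have hR := fun v => LinearAway.Rminus (i := i) q j up um v
  refine (((hR vm).mul (LinearAway.eulerFun _)).sub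
    ((LinearAway.mulZ i).mul ((hR vm).mul (.sMinus q)))).ext ((hR _).smul _) fun a => ?_
  have hβ' : q ^ (um - vm) = β⁻¹ := by rw [← Complex.cpow_neg]; congr 1; ring
  rw [LinearMap.sub_apply, Module.End.mul_apply, Rminus_diag_sub hq0 hq hij hC,
    Module.End.mul_apply, Module.End.mul_apply, mulZ_apply, mul_Rminus_lower hq0 hq hij hC,
    ← smul_sub, ← map_sub, LinearMap.smul_apply,
    Rminus_add_one_X_pow hq0 hq hij hC, smul_smul (qNum q _), qNum_eq, hβ', inv_inv,
    show κ * (β⁻¹ - β) * ((q ^ a)⁻¹ * wt a) = κ * (q ^ a)⁻¹ * wt a * (β⁻¹ - β) by ring,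
    mul_smul _ (β⁻¹ - β), ← coeff_cst_mul (β⁻¹ - β)]
  refine congrArg (fun f : PowerSeries (MvPolynomial σ ℂ) =>
    (κ * (q ^ a)⁻¹ * wt a) • PowerSeries.coeff a f) ?_
  have hF := serF_functional (up := up) (um := um) (vm := vm) (i := i) hq
  have hG' := qSer_mul_base (q ^ 2) (β ^ 2) (α • (X j : MvPolynomial σ ℂ))
  have hF' := qSer_div_base_shift (pow_ne_zero 2 hq0) (sq_pow_ne_one hq) (α ^ 2)
    (β • (X i : MvPolynomial σ ℂ))
  have hβ : cc β * cc β⁻¹ = 1 := by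
    rw [← map_mul, mul_inv_cancel₀ (cpow_ne_zero' hq0 _), map_one]
  rw [hF', lin_smul]
  generalize serF = F, serP = P, serG = G, serQ = Q,
    qSer (q ^ 2) (β ^ 2 * q ^ 2) (α • (X j : MvPolynomial σ ℂ)) = G' at hF hG' ⊢
  simp only [map_mul, map_pow, map_sub, lin] at hG' ⊢
  linear_combination ring_gauge_two hβ hF hG'

/-- The lower left entry of the gauged product vanishes. -/
lemma Rminus_gauge_zero (hq0 : q ≠ 0) (hq : ∀ n : ℕ, 0 < n → q ^ n ≠ 1) (hij : i ≠ j)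
    (hC : NoPole q up um) :
    Rminus q i j up um vm * (mulZ i * eulerFun i (fun a => qNum q (up - um + a)) +
        mulZ j * eulerFun i (fun a => qNum q (um - vm - a))) =
      mulZ i * (Rminus q i j up um vm *
        (eulerFun i (fun a => qNum q (up - vm + a)) + mulZ j * sMinus q i)) := by
  have hR := fun v => LinearAway.Rminus (i := i) q j up um v
  refine ((hR vm).mul (((LinearAway.mulZ i).mul (.eulerFun _)).add
    ((LinearAway.mulZ j).mul (.eulerFun _)))).ext ((LinearAway.mulZ i).mul ((hR vm).mul
      ((LinearAway.eulerFun _).add ((LinearAway.mulZ j).mul (.sMinus q))))) fun a => ?_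
  have h := bot_lhs (vm := vm) hq0 hq hij hC (um - vm) 1 a
  rw [one_smul, map_one, one_mul] at h
  have hβ' : q ^ (um - vm) = β⁻¹ := by rw [← Complex.cpow_neg]; congr 1; ring
  rw [h, Module.End.mul_apply, gauge_entry_one_X_pow hq0 hq hij hC, map_smul, mulZ_apply,
    ← coeff_lin_mul, hβ', inv_inv]
  refine congrArg (fun f : PowerSeries (MvPolynomial σ ℂ) =>
    (κ * (q ^ a)⁻¹ * wt a) • PowerSeries.coeff (a + 1) f) ?_
  have hF := serF_functional (up := up) (um := um) (vm := vm) (i := i) hq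
  have hG := serG_functional (up := up) (um := um) (vm := vm) (j := j) hq
  have hβ : cc β * cc β⁻¹ = 1 := by
    rw [← map_mul, mul_inv_cancel₀ (cpow_ne_zero' hq0 _), map_one]
  have hα : cc α * cc α⁻¹ = 1 := by
    rw [← map_mul, mul_inv_cancel₀ (cpow_ne_zero' hq0 _), map_one]
  rw [mul_inv, map_mul, map_mul, map_pow, map_pow, lin, lin]
  generalize serF = F, serP = P, serG = G, serQ = Q at hF hG ⊢
  linear_combination ring_gauge_zero hα hβ hF hG

end Gauge

/-! ### The product of a Lax matrix with `ℛ⁻` after a gauge transformation -/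

/-! The matrix now acts after `ℛ⁻`. The symmetric rescalings `q^(± z_i ∂_i)` make it convenient to use
the series at `q^(-1)`, `q` and `q³` times the argument, here `serF`, `serP` and `serP'`. -/

section GaugeLeft

open MvPolynomial

variable {σ : Type} {q up um vm : ℂ} {i j : σ}

local notation "κ" => (q - q⁻¹)⁻¹
local notation "α" => q ^ (up - vm)
local notation "β" => q ^ (vm - um)
local notation "wt" => qNorm (q ^ 2) (α ^ 2 * β ^ 2)
local notation "serF" => qSer (q ^ 2) (α ^ 2) (q⁻¹ • β • (X i : MvPolynomial σ ℂ))
local notation "serP" => qSer (q ^ 2) (α ^ 2) (q • β • (X i : MvPolynomial σ ℂ))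
local notation "serP'" => qSer (q ^ 2) (α ^ 2) (q ^ 2 • q • β • (X i : MvPolynomial σ ℂ))
local notation "serG" => qSer (q ^ 2) (β ^ 2) (α • (X j : MvPolynomial σ ℂ))
local notation "serQ" => qSer (q ^ 2) (β ^ 2) (q ^ 2 • α • (X j : MvPolynomial σ ℂ))
local notation "serH" => qSer (q ^ 2) (β ^ 2 / q ^ 2) (α • (X j : MvPolynomial σ ℂ))
local notation "serH'" => qSer (q ^ 2) (β ^ 2 / q ^ 2) (q ^ 2 • α • (X j : MvPolynomial σ ℂ))
local notation "cc" => cst (MvPolynomial σ ℂ)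

lemma sq_smul_inv_smul (hq0 : q ≠ 0) (c : ℂ) :
    q ^ 2 • q⁻¹ • c • (X i : MvPolynomial σ ℂ) = q • c • X i := by
  rw [smul_smul (q ^ 2)]; congr 1; field_simp

lemma tScale_Rminus_X_pow (hq0 : q ≠ 0) (hq : ∀ n : ℕ, 0 < n → q ^ n ≠ 1) (hij : i ≠ j)
    (hC : NoPole q up um) (r : ℂ) (a : ℕ) : tScale i r (Rminus q i j up um vm (X i ^ a)) =
      wt a • PowerSeries.coeff a (qSer (q ^ 2) (α ^ 2) (r • β • X i) * serG) := by
  rw [Rminus_X_pow' hq0 hq hij hC, map_smul, ← qHerm, tScale_qHerm_left hij, qHerm]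

lemma cpow_one_add_sub (hq0 : q ≠ 0) : q ^ (1 + um - up) = q * (α * β)⁻¹ := by
  rw [← Complex.cpow_add _ _ hq0, ← Complex.cpow_neg]
  nth_rewrite 2 [← Complex.cpow_one q]
  rw [← Complex.cpow_add _ _ hq0]; congr 1; ring

lemma cpow_one_add_sub' (hq0 : q ≠ 0) : q ^ (1 + um - vm) = q * β⁻¹ := by
  rw [← Complex.cpow_neg]
  nth_rewrite 2 [← Complex.cpow_one q]
  rw [← Complex.cpow_add _ _ hq0]; congr 1; ring

lemma serF_functional_half (hq0 : q ≠ 0) (hq : ∀ n : ℕ, 0 < n → q ^ n ≠ 1) : serF - serP =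
    PowerSeries.X * (cc (q⁻¹ * β) * PowerSeries.C (X i)) * (serF - cc α ^ 2 * serP) := by
  have h := qSer_functional (sq_pow_ne_one hq) (α ^ 2) (q⁻¹ • β • (X i : MvPolynomial σ ℂ))
  rw [sq_smul_inv_smul hq0, smul_smul, lin_smul, map_pow] at h
  unfold lin at h
  rw [smul_smul]
  linear_combination h

lemma serP_functional_half (hq : ∀ n : ℕ, 0 < n → q ^ n ≠ 1) : serP - serP' =
    PowerSeries.X * (cc (q * β) * PowerSeries.C (X i)) * (serP - cc α ^ 2 * serP') := by
  have h := qSer_functional (sq_pow_ne_one hq) (α ^ 2) (q • β • (X i : MvPolynomial σ ℂ))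
  rw [smul_smul q, lin_smul, map_pow] at h
  unfold lin at h
  rw [smul_smul q]
  linear_combination h

/-- The second series with its parameter lowered, and the rescaling of this series. -/
lemma serH_eq (hq0 : q ≠ 0) (hq : ∀ n : ℕ, 0 < n → q ^ n ≠ 1) :
    serH = (1 - cc (β ^ 2 / q ^ 2 * α) * (PowerSeries.X * PowerSeries.C (X j))) * serG ∧
      serH' = (1 - cc α * (PowerSeries.X * PowerSeries.C (X j))) * serG := by
  refine ⟨?_, ?_⟩
  · rw [qSer_div_base (pow_ne_zero 2 hq0) (sq_pow_ne_one hq), lin_smul, map_mul, lin, mul_assoc]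
  · rw [qSer_div_base_shift (pow_ne_zero 2 hq0) (sq_pow_ne_one hq), lin_smul, lin]

lemma coeff_serP_serH' (hq0 : q ≠ 0) (a : ℕ) : PowerSeries.coeff a (serP * serH') =
    (q ^ 2) ^ a • PowerSeries.coeff a (serF * serH) := by
  rw [← sq_smul_inv_smul hq0]
  exact qHerm_smul_smul _ _ _ _ _ _ _

lemma coeff_serP_serQ_half (hq0 : q ≠ 0) (a : ℕ) : PowerSeries.coeff a (serP * serQ) =
    (q ^ 2) ^ a • PowerSeries.coeff a (serF * serG) := by
  rw [← sq_smul_inv_smul hq0]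
  exact qHerm_smul_smul _ _ _ _ _ _ _

lemma coeff_serP'_serQ (a : ℕ) : PowerSeries.coeff a (serP' * serQ) =
    (q ^ 2) ^ a • PowerSeries.coeff a (serP * serG) :=
  qHerm_smul_smul _ _ _ _ _ _ _

/-- The identity between coefficients of series behind `Rminus_gauge_left_two`. -/
lemma coeff_two_aux (hq0 : q ≠ 0) (hq : ∀ n : ℕ, 0 < n → q ^ n ≠ 1) (a : ℕ) :
    X i * (q ^ (1 + um - up) • PowerSeries.coeff a (serF * serG) -
          (q ^ (1 + um - up))⁻¹ • PowerSeries.coeff a (serP * serG)) +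
        X j * (PowerSeries.coeff a (serP * serG) - PowerSeries.coeff a (serF * serG)) =
      X i * ((q ^ (1 + um - up) * (1 - α ^ 2 * β ^ 2 / q ^ 2 * (q ^ 2) ^ a)) •
        PowerSeries.coeff a (serF * serH)) := by
  have h1 : (q ^ (1 + um - up) * (1 - α ^ 2 * β ^ 2 / q ^ 2 * (q ^ 2) ^ a)) •
      PowerSeries.coeff a (serF * serH) = PowerSeries.coeff a (cc (q ^ (1 + um - up)) *
        (serF * serH - cc (α ^ 2 * β ^ 2 / q ^ 2) * (serP * serH'))) := by
    rw [coeff_cst_mul, map_sub, coeff_cst_mul, coeff_serP_serH' hq0]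
    module
  rw [h1, ← map_sub, ← coeff_cst_mul, ← coeff_cst_mul, ← map_sub, coeff_C_mul', coeff_C_mul',
    coeff_C_mul', ← map_add]
  refine congrArg (fun f : PowerSeries (MvPolynomial σ ℂ) => PowerSeries.coeff a f) ?_
  have hα := cpow_ne_zero' hq0 (up - vm)
  have hβ := cpow_ne_zero' hq0 (vm - um)
  have hF := serF_functional_half (up := up) (um := um) (vm := vm) (i := i) hq0 hq
  obtain ⟨hH, hH'⟩ := serH_eq (up := up) (um := um) (vm := vm) (j := j) hq0 hq
  rw [cpow_one_add_sub (up := up) (um := um) (vm := vm) hq0]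
  generalize serF = F, serP = P, serG = G, serH = H, serH' = H' at hF hH hH' ⊢
  rw [hH, hH']
  generalize α = x, β = y at *
  have e1 : cc (q * (x * y)⁻¹) * cc (y ^ 2 / q ^ 2 * x) = cc (q⁻¹ * y) := by
    rw [← map_mul]; congr 1; field_simp
  have e2 : cc (q * (x * y)⁻¹) * cc (x ^ 2 * y ^ 2 / q ^ 2) = cc (q * (x * y)⁻¹)⁻¹ := by
    rw [← map_mul]; congr 1; field_simp
  have e3 : cc (q * (x * y)⁻¹)⁻¹ * cc x = cc (q⁻¹ * y) * cc x ^ 2 := by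
    rw [← map_mul, ← map_pow, ← map_mul]; congr 1; field_simp
  generalize cc (q * (x * y)⁻¹) = s, cc (q * (x * y)⁻¹)⁻¹ = s', cc (y ^ 2 / q ^ 2 * x) = c1,
    cc (x ^ 2 * y ^ 2 / q ^ 2) = c2, cc (q⁻¹ * y) = c3, cc x = c4, PowerSeries.C (X i : MvPolynomial σ ℂ) = Z,
    PowerSeries.C (X j : MvPolynomial σ ℂ) = Y,
    (PowerSeries.X : PowerSeries (MvPolynomial σ ℂ)) = t at *
  linear_combination (-Y * G) * hF + (Z * F * t * Y * G) * e1 +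
    (Z * P * (1 - c4 * (t * Y)) * G) * e2 - (Z * P * t * Y * G) * e3

/-- The lower right entry of the left gauged product on powers of `z_i`. -/
lemma gauge_left_two_X_pow (hq0 : q ≠ 0) (hq : ∀ n : ℕ, 0 < n → q ^ n ≠ 1) (hij : i ≠ j)
    (hC : NoPole q up um) (a : ℕ) :
    eulerFun i (fun a => qNum q (1 + um - up - a)) (Rminus q i j up um vm (X i ^ a)) -
        X j * sMinus q i (Rminus q i j up um vm (X i ^ a)) =
      (κ * wt a * (q ^ (1 + um - up) * (1 - α ^ 2 * β ^ 2 / q ^ 2 * (q ^ 2) ^ a))) •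
        PowerSeries.coeff a (serF * serH) := by
  refine mul_left_cancel₀ (X_ne_zero (R := ℂ) i) ?_
  have h1 := tScale_Rminus_X_pow (vm := vm) hq0 hq hij hC q a
  have h0 := tScale_Rminus_X_pow (vm := vm) hq0 hq hij hC q⁻¹ a
  rw [mul_sub, mul_left_comm (X i) (X j), X_mul_sMinus_of_scale h1 h0,
    qNum_sub_apply_of_scale hq0 _ h1 h0, mul_smul (κ * wt a), mul_smul_comm (κ * wt a),
    ← coeff_two_aux hq0 hq]
  simp only [mul_sub, smul_sub, smul_add, mul_smul_comm, mul_neg, smul_smul]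
  module

/-- The lower right entry of the left gauged product raises `um`. -/
lemma Rminus_gauge_left_two (hq0 : q ≠ 0) (hq : ∀ n : ℕ, 0 < n → q ^ n ≠ 1) (hij : i ≠ j)
    (hC : NoPole q up um) (hC' : NoPole q up (um + 1)) :
    eulerFun i (fun a => qNum q (1 + um - up - a)) * Rminus q i j up um vm -
        mulZ j * (sMinus q i * Rminus q i j up um vm) =
      qNum q (1 + um - up) • Rminus q i j up (um + 1) vm := by
  have hR := fun u => LinearAway.Rminus (i := i) q j up u vm
  refine (((LinearAway.eulerFun _).mul (hR _)).sub ((LinearAway.mulZ j).mul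
    ((LinearAway.sMinus q).mul (hR _)))).ext ((hR _).smul _) fun a => ?_
  have hα := cpow_ne_zero' hq0 (up - vm)
  have hβ := cpow_ne_zero' hq0 (vm - um)
  have hβ' : q ^ (vm - (um + 1)) = q⁻¹ * β := by
    rw [show vm - (um + 1) = vm - um - 1 by ring, Complex.cpow_sub _ _ hq0, Complex.cpow_one,
      div_eq_inv_mul]
  have hn := fun n => hC.qPoch_ne_zero hq0 vm n
  have hn' := hC'.qPoch_ne_zero hq0 vm a
  rw [LinearMap.sub_apply, LinearMap.smul_apply, Module.End.mul_apply, Module.End.mul_apply,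
    Module.End.mul_apply, mulZ_apply, gauge_left_two_X_pow hq0 hq hij hC, Rminus_X_pow' hq0 hq hij hC']
  rw [hβ'] at hn' ⊢
  rw [show (q⁻¹ * β) ^ 2 = β ^ 2 / q ^ 2 by field_simp, ← smul_smul q⁻¹, smul_smul (qNum q _)]
  rw [show (q⁻¹ * β) ^ 2 = β ^ 2 / q ^ 2 by field_simp] at hn'
  refine congrArg (fun c : ℂ => c • PowerSeries.coeff a (serF * serH)) ?_
  rw [qNum_eq, cpow_one_add_sub (up := up) (um := um) (vm := vm) hq0]
  have h2 := qPoch_succ (α ^ 2 * β ^ 2 / q ^ 2) (q ^ 2) a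
  rw [qPoch_succ', div_mul_cancel₀ _ (pow_ne_zero 2 hq0)] at h2
  have hna := hn a
  rw [show α ^ 2 * (β ^ 2 / q ^ 2) = α ^ 2 * β ^ 2 / q ^ 2 by ring] at hn' ⊢
  unfold qNorm
  generalize qPoch (α ^ 2 * β ^ 2) (q ^ 2) a = w, qPoch (α ^ 2 * β ^ 2 / q ^ 2) (q ^ 2) a = w',
    qPoch (q ^ 2) (q ^ 2) a = w'' at *
  generalize α = x, β = y at *
  have e : q * (x * y)⁻¹ - (q * (x * y)⁻¹)⁻¹ = q * (x * y)⁻¹ * (1 - x ^ 2 * y ^ 2 / q ^ 2) := by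
    field_simp
  rw [e]
  generalize q * (x * y)⁻¹ = s, x ^ 2 * y ^ 2 / q ^ 2 = c, κ = k at *
  field_simp
  linear_combination (-(k * w'' * s)) * h2

/-- The identity between coefficients of series behind `Rminus_gauge_left_one`. -/
lemma coeff_one_aux (hq0 : q ≠ 0) (hq : ∀ n : ℕ, 0 < n → q ^ n ≠ 1) (a : ℕ) :
    (1 - (q ^ 2) ^ a * (α ^ 2 * β ^ 2)) •
        (X i * (q ^ (1 + um - vm) • PowerSeries.coeff a (serP * serG) -
          (q ^ (1 + um - vm))⁻¹ • PowerSeries.coeff a (serF * serG))) -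
      (1 - (q ^ 2) ^ (a + 1)) • (PowerSeries.coeff (a + 1) (serP * serG) -
        PowerSeries.coeff (a + 1) (serF * serG)) =
      X i * ((q ^ (1 + um - vm) * (1 - α ^ 2 * β ^ 2 / q ^ 2) * (1 - β ^ 2)) •
        PowerSeries.coeff a (serP * qSer (q ^ 2) (β ^ 2 * q ^ 2) (α • (X j)))) := by
  have hB := qSer_mul_base (q ^ 2) (β ^ 2) (α • (X j : MvPolynomial σ ℂ))
  have h1 : X i * ((q ^ (1 + um - vm) * (1 - α ^ 2 * β ^ 2 / q ^ 2) * (1 - β ^ 2)) •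
        PowerSeries.coeff a (serP * qSer (q ^ 2) (β ^ 2 * q ^ 2) (α • (X j)))) =
      PowerSeries.coeff (a + 1) (lin (X i) * (cc (q ^ (1 + um - vm) *
        (1 - α ^ 2 * β ^ 2 / q ^ 2)) * (serP * (serG - cc (β ^ 2) * serQ)))) := by
    rw [coeff_lin_mul, coeff_cst_mul, ← hB, mul_left_comm serP,
      show (1 - cc (β ^ 2)) = cc (1 - β ^ 2) by rw [map_sub, map_one], coeff_cst_mul,
      mul_smul _ (1 - β ^ 2)]
  have h2 : (1 - (q ^ 2) ^ a * (α ^ 2 * β ^ 2)) •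
        (X i * (q ^ (1 + um - vm) • PowerSeries.coeff a (serP * serG) -
          (q ^ (1 + um - vm))⁻¹ • PowerSeries.coeff a (serF * serG))) =
      PowerSeries.coeff (a + 1) (lin (X i) * ((cc (q ^ (1 + um - vm)) * (serP * serG) -
        cc (q ^ (1 + um - vm))⁻¹ * (serF * serG)) - cc (α ^ 2 * β ^ 2) *
          (cc (q ^ (1 + um - vm)) * (serP' * serQ) -
        cc (q ^ (1 + um - vm))⁻¹ * (serP * serQ)))) := by
    rw [coeff_lin_mul]
    simp only [map_sub, coeff_cst_mul]
    rw [coeff_serP_serQ_half hq0, coeff_serP'_serQ, ← mul_smul_comm]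
    congr 1
    module
  have h3 : (1 - (q ^ 2) ^ (a + 1)) • (PowerSeries.coeff (a + 1) (serP * serG) -
        PowerSeries.coeff (a + 1) (serF * serG)) =
      PowerSeries.coeff (a + 1) ((serP * serG - serF * serG) -
        (serP' * serQ - serP * serQ)) := by
    simp only [map_sub]
    rw [coeff_serP_serQ_half hq0, coeff_serP'_serQ]
    module
  rw [h1, h2, h3, ← map_sub]
  clear h1 h2 h3 hB
  refine congrArg (fun f : PowerSeries (MvPolynomial σ ℂ) => PowerSeries.coeff (a + 1) f) ?_
  have hα := cpow_ne_zero' hq0 (up - vm)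
  have hβ := cpow_ne_zero' hq0 (vm - um)
  have hF := serF_functional_half (up := up) (um := um) (vm := vm) (i := i) hq0 hq
  have hP := serP_functional_half (up := up) (um := um) (vm := vm) (i := i) hq
  rw [cpow_one_add_sub' (um := um) (vm := vm) hq0, lin]
  generalize serF = F, serP = P, serP' = P', serG = G, serQ = Q at hF hP ⊢
  generalize α = x, β = y at *
  have e1 : cc (q * y⁻¹)⁻¹ = cc (q⁻¹ * y) := by congr 1; field_simp
  have e2 : cc (q * y⁻¹ * (1 - x ^ 2 * y ^ 2 / q ^ 2)) =
      cc (q * y⁻¹) - cc (q⁻¹ * y) * cc x ^ 2 := by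
    rw [← map_pow, ← map_mul, ← map_sub]; congr 1; field_simp
  have e3 : cc (x ^ 2 * y ^ 2) * cc (q * y⁻¹) = cc (q * y) * cc x ^ 2 := by
    rw [← map_pow, ← map_mul, ← map_mul]; congr 1; field_simp
  have e4 : cc (q * y⁻¹) * cc (y ^ 2) = cc (q * y) := by
    rw [← map_mul]; congr 1; field_simp
  have e5 : cc (x ^ 2 * y ^ 2) = cc x ^ 2 * cc (y ^ 2) := by rw [map_mul, map_pow]
  rw [e2, e1]
  generalize cc (q * y⁻¹) = s, cc (q⁻¹ * y) = c3, cc (q * y) = c4, cc (x ^ 2 * y ^ 2) = c5,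
    cc (y ^ 2) = c6, cc x = c7,
    PowerSeries.C (X i : MvPolynomial σ ℂ) = Z,
    (PowerSeries.X : PowerSeries (MvPolynomial σ ℂ)) = t at *
  linear_combination G * hF - Q * hP - (t * Z * P' * Q) * e3 + (t * Z * c3 * P * Q) * e5 +
    (t * Z * P * Q) * e4

/-- The upper left entry of the left gauged product on powers of `z_i`. -/
lemma gauge_left_one_X_pow (hq0 : q ≠ 0) (hq : ∀ n : ℕ, 0 < n → q ^ n ≠ 1) (hij : i ≠ j)
    (hC : NoPole q up um) (a : ℕ) :
    X i * (eulerFun i (fun a => qNum q (1 + um - vm + a)) (Rminus q i j up um vm (X i ^ a)) +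
        sMinus q i (Rminus q i j up um vm (X i ^ (a + 1)))) =
      κ • (wt a • (X i * (q ^ (1 + um - vm) • PowerSeries.coeff a (serP * serG) -
          (q ^ (1 + um - vm))⁻¹ • PowerSeries.coeff a (serF * serG))) -
        wt (a + 1) • (PowerSeries.coeff (a + 1) (serP * serG) -
          PowerSeries.coeff (a + 1) (serF * serG))) := by
  have h := fun n => tScale_Rminus_X_pow (vm := vm) hq0 hq hij hC q n
  have h' := fun n => tScale_Rminus_X_pow (vm := vm) hq0 hq hij hC q⁻¹ n
  rw [mul_add, X_mul_sMinus_of_scale (h _) (h' _), qNum_add_apply_of_scale hq0 _ (h _) (h' _)]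
  simp only [mul_sub, smul_sub, mul_smul_comm, smul_smul]
  module

/-- The upper left entry of the left gauged product lowers `um`. -/
lemma Rminus_gauge_left_one (hq0 : q ≠ 0) (hq : ∀ n : ℕ, 0 < n → q ^ n ≠ 1) (hij : i ≠ j)
    (hC : NoPole q up um) :
    eulerFun i (fun a => qNum q (1 + um - vm + a)) * Rminus q i j up um vm +
        sMinus q i * (Rminus q i j up um vm * mulZ i) =
      (qNum q (um - vm) * qNum q (1 + um - up) / qNum q (um - up)) •
        Rminus q i j up (um - 1) vm := by
  have hR := fun u => LinearAway.Rminus (i := i) q j up u vm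
  refine (((LinearAway.eulerFun _).mul (hR _)).add ((LinearAway.sMinus q).mul
    ((hR _).mul (.mulZ i)))).ext ((hR _).smul _) fun a => ?_
  have hα := cpow_ne_zero' hq0 (up - vm)
  have hβ := cpow_ne_zero' hq0 (vm - um)
  have hβ' : q ^ (vm - (um - 1)) = q * β := by
    rw [show vm - (um - 1) = vm - um + 1 by ring, Complex.cpow_add _ _ hq0, Complex.cpow_one,
      mul_comm]
  have hC' : NoPole q up (um - 1) := fun n => by
    have := hC (n + 1)
    rwa [show 2 * up - 2 * (um - 1) + 2 * (n : ℂ) = 2 * up - 2 * um + 2 * ((n + 1 : ℕ) : ℂ) by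
      push_cast; ring]
  have hn := fun n => hC.qPoch_ne_zero hq0 vm n
  have hn' := hC'.qPoch_ne_zero hq0 vm a
  have hna := hn (a + 1)
  rw [qPoch_succ] at hna
  have hd := right_ne_zero_of_mul hna
  refine mul_left_cancel₀ (X_ne_zero (R := ℂ) i) ?_
  refine smul_right_injective _ hd ?_
  dsimp only
  rw [LinearMap.add_apply, LinearMap.smul_apply, Module.End.mul_apply, Module.End.mul_apply,
    Module.End.mul_apply, mulZ_apply, ← pow_succ', gauge_left_one_X_pow hq0 hq hij hC,
    smul_comm _ κ, smul_sub, smul_smul _ (wt (a + 1)), mul_comm _ (wt (a + 1)),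
    qNorm_succ hq0 hC, smul_comm _ (wt a), mul_smul (wt a), ← smul_sub, coeff_one_aux hq0 hq,
    Rminus_X_pow' hq0 hq hij hC', hβ', show (q * β) ^ 2 = β ^ 2 * q ^ 2 by ring, ← smul_smul q β,
    ← mul_smul_comm, ← mul_smul_comm, ← mul_smul_comm]
  refine congrArg (fun f => X i * f) ?_
  rw [smul_smul, smul_smul, smul_smul (1 - _), smul_smul (_ * _)]
  refine congrArg (fun c : ℂ => c • PowerSeries.coeff a
    (serP * qSer (q ^ 2) (β ^ 2 * q ^ 2) (α • (X j)))) ?_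
  rw [hβ', show (q * β) ^ 2 = β ^ 2 * q ^ 2 by ring] at hn'
  have h2 := qPoch_succ' (α ^ 2 * β ^ 2) (q ^ 2) a
  rw [qPoch_succ] at h2
  have hw := hn a
  have h1C : 1 - α ^ 2 * β ^ 2 ≠ 0 := by
    have := hn 1
    rwa [qPoch_succ', qPoch_zero, mul_one] at this
  rw [show α ^ 2 * (β ^ 2 * q ^ 2) = α ^ 2 * β ^ 2 * q ^ 2 by ring] at hn' ⊢
  have e1 : q ^ (um - vm) = β⁻¹ := by rw [← Complex.cpow_neg]; congr 1; ring
  have e2 : q ^ (um - up) = (α * β)⁻¹ := by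
    rw [← Complex.cpow_add _ _ hq0, ← Complex.cpow_neg]; congr 1; ring
  have hκ : κ ≠ 0 := by
    refine inv_ne_zero fun h => hq 2 two_pos ?_
    have h' := congrArg (fun x => x * q) h
    simp only [sub_mul, zero_mul, inv_mul_cancel₀ hq0] at h'
    linear_combination h'
  rw [qNum_eq, qNum_eq, qNum_eq, cpow_one_add_sub (up := up) (um := um) (vm := vm) hq0,
    cpow_one_add_sub' hq0, e1, e2]
  unfold qNorm
  generalize qPoch (α ^ 2 * β ^ 2) (q ^ 2) a = w,
    qPoch (α ^ 2 * β ^ 2 * q ^ 2) (q ^ 2) a = w', qPoch (q ^ 2) (q ^ 2) a = w'',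
    (q ^ 2) ^ a = r at *
  generalize α = x, β = y at *
  have e3 : (x * y)⁻¹ - (x * y)⁻¹⁻¹ = (x * y)⁻¹ * (1 - x ^ 2 * y ^ 2) := by field_simp
  have e4 : q * (x * y)⁻¹ - (q * (x * y)⁻¹)⁻¹ = q * (x * y)⁻¹ * (1 - x ^ 2 * y ^ 2 / q ^ 2) := by
    field_simp
  have e5 : y⁻¹ - y⁻¹⁻¹ = y⁻¹ * (1 - y ^ 2) := by field_simp
  have e6 : 1 - r * (x ^ 2 * y ^ 2) = (1 - x ^ 2 * y ^ 2) * w' / w := by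
    field_simp; linear_combination h2
  rw [e3, e4, e5, e6]
  clear e1 e2 e3 e4 e5 e6 h2 hd hna hn hC hC' hq
  generalize 1 - x ^ 2 * y ^ 2 / q ^ 2 = c1, 1 - x ^ 2 * y ^ 2 = c2, 1 - y ^ 2 = c3, κ = k at *
  field_simp

/-- The identity between coefficients of series behind `Rminus_gauge_left_zero`. -/
lemma coeff_zero_aux (hq0 : q ≠ 0) (hq : ∀ n : ℕ, 0 < n → q ^ n ≠ 1) (a : ℕ) :
    X i * (α • PowerSeries.coeff a (serP * serG) - α⁻¹ • PowerSeries.coeff a (serF * serG)) +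
        (q ^ (1 + um - up) * (1 - (q ^ 2) ^ (a + 1))) • PowerSeries.coeff (a + 1) (serF * serH) =
      X j * (q ^ (1 + um - vm) • PowerSeries.coeff a (serP * serG) -
          (q ^ (1 + um - vm))⁻¹ • PowerSeries.coeff a (serF * serG)) := by
  have h1 : (q ^ (1 + um - up) * (1 - (q ^ 2) ^ (a + 1))) •
      PowerSeries.coeff (a + 1) (serF * serH) = PowerSeries.coeff (a + 1)
        (cc (q ^ (1 + um - up)) * (serF * serH - serP * serH')) := by
    rw [coeff_cst_mul, map_sub, coeff_serP_serH' hq0]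
    module
  rw [h1]
  simp only [← coeff_cst_mul, ← map_sub, ← coeff_lin_mul, ← map_add]
  refine congrArg (fun f : PowerSeries (MvPolynomial σ ℂ) => PowerSeries.coeff (a + 1) f) ?_
  have hα := cpow_ne_zero' hq0 (up - vm)
  have hβ := cpow_ne_zero' hq0 (vm - um)
  have hF := serF_functional_half (up := up) (um := um) (vm := vm) (i := i) hq0 hq
  obtain ⟨hH, hH'⟩ := serH_eq (up := up) (um := um) (vm := vm) (j := j) hq0 hq
  rw [cpow_one_add_sub (up := up) (um := um) (vm := vm) hq0, cpow_one_add_sub' hq0, lin, lin]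
  generalize serF = F, serP = P, serG = G, serH = H, serH' = H' at hF hH hH' ⊢
  rw [hH, hH']
  generalize α = x, β = y at *
  have e1 : cc (q * (x * y)⁻¹) * cc (q⁻¹ * y) = cc x⁻¹ := by
    rw [← map_mul]; congr 1; field_simp
  have e2 : cc x⁻¹ * cc x ^ 2 = cc x := by
    rw [← map_pow, ← map_mul]; congr 1; field_simp
  have e3 : cc (q * (x * y)⁻¹) * cc (y ^ 2 / q ^ 2 * x) = cc (q * y⁻¹)⁻¹ := by
    rw [← map_mul]; congr 1; field_simp
  have e4 : cc (q * (x * y)⁻¹) * cc x = cc (q * y⁻¹) := by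
    rw [← map_mul]; congr 1; field_simp
  generalize cc (q * (x * y)⁻¹) = s, cc (q⁻¹ * y) = c1, cc x⁻¹ = c2, cc x = c3,
    cc (y ^ 2 / q ^ 2 * x) = c4, cc (q * y⁻¹)⁻¹ = c5, cc (q * y⁻¹) = c6,
    PowerSeries.C (X i : MvPolynomial σ ℂ) = Z, PowerSeries.C (X j : MvPolynomial σ ℂ) = Y,
    (PowerSeries.X : PowerSeries (MvPolynomial σ ℂ)) = t at *
  linear_combination (s * G) * hF + (t * Z * (F - c3 ^ 2 * P) * G) * e1 - (t * Z * P * G) * e2 -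
    (t * Y * F * G) * e3 + (t * Y * P * G) * e4

/-- The lower left entry of the left gauged product vanishes. -/
lemma Rminus_gauge_left_zero (hq0 : q ≠ 0) (hq : ∀ n : ℕ, 0 < n → q ^ n ≠ 1) (hij : i ≠ j)
    (hC : NoPole q up um) :
    mulZ i * eulerFun i (fun a => qNum q (up - vm + a)) * Rminus q i j up um vm +
        eulerFun i (fun a => qNum q (1 + um - up - a)) * (Rminus q i j up um vm * mulZ i) =
      mulZ j * (eulerFun i (fun a => qNum q (1 + um - vm + a)) * Rminus q i j up um vm +
        sMinus q i * (Rminus q i j up um vm * mulZ i)) := by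
  have hR := fun u => LinearAway.Rminus (i := i) q j up u vm
  refine ((((LinearAway.mulZ i).mul (.eulerFun _)).mul (hR _)).add ((LinearAway.eulerFun _).mul
    ((hR _).mul (.mulZ i)))).ext ((LinearAway.mulZ j).mul (((LinearAway.eulerFun _).mul
      (hR _)).add ((LinearAway.sMinus q).mul ((hR _).mul (.mulZ i))))) fun a => ?_
  refine mul_left_cancel₀ (X_ne_zero (R := ℂ) i) ?_
  have h := fun n => tScale_Rminus_X_pow (vm := vm) hq0 hq hij hC q n
  have h' := fun n => tScale_Rminus_X_pow (vm := vm) hq0 hq hij hC q⁻¹ n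
  simp only [LinearMap.add_apply, Module.End.mul_apply, mulZ_apply]
  rw [← pow_succ', mul_left_comm (X i) (X j), gauge_left_one_X_pow hq0 hq hij hC,
    qNum_add_apply_of_scale hq0 _ (h _) (h' _), qNum_sub_apply_of_scale hq0 _ (h _) (h' _)]
  have h1 := coeff_zero_aux (up := up) (um := um) (vm := vm) (i := i) (j := j) hq0 hq a
  have h2 := coeff_two_aux (up := up) (um := um) (vm := vm) (i := i) (j := j) hq0 hq (a + 1)
  have h3 := qNorm_succ (vm := vm) hq0 hC a
  have h4 : α ^ 2 * β ^ 2 / q ^ 2 * (q ^ 2) ^ (a + 1) = (q ^ 2) ^ a * (α ^ 2 * β ^ 2) := by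
    field_simp; ring
  rw [h4] at h2
  clear h h' hR h4
  revert h1 h2 h3
  generalize PowerSeries.coeff a (serP * serG) = cP,
    PowerSeries.coeff a (serF * serG) = cF, PowerSeries.coeff (a + 1) (serP * serG) = cP',
    PowerSeries.coeff (a + 1) (serF * serG) = cF', PowerSeries.coeff (a + 1) (serF * serH) = cH,
    wt a = w, wt (a + 1) = w', κ = k
  generalize q ^ (1 + um - up) = s, q ^ (1 + um - vm) = s',
    (q ^ 2) ^ a * (α ^ 2 * β ^ 2) = e, (q ^ 2) ^ (a + 1) = e'
  generalize α = x
  intro h1 h2 h3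
  simp only [Algebra.smul_def, map_mul, map_sub, map_one] at h1 h2 ⊢
  have h3' : algebraMap ℂ (MvPolynomial σ ℂ) w' * (1 - algebraMap _ _ e) =
      algebraMap _ _ w * (1 - algebraMap _ _ e') := by
    rw [← map_one (algebraMap ℂ (MvPolynomial σ ℂ)), ← map_sub, ← map_sub, ← map_mul, ← map_mul, h3]
  linear_combination algebraMap ℂ (MvPolynomial σ ℂ) k * (algebraMap ℂ _ w' * h2 +
    X i * algebraMap ℂ _ w * h1 + X i * cH * algebraMap ℂ _ s * h3')

end GaugeLeft

/-! ### The operators of one site -/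

section SiteOperator

variable {σ : Type} {q : ℂ} {i o : σ}

/-- `ℛ⁻` depends only on differences of the parameters. -/
lemma Rminus_shift (q : ℂ) (i j : σ) (up um vm c : ℂ) :
    Rminus q i j (up + c) (um + c) (vm + c) = Rminus q i j up um vm := by
  unfold Rminus
  simp only [add_sub_add_right_eq_sub, mul_add]

lemma Rplus_shift (q : ℂ) (i j : σ) (up vp vm c : ℂ) :
    Rplus q i j (up + c) (vp + c) (vm + c) = Rplus q i j up vp vm := by
  rw [Rplus_eq_Rminus, Rplus_eq_Rminus, ← Rminus_shift q j i _ _ _ c]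
  congr 1 <;> ring

lemma NoPole.shift {q up um : ℂ} (h : NoPole q up um) (c : ℂ) : NoPole q (up + c) (um + c) :=
  fun j => by
    rw [show 2 * (up + c) - 2 * (um + c) + 2 * (j : ℂ) = 2 * up - 2 * um + 2 * j by ring]
    exact h j

/-- The gauge matrix `(1, 0; z, 1)`. -/
def gaugeG (i : σ) : Matrix (Fin 2) (Fin 2) (Op σ) := !![1, 0; mulZ i, 1]

lemma scalar_mul_gaugeG {A : Op σ} {i j : σ} (h : A * mulZ i = mulZ j * A) :
    Matrix.scalar (Fin 2) A * gaugeG i = gaugeG j * Matrix.scalar (Fin 2) A := by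
  refine Matrix.ext fun a b => ?_
  rw [Matrix.scalar_apply, Matrix.diagonal_mul, Matrix.mul_diagonal]
  revert a b
  simp [Fin.forall_fin_two, gaugeG, h]

variable [DecidableEq σ]

/-- The operator `ℝ_{i o}` of a site with spin `ℓ` and inhomogeneity `δ`, in terms of the
parameters `u₁` and `u₂`. -/
def siteR (q : ℂ) (i o : σ) (ℓ δ u₁ u₂ : ℂ) : Op σ :=
  perm i o * (Rplus q i o (δ + ℓ) (1 - u₁) (δ - ℓ) * Rminus q i o (δ + ℓ) (δ - ℓ) (-u₂))

lemma Rop_eq_siteR (q : ℂ) (i o : σ) (ℓ δ u₁ u₂ : ℂ) :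
    Rop q i o ℓ ((1 + u₂ - u₁) / 2) ((u₁ + u₂ - 1) / 2 + δ) = siteR q i o ℓ δ u₁ u₂ := by
  rw [siteR, ← Rplus_shift q i o _ _ _ ((u₁ + u₂ - 1) / 2),
    ← Rminus_shift q i o _ _ _ ((u₁ + u₂ - 1) / 2), Rop, Rcheck]
  congr 3 <;> ring

lemma perm_mul_mulZ (i o : σ) : perm i o * mulZ i = mulZ o * perm i o := by
  refine LinearMap.ext fun Φ => ?_
  simp [perm]

lemma perm_monomial (i o : σ) (s : σ →₀ ℕ) (c : ℂ) : perm i o (MvPolynomial.monomial s c) =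
    MvPolynomial.monomial (s.equivMapDomain (Equiv.swap i o)) c := by
  change MvPolynomial.rename _ _ = _
  rw [MvPolynomial.rename_monomial, Finsupp.equivMapDomain_eq_mapDomain]

lemma perm_mul_eulerFun (i o : σ) (f : ℕ → ℂ) :
    perm i o * eulerFun i f = eulerFun o f * perm i o := by
  refine op_ext fun s => ?_
  rw [Module.End.mul_apply, Module.End.mul_apply, eulerFun_monomial, perm_monomial, perm_monomial,
    eulerFun_monomial]
  simp

lemma perm_mul_divZ (i o : σ) : perm i o * divZ i = divZ o * perm i o := by
  refine op_ext fun s => ?_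
  rw [Module.End.mul_apply, Module.End.mul_apply, perm_monomial, divZ, divZ, onMonomials_monomial,
    onMonomials_monomial]
  simp only [Finsupp.equivMapDomain_apply, Equiv.symm_swap, Equiv.swap_apply_right]
  split_ifs with h
  · simp
  · rw [perm_monomial]
    refine congrArg (fun t => MvPolynomial.monomial t (1 : ℂ)) (Finsupp.ext fun x => ?_)
    simp only [Finsupp.equivMapDomain_apply, Equiv.symm_swap, Finsupp.tsub_apply]
    congr 1
    rw [Finsupp.single_apply, Finsupp.single_apply]
    congr 1
    rw [eq_comm (a := i), Equiv.swap_apply_eq_iff, Equiv.swap_apply_left, eq_comm (a := x)]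

lemma perm_mul_laxPM (i o : σ) (up um : ℂ) (a b : Fin 2) :
    perm i o * laxPM q i up um a b = laxPM q o up um a b * perm i o := by
  have h : ∀ a b, perm i o * laxPM q i up um a b = laxPM q o up um a b * perm i o := by
    simp only [Fin.forall_fin_two, laxPM_zero_zero, laxPM_zero_one, laxPM_one_zero, laxPM_one_one,
      sMinus, op_neg, mul_smul_comm, smul_mul_assoc]
    simp only [← mul_assoc, perm_mul_eulerFun, perm_mul_mulZ, perm_mul_divZ]
    simp only [mul_assoc, perm_mul_eulerFun, and_self]
  exact h a b

lemma perm_intertwines (i o : σ) (up um vp vm : ℂ) :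
    Matrix.scalar (Fin 2) (perm i o) * (laxPM q i up um * laxPM q o vp vm) =
      laxPM q o up um * laxPM q i vp vm * Matrix.scalar (Fin 2) (perm i o) := by
  have hc : perm i o = perm o i := by rw [perm, perm, Equiv.swap_comm]
  have h1 : Matrix.scalar (Fin 2) (perm i o) * laxPM q i up um =
      laxPM q o up um * Matrix.scalar (Fin 2) (perm i o) := by
    refine Matrix.ext fun a b => ?_
    rw [Matrix.scalar_apply, Matrix.diagonal_mul, Matrix.mul_diagonal, perm_mul_laxPM]
  have h2 : Matrix.scalar (Fin 2) (perm i o) * laxPM q o vp vm =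
      laxPM q i vp vm * Matrix.scalar (Fin 2) (perm i o) := by
    refine Matrix.ext fun a b => ?_
    rw [Matrix.scalar_apply, Matrix.diagonal_mul, Matrix.mul_diagonal, hc, perm_mul_laxPM]
  rw [← mul_assoc, h1, mul_assoc, h2, mul_assoc]

/-- The intertwining relation for the operator of one site. -/
theorem siteR_intertwines (hq0 : q ≠ 0) (hq : ∀ n : ℕ, 0 < n → q ^ n ≠ 1) (hio : i ≠ o)
    {ℓ δ u₁ : ℂ} (u₂ v : ℂ) (h1 : NoPole q (δ + ℓ) (δ - ℓ)) (h2 : NoPole q (1 - u₁) (δ - ℓ)) :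
    Matrix.scalar (Fin 2) (siteR q i o ℓ δ u₁ u₂) *
        (lax q ℓ i (v + δ) * laxPM q o (1 - u₁ + v) (-u₂ + v)) =
      laxPM q o (1 - u₁ + v) (-u₂ + v) * lax q ℓ i (v + δ) *
        Matrix.scalar (Fin 2) (siteR q i o ℓ δ u₁ u₂) := by
  rw [lax_eq_laxPM, show v + δ + ℓ = δ + ℓ + v by ring, show v + δ - ℓ = δ - ℓ + v by ring, siteR,
    ← Rplus_shift q i o _ _ _ v, ← Rminus_shift q i o _ _ _ v, map_mul, map_mul, mul_assoc,
    mul_assoc, Rminus_intertwines hq0 hq hio _ _ (h1.shift v), ← mul_assoc (Matrix.scalar (Fin 2)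
    (Rplus _ _ _ _ _ _)), Rplus_intertwines hq0 hq hio _ _ (h2.shift v), mul_assoc, ← mul_assoc,
    perm_intertwines]
  simp only [mul_assoc]

/-- After a gauge transformation the product of `ℝ_{i o}(u₁ | u₂)` with the Lax matrix at `u₂` is
triangular. -/
theorem siteR_mul_lax (hq0 : q ≠ 0) (hq : ∀ n : ℕ, 0 < n → q ^ n ≠ 1) (hio : i ≠ o)
    {ℓ δ : ℂ} (u₁ u₂ : ℂ) (h1 : NoPole q (δ + ℓ) (δ - ℓ)) :
    ∃ B, Matrix.scalar (Fin 2) (siteR q i o ℓ δ u₁ u₂) * lax q ℓ i (u₂ + δ) * gaugeG o =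
      gaugeG o * !![qNum q (u₂ + δ + ℓ) • siteR q i o ℓ δ u₁ (u₂ + 1), B;
        0, qNum q (u₂ + δ - ℓ) • siteR q i o ℓ δ u₁ (u₂ - 1)] := by
  set R := Rminus q i o (δ + ℓ) (δ - ℓ) (-u₂) with hR
  have e1 := Rminus_gauge_one (vm := -u₂) hq0 hq hio h1
  have e2 := Rminus_gauge_two (vm := -u₂) hq0 hq hio h1
  have e0 := Rminus_gauge_zero (vm := -u₂) hq0 hq hio h1
  rw [e1] at e0
  rw [← hR] at e0 e1 e2
  rw [show δ + ℓ - -u₂ = u₂ + δ + ℓ by ring] at e0 e1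
  rw [show δ - ℓ - -u₂ = u₂ + δ - ℓ by ring] at e0 e2
  rw [show -u₂ - 1 = -(u₂ + 1) by ring] at e0 e1
  rw [show -u₂ + 1 = -(u₂ - 1) by ring] at e2
  have hz : ∀ a b, laxPM q i (u₂ + δ + ℓ) (u₂ + δ - ℓ) a b * mulZ o =
      mulZ o * laxPM q i (u₂ + δ + ℓ) (u₂ + δ - ℓ) a b := fun a b =>
    (localOn_laxPM (Set.mem_singleton i) _ _ _ a b).1 o hio.symm
  have key : Matrix.scalar (Fin 2) R * lax q ℓ i (u₂ + δ) * gaugeG o = gaugeG i *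
      !![qNum q (u₂ + δ + ℓ) • Rminus q i o (δ + ℓ) (δ - ℓ) (-(u₂ + 1)), R * sMinus q i;
        0, qNum q (u₂ + δ - ℓ) • Rminus q i o (δ + ℓ) (δ - ℓ) (-(u₂ - 1))] := by
    rw [lax_eq_laxPM]
    refine Matrix.ext fun a b => ?_
    rw [Matrix.mul_apply, Matrix.mul_apply, Fin.sum_univ_two, Fin.sum_univ_two,
      Matrix.scalar_apply, Matrix.diagonal_mul, Matrix.diagonal_mul]
    revert a b
    simp only [Fin.forall_fin_two, gaugeG, Matrix.of_apply, Matrix.cons_val', Matrix.cons_val_zero,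
      Matrix.cons_val_one, Matrix.cons_val_fin_one, mul_one, mul_zero, one_mul, zero_mul, add_zero,
      zero_add]
    simp only [mul_assoc, hz, ← mul_add]
    refine ⟨⟨e1, rfl⟩, e0 ▸ ?_, ?_⟩
    · rw [laxPM_one_zero, laxPM_one_one, show u₂ + δ + ℓ - (u₂ + δ - ℓ) = δ + ℓ - (δ - ℓ) by ring]
    · rw [← e2, laxPM_one_one]
      abel
  refine ⟨perm i o * (Rplus q i o (δ + ℓ) (1 - u₁) (δ - ℓ) * (R * sMinus q i)), ?_⟩
  have hp : Rplus q i o (δ + ℓ) (1 - u₁) (δ - ℓ) * mulZ i =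
      mulZ i * Rplus q i o (δ + ℓ) (1 - u₁) (δ - ℓ) := by
    rw [Rplus_eq_Rminus]
    exact LinearAway.Rminus q i _ _ _ i hio
  rw [siteR, map_mul, map_mul, mul_assoc, mul_assoc, mul_assoc, ← mul_assoc _ _ (gaugeG o), ← hR,
    key, ← mul_assoc _ (gaugeG i), scalar_mul_gaugeG hp, mul_assoc, ← mul_assoc _ (gaugeG i),
    scalar_mul_gaugeG (perm_mul_mulZ i o), mul_assoc]
  congr 1
  refine Matrix.ext fun a b => ?_
  rw [Matrix.scalar_apply, Matrix.diagonal_mul, Matrix.scalar_apply, Matrix.diagonal_mul]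
  revert a b
  simp [Fin.forall_fin_two, siteR]

/-- After a gauge transformation the product of the Lax matrix at `u₁` with `ℝ_{i o}(u₁ | u₂)` is
triangular. -/
theorem lax_mul_siteR (hq0 : q ≠ 0) (hq : ∀ n : ℕ, 0 < n → q ^ n ≠ 1) (hio : i ≠ o)
    {ℓ δ u₁ : ℂ} (u₂ : ℂ) (h2 : NoPole q (1 - u₁) (δ - ℓ)) (h2' : NoPole q (1 - (u₁ + 1)) (δ - ℓ)) :
    ∃ B, lax q ℓ i (u₁ + δ) * Matrix.scalar (Fin 2) (siteR q i o ℓ δ u₁ u₂) * gaugeG o =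
      gaugeG o * !![(qNum q (u₁ - 1 + δ + ℓ) * qNum q (u₁ + δ - ℓ) / qNum q (u₁ - 1 + δ - ℓ)) •
          siteR q i o ℓ δ (u₁ - 1) u₂, B;
        0, qNum q (u₁ + δ - ℓ) • siteR q i o ℓ δ (u₁ + 1) u₂] := by
  set R := Rminus q o i (-(δ - ℓ)) (-(1 - u₁)) (-(δ + ℓ)) with hR
  have hC : NoPole q (-(δ - ℓ)) (-(1 - u₁)) := fun n => by
    rw [show 2 * -(δ - ℓ) - 2 * -(1 - u₁) + 2 * (n : ℂ) = 2 * (1 - u₁) - 2 * (δ - ℓ) + 2 * n by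
      ring]
    exact h2 n
  have hC' : NoPole q (-(δ - ℓ)) (-(1 - u₁) + 1) := fun n => by
    rw [show 2 * -(δ - ℓ) - 2 * (-(1 - u₁) + 1) + 2 * (n : ℂ) =
      2 * (1 - (u₁ + 1)) - 2 * (δ - ℓ) + 2 * n by ring]
    exact h2' n
  have e1 := Rminus_gauge_left_one (vm := -(δ + ℓ)) hq0 hq hio.symm hC
  have e2 := Rminus_gauge_left_two (vm := -(δ + ℓ)) hq0 hq hio.symm hC hC'
  have e0 := Rminus_gauge_left_zero (vm := -(δ + ℓ)) hq0 hq hio.symm hC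
  rw [e1] at e0
  rw [← hR] at e0 e1 e2
  rw [show -(1 - u₁) - 1 = -(1 - (u₁ - 1)) by ring] at e0 e1
  rw [show -(1 - u₁) + 1 = -(1 - (u₁ + 1)) by ring] at e2
  rw [show -(1 - u₁) - -(δ + ℓ) = u₁ - 1 + δ + ℓ by ring,
    show -(1 - u₁) - -(δ - ℓ) = u₁ - 1 + δ - ℓ by ring,
    show 1 + -(1 - u₁) - -(δ - ℓ) = u₁ + δ - ℓ by ring] at e0 e1
  rw [show 1 + -(1 - u₁) - -(δ + ℓ) = u₁ + δ + ℓ by ring] at e1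
  rw [show 1 + -(1 - u₁) - -(δ - ℓ) = u₁ + δ - ℓ by ring] at e2
  rw [← Rplus_eq_Rminus] at e0 e1 e2
  have key : laxPM q o (u₁ + δ + ℓ) (u₁ + δ - ℓ) * Matrix.scalar (Fin 2) R * gaugeG o = gaugeG i *
      !![(qNum q (u₁ - 1 + δ + ℓ) * qNum q (u₁ + δ - ℓ) / qNum q (u₁ - 1 + δ - ℓ)) •
          Rplus q i o (δ + ℓ) (1 - (u₁ - 1)) (δ - ℓ), sMinus q o * R;
        0, qNum q (u₁ + δ - ℓ) • Rplus q i o (δ + ℓ) (1 - (u₁ + 1)) (δ - ℓ)] := by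
    refine Matrix.ext fun a b => ?_
    rw [Matrix.mul_apply, Matrix.mul_apply, Fin.sum_univ_two, Fin.sum_univ_two,
      Matrix.scalar_apply, Matrix.mul_diagonal, Matrix.mul_diagonal]
    revert a b
    simp only [Fin.forall_fin_two, gaugeG, Matrix.of_apply, Matrix.cons_val', Matrix.cons_val_zero,
      Matrix.cons_val_one, Matrix.cons_val_fin_one, mul_one, mul_zero, one_mul, zero_mul, add_zero,
      zero_add]
    refine ⟨⟨?_, rfl⟩, ?_, ?_⟩
    · rw [← e1, mul_assoc]; rfl
    · rw [← e0, laxPM_one_zero, laxPM_one_one, mul_assoc _ R,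
        show u₁ + δ + ℓ - (u₁ + δ - ℓ) = -(δ - ℓ) - -(δ + ℓ) by ring]
    · rw [← e2, laxPM_one_one]
      abel
  refine ⟨perm i o * (sMinus q o * R * Rminus q i o (δ + ℓ) (δ - ℓ) (-u₂)), ?_⟩
  have hm : Rminus q i o (δ + ℓ) (δ - ℓ) (-u₂) * mulZ o =
      mulZ o * Rminus q i o (δ + ℓ) (δ - ℓ) (-u₂) := LinearAway.Rminus q o _ _ _ o hio.symm
  have hL : laxPM q i (u₁ + δ + ℓ) (u₁ + δ - ℓ) * Matrix.scalar (Fin 2) (perm i o) =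
      Matrix.scalar (Fin 2) (perm i o) * laxPM q o (u₁ + δ + ℓ) (u₁ + δ - ℓ) := by
    refine Matrix.ext fun a b => ?_
    rw [Matrix.scalar_apply, Matrix.diagonal_mul, Matrix.mul_diagonal,
      show perm i o = perm o i by rw [perm, perm, Equiv.swap_comm], perm_mul_laxPM]
  rw [lax_eq_laxPM, siteR, map_mul, map_mul, ← mul_assoc, ← mul_assoc, hL, mul_assoc _ _ (gaugeG o),
    scalar_mul_gaugeG hm, ← mul_assoc, Rplus_eq_Rminus, ← hR, mul_assoc (Matrix.scalar _ _),
    mul_assoc (Matrix.scalar _ _), key, ← mul_assoc,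
    scalar_mul_gaugeG (perm_mul_mulZ i o), mul_assoc, mul_assoc]
  congr 1
  refine Matrix.ext fun a b => ?_
  rw [Matrix.scalar_apply, Matrix.diagonal_mul, Matrix.scalar_apply, Matrix.mul_diagonal]
  revert a b
  simp [Fin.forall_fin_two, siteR]

lemma localOn_siteR {S : Set σ} (hi : i ∈ S) (ho : o ∈ S) (hio : i ≠ o) (ℓ δ u₁ u₂ : ℂ) :
    LocalOn S (siteR q i o ℓ δ u₁ u₂) := by
  rw [siteR, Rplus_eq_Rminus]
  exact (LocalOn.perm hi ho).mul ((localOn_Rminus ho hi hio.symm _ _ _).mul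
    (localOn_Rminus hi ho hio _ _ _))

end SiteOperator

/-! ### Products over the chain -/

section ListProducts

variable {ι M : Type*}

/-- Factors belonging to different indices commute, so that the products can be separated. -/
lemma prod_map_mul_of_commute [Monoid M] (f g : ι → M) (l : List ι) (hl : l.Nodup)
    (h : ∀ a b, a ≠ b → Commute (f a) (g b)) :
    (l.map fun a => f a * g a).prod = (l.map f).prod * (l.map g).prod := by
  induction l with
  | nil => simp
  | cons a l ih =>
    rw [List.nodup_cons] at hl
    have hc : Commute (l.map f).prod (g a) :=
      Commute.list_prod_left _ _ fun x hx => by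
        obtain ⟨b, hb, rfl⟩ := List.mem_map.mp hx
        exact h b a fun hba => hl.1 (hba ▸ hb)
    simp only [List.map_cons, List.prod_cons, ih hl.2]
    rw [mul_assoc, ← mul_assoc (g a), ← hc.eq]
    simp only [mul_assoc]

lemma prod_map_semiconj [Monoid M] (f g : ι → M) (G : M) (l : List ι)
    (h : ∀ a ∈ l, f a * G = G * g a) : (l.map f).prod * G = G * (l.map g).prod := by
  induction l with
  | nil => simp
  | cons a l ih =>
    simp only [List.map_cons, List.prod_cons]
    rw [mul_assoc, ih fun b hb => h b (List.mem_cons_of_mem _ hb), ← mul_assoc,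
      h a List.mem_cons_self, mul_assoc]

lemma prod_map_smul [Ring M] [Algebra ℂ M] (c : ι → ℂ) (f : ι → M) (l : List ι) :
    (l.map fun a => c a • f a).prod = (l.map c).prod • (l.map f).prod := by
  induction l with
  | nil => simp
  | cons a l ih => simp only [List.map_cons, List.prod_cons, ih, smul_mul_smul_comm]

lemma prod_map_triangular [Ring M] (x b y : ι → M) (l : List ι) :
    ∃ B, (l.map fun a => !![x a, b a; 0, y a]).prod =
      !![(l.map x).prod, B; 0, (l.map y).prod] := by
  induction l with
  | nil => exact ⟨0, by simp [Matrix.one_fin_two]⟩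
  | cons a l ih =>
    obtain ⟨B, hB⟩ := ih
    refine ⟨x a * B + b a * (l.map y).prod, ?_⟩
    simp only [List.map_cons, List.prod_cons, hB]
    rw [Matrix.mul_fin_two]
    simp

lemma prod_map_scalar [Ring M] (f : ι → M) (l : List ι) :
    (l.map fun a => Matrix.scalar (Fin 2) (f a)).prod =
      Matrix.scalar (Fin 2) (l.map f).prod := by
  rw [map_list_prod, List.map_map]; rfl

end ListProducts

variable {N : ℕ}

/-- The monodromy operator `ℝ_{10} ⋯ ℝ_{N0}` in terms of the parameters `u₁` and `u₂`. -/
def chainR (q : ℂ) (ℓ δ : Fin N → ℂ) (u₁ u₂ : ℂ) : Op (Option (Fin N)) :=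
  (List.ofFn fun k => siteR q (some k) none (ℓ k) (δ k) u₁ u₂).prod

lemma monodromy_eq_chainR (q : ℂ) (ℓ δ : Fin N → ℂ) (u₁ u₂ : ℂ) :
    monodromy q ℓ δ ((u₁ + u₂ - 1) / 2) ((1 + u₂ - u₁) / 2) = chainR q ℓ δ u₁ u₂ := by
  simp only [monodromy, chainR, Rop_eq_siteR]

/-- The product `L_1(v + δ_1) ⋯ L_N(v + δ_N)` acting in the variables `z_{e k}`. -/
def chainLax {σ : Type} (e : Fin N → σ) (q : ℂ) (ℓ δ : Fin N → ℂ) (v : ℂ) :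
    Matrix (Fin 2) (Fin 2) (Op σ) :=
  (List.ofFn fun k => lax q (ℓ k) (e k) (v + δ k)).prod

lemma transfer_eq (q : ℂ) (ℓ δ : Fin N → ℂ) (v : ℂ) :
    transfer q ℓ δ v = chainLax id q ℓ δ v 0 0 + chainLax id q ℓ δ v 1 1 := by
  rw [transfer, Matrix.trace_fin_two]; rfl

lemma noPole_site {q : ℂ} {ℓ : Fin N → ℂ} (hℓ : ∀ (k : Fin N) (j : ℕ), q ^ (4 * ℓ k + 2 * j) ≠ 1)
    (δ : Fin N → ℂ) (k : Fin N) : NoPole q (δ k + ℓ k) (δ k - ℓ k) := fun j => by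
  rw [show 2 * (δ k + ℓ k) - 2 * (δ k - ℓ k) + 2 * (j : ℂ) = 4 * ℓ k + 2 * j by ring]
  exact hℓ k j

lemma Regular.noPole {q : ℂ} {ℓ δ : Fin N → ℂ} {u₁ : ℂ} (h : Regular q ℓ δ u₁) (k : Fin N) :
    NoPole q (1 - u₁) (δ k - ℓ k) := fun j => by
  rw [show 2 * (1 - u₁) - 2 * (δ k - ℓ k) + 2 * (j : ℂ) =
    2 + 2 * ℓ k - 2 * u₁ - 2 * δ k + 2 * j by ring]
  exact h k j

/-- Operators of different sites share at most the auxiliary variable, on which the Lax matrix does not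
act. -/
lemma commute_siteR_lax (q : ℂ) (ℓ δ : Fin N → ℂ) (u₁ u₂ v : ℂ) {k l : Fin N} (hkl : k ≠ l) :
    Commute (Matrix.scalar (Fin 2) (siteR q (some k) none (ℓ k) (δ k) u₁ u₂))
      (lax q (ℓ l) (some l) v) := by
  have hR : LocalOn ({some k, none} : Set (Option (Fin N)))
      (siteR q (some k) none (ℓ k) (δ k) u₁ u₂) := by
    apply localOn_siteR <;> simp
  have hd : Disjoint ({some k, none} : Set (Option (Fin N))) {some l} := by
    simp [hkl.symm]
  refine Matrix.ext fun a b => ?_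
  rw [Matrix.scalar_apply, Matrix.diagonal_mul, Matrix.mul_diagonal, lax_eq_laxPM]
  exact hR.commute (localOn_laxPM (Set.mem_singleton _) _ _ _ a b) hd

variable {q : ℂ} {ℓ δ : Fin N → ℂ}

lemma chainR_mul_chainLax (u₁ u₂ v : ℂ) :
    Matrix.scalar (Fin 2) (chainR q ℓ δ u₁ u₂) * chainLax some q ℓ δ v =
      ((List.finRange N).map fun k =>
        Matrix.scalar (Fin 2) (siteR q (some k) none (ℓ k) (δ k) u₁ u₂) *
          lax q (ℓ k) (some k) (v + δ k)).prod := by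
  rw [prod_map_mul_of_commute _ _ _ (List.nodup_finRange N) fun a b hab =>
    commute_siteR_lax q ℓ δ u₁ u₂ _ hab, prod_map_scalar, chainR, chainLax, List.ofFn_eq_map,
    List.ofFn_eq_map]

lemma chainLax_mul_chainR (u₁ u₂ v : ℂ) :
    chainLax some q ℓ δ v * Matrix.scalar (Fin 2) (chainR q ℓ δ u₁ u₂) =
      ((List.finRange N).map fun k => lax q (ℓ k) (some k) (v + δ k) *
        Matrix.scalar (Fin 2) (siteR q (some k) none (ℓ k) (δ k) u₁ u₂)).prod := by
  rw [prod_map_mul_of_commute _ _ _ (List.nodup_finRange N) fun a b hab =>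
    (commute_siteR_lax q ℓ δ u₁ u₂ _ hab.symm).symm, prod_map_scalar, chainR, chainLax,
    List.ofFn_eq_map, List.ofFn_eq_map]

/-- The intertwining relation for the whole chain. -/
theorem chainR_intertwines (hq0 : q ≠ 0) (hq : ∀ n : ℕ, 0 < n → q ^ n ≠ 1)
    (hℓ : ∀ (k : Fin N) (j : ℕ), q ^ (4 * ℓ k + 2 * j) ≠ 1) {u₁ : ℂ} (u₂ v : ℂ)
    (h1 : Regular q ℓ δ u₁) :
    Matrix.scalar (Fin 2) (chainR q ℓ δ u₁ u₂) * chainLax some q ℓ δ v *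
        laxPM q none (1 - u₁ + v) (-u₂ + v) =
      laxPM q none (1 - u₁ + v) (-u₂ + v) *
        (chainLax some q ℓ δ v * Matrix.scalar (Fin 2) (chainR q ℓ δ u₁ u₂)) := by
  rw [chainR_mul_chainLax, chainLax_mul_chainR]
  refine prod_map_semiconj _ _ _ _ fun k _ => ?_
  rw [mul_assoc, siteR_intertwines hq0 hq (by simp) _ _ (noPole_site hℓ δ k) (h1.noPole k),
    mul_assoc]

lemma prod_finRange (f : Fin N → ℂ) : ((List.finRange N).map f).prod = ∏ k, f k := by
  rw [← List.ofFn_eq_map, List.prod_ofFn]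

/-- After a gauge transformation in the auxiliary variable, the product of `ℝ_{10} ⋯ ℝ_{N0}` with the
chain of Lax matrices at `u₂` is triangular. The same gauge matrix serves all sites. -/
theorem chainR_mul_chainLax_mul_gaugeG (hq0 : q ≠ 0) (hq : ∀ n : ℕ, 0 < n → q ^ n ≠ 1)
    (hℓ : ∀ (k : Fin N) (j : ℕ), q ^ (4 * ℓ k + 2 * j) ≠ 1) (u₁ u₂ : ℂ) :
    ∃ B, Matrix.scalar (Fin 2) (chainR q ℓ δ u₁ u₂) * chainLax some q ℓ δ u₂ * gaugeG none =
      gaugeG none * !![deltaPlus q ℓ δ u₂ • chainR q ℓ δ u₁ (u₂ + 1), B;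
        0, deltaMinus q ℓ δ u₂ • chainR q ℓ δ u₁ (u₂ - 1)] := by
  choose b hb using fun k => siteR_mul_lax (i := some k) (o := none) hq0 hq (by simp) u₁ u₂
    (noPole_site hℓ δ k)
  obtain ⟨B, hB⟩ := prod_map_triangular
    (fun k => qNum q (u₂ + δ k + ℓ k) • siteR q (some k) none (ℓ k) (δ k) u₁ (u₂ + 1)) b
    (fun k => qNum q (u₂ + δ k - ℓ k) • siteR q (some k) none (ℓ k) (δ k) u₁ (u₂ - 1))
    (List.finRange N)
  refine ⟨B, ?_⟩
  rw [chainR_mul_chainLax, prod_map_semiconj _ _ _ _ fun k _ => hb k, hB,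
    prod_map_smul (fun k => qNum q (u₂ + δ k + ℓ k)) (fun k =>
      siteR q (some k) none (ℓ k) (δ k) u₁ (u₂ + 1)),
    prod_map_smul (fun k => qNum q (u₂ + δ k - ℓ k)) (fun k =>
      siteR q (some k) none (ℓ k) (δ k) u₁ (u₂ - 1)), prod_finRange, prod_finRange]
  simp only [chainR, List.ofFn_eq_map, deltaPlus, deltaMinus]

/-- After a gauge transformation in the auxiliary variable, the product of the chain of Lax matrices
at `u₁` with `ℝ_{10} ⋯ ℝ_{N0}` is triangular. -/
theorem chainLax_mul_chainR_mul_gaugeG (hq0 : q ≠ 0) (hq : ∀ n : ℕ, 0 < n → q ^ n ≠ 1)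
    {u₁ : ℂ} (u₂ : ℂ) (h1 : Regular q ℓ δ u₁) (h1' : Regular q ℓ δ (u₁ + 1)) :
    ∃ B, chainLax some q ℓ δ u₁ * Matrix.scalar (Fin 2) (chainR q ℓ δ u₁ u₂) * gaugeG none =
      gaugeG none * !![(deltaPlus q ℓ δ (u₁ - 1) * deltaMinus q ℓ δ u₁ /
          deltaMinus q ℓ δ (u₁ - 1)) • chainR q ℓ δ (u₁ - 1) u₂, B;
        0, deltaMinus q ℓ δ u₁ • chainR q ℓ δ (u₁ + 1) u₂] := by
  choose b hb using fun k => lax_mul_siteR (i := some k) (o := none) hq0 hq (by simp) u₂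
    (h1.noPole k) (h1'.noPole k)
  obtain ⟨B, hB⟩ := prod_map_triangular
    (fun k => (qNum q (u₁ - 1 + δ k + ℓ k) * qNum q (u₁ + δ k - ℓ k) /
      qNum q (u₁ - 1 + δ k - ℓ k)) • siteR q (some k) none (ℓ k) (δ k) (u₁ - 1) u₂) b
    (fun k => qNum q (u₁ + δ k - ℓ k) • siteR q (some k) none (ℓ k) (δ k) (u₁ + 1) u₂)
    (List.finRange N)
  refine ⟨B, ?_⟩
  rw [chainLax_mul_chainR, prod_map_semiconj _ _ _ _ fun k _ => hb k, hB,
    prod_map_smul (fun k => qNum q (u₁ - 1 + δ k + ℓ k) * qNum q (u₁ + δ k - ℓ k) /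
      qNum q (u₁ - 1 + δ k - ℓ k)) (fun k =>
      siteR q (some k) none (ℓ k) (δ k) (u₁ - 1) u₂),
    prod_map_smul (fun k => qNum q (u₁ + δ k - ℓ k)) (fun k =>
      siteR q (some k) none (ℓ k) (δ k) (u₁ + 1) u₂), prod_finRange, prod_finRange]
  simp only [chainR, List.ofFn_eq_map, deltaPlus, deltaMinus, Finset.prod_div_distrib,
    Finset.prod_mul_distrib]

/-! ### Matrix elements with respect to the auxiliary variable -/

section Aux

open MvPolynomial

variable {N : ℕ}

lemma lin_ext {σ : Type} {M : Type*} [AddCommMonoid M] [Module ℂ M]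
    {A B : MvPolynomial σ ℂ →ₗ[ℂ] M} (h : ∀ s, A (monomial s 1) = B (monomial s 1)) : A = B :=
  (basisMonomials σ ℂ).ext fun s => by simpa using h s

/-- The map `Ψ ↦ z₀^m Ψ`. -/
def auxIn (m : ℕ) : MvPolynomial (Fin N) ℂ →ₗ[ℂ] MvPolynomial (Option (Fin N)) ℂ :=
  LinearMap.mulLeft ℂ (X none ^ m) ∘ₗ (rename some).toLinearMap

/-- The coefficient of `z₀^n`. -/
def auxOut (n : ℕ) : MvPolynomial (Option (Fin N)) ℂ →ₗ[ℂ] MvPolynomial (Fin N) ℂ where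
  toFun f := (optionEquivLeft ℂ (Fin N) f).coeff n
  map_add' f g := by simp
  map_smul' c f := by simp

/-- The matrix element of `A` between `z₀^m` and `z₀^n`. -/
def auxCoeff (A : Op (Option (Fin N))) (m n : ℕ) : Op (Fin N) := auxOut n ∘ₗ A ∘ₗ auxIn m

lemma auxCoeff_apply (A : Op (Option (Fin N))) (m n : ℕ) (Ψ : MvPolynomial (Fin N) ℂ) :
    auxCoeff A m n Ψ = auxOut n (A (auxIn m Ψ)) := rfl

lemma auxOut_apply (n : ℕ) (f : MvPolynomial (Option (Fin N)) ℂ) :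
    auxOut n f = (optionEquivLeft ℂ (Fin N) f).coeff n := rfl

lemma auxIn_monomial (m : ℕ) (s : Fin N →₀ ℕ) (c : ℂ) :
    auxIn m (monomial s c) = monomial (s.optionElim m) c := by
  simp only [auxIn, LinearMap.comp_apply, LinearMap.mulLeft_apply, AlgHom.toLinearMap_apply,
    rename_monomial, X_pow_eq_monomial, monomial_mul, one_mul]
  refine congrArg (fun t => monomial t c) (Finsupp.ext fun a => ?_)
  cases a with
  | none => simp [Finsupp.mapDomain_of_notMem_range]
  | some a => simp [Finsupp.mapDomain_apply (Option.some_injective _)]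

lemma auxOut_monomial (n : ℕ) (s : Option (Fin N) →₀ ℕ) (c : ℂ) :
    auxOut n (monomial s c) = if s none = n then monomial s.some c else 0 := by
  rw [auxOut_apply, optionEquivLeft_monomial, Polynomial.coeff_monomial]

lemma coeff_auxOut (n : ℕ) (s : Fin N →₀ ℕ) (f : MvPolynomial (Option (Fin N)) ℂ) :
    (auxOut n f).coeff s = f.coeff (s.optionElim n) :=
  optionEquivLeft_coeff_coeff _ f n s

lemma auxOut_auxIn (m n : ℕ) (Ψ : MvPolynomial (Fin N) ℂ) :
    auxOut n (auxIn m Ψ) = if m = n then Ψ else 0 := by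
  refine MvPolynomial.ext _ _ fun s => ?_
  induction Ψ using MvPolynomial.induction_on' with
  | monomial t c =>
    rw [auxIn_monomial, auxOut_monomial, Finsupp.optionElim_apply_none, Finsupp.some_optionElim]
  | add a b ha hb =>
    rw [map_add, map_add, coeff_add, ha, hb]
    split_ifs <;> simp

lemma monomial_eq_auxIn (s : Option (Fin N) →₀ ℕ) :
    (monomial s (1 : ℂ)) = auxIn (s none) (monomial s.some 1) := by
  rw [auxIn_monomial, Finsupp.optionElim_some]

lemma mulZ_none_auxIn (m : ℕ) (Ψ : MvPolynomial (Fin N) ℂ) :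
    mulZ none (auxIn m Ψ) = auxIn (m + 1) Ψ := by
  simp only [mulZ_apply, auxIn, LinearMap.comp_apply, LinearMap.mulLeft_apply, pow_succ', mul_assoc]

lemma eulerFun_none_auxIn (f : ℕ → ℂ) (m : ℕ) (Ψ : MvPolynomial (Fin N) ℂ) :
    eulerFun none f (auxIn m Ψ) = f m • auxIn m Ψ := by
  refine LinearMap.congr_fun (f := eulerFun none f ∘ₗ auxIn m) (g := f m • auxIn m)
    (lin_ext fun s => ?_) Ψ
  rw [LinearMap.comp_apply, LinearMap.smul_apply, auxIn_monomial, eulerFun_monomial, smul_monomial,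
    Finsupp.optionElim_apply_none, smul_eq_mul]

lemma divZ_none_auxIn_succ (m : ℕ) (Ψ : MvPolynomial (Fin N) ℂ) :
    divZ none (auxIn (m + 1) Ψ) = auxIn m Ψ := by
  refine LinearMap.congr_fun (f := divZ none ∘ₗ auxIn (m + 1)) (g := auxIn m)
    (lin_ext fun s => ?_) Ψ
  rw [LinearMap.comp_apply, auxIn_monomial, auxIn_monomial, divZ, onMonomials_monomial,
    Finsupp.optionElim_apply_none, if_neg m.succ_ne_zero]
  refine congrArg (fun t => monomial t 1) (Finsupp.ext fun a => ?_)
  cases a <;> simp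

lemma auxOut_succ_mulZ_none (n : ℕ) (f : MvPolynomial (Option (Fin N)) ℂ) :
    auxOut (n + 1) (mulZ none f) = auxOut n f := by
  rw [auxOut_apply, auxOut_apply, mulZ_apply, map_mul, optionEquivLeft_X_none, Polynomial.coeff_X_mul]

lemma auxOut_zero_mulZ_none (f : MvPolynomial (Option (Fin N)) ℂ) : auxOut 0 (mulZ none f) = 0 := by
  rw [auxOut_apply, mulZ_apply, map_mul, optionEquivLeft_X_none, Polynomial.coeff_X_mul_zero]

lemma auxOut_eulerFun_none (f : ℕ → ℂ) (n : ℕ) (g : MvPolynomial (Option (Fin N)) ℂ) :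
    auxOut n (eulerFun none f g) = f n • auxOut n g := by
  refine MvPolynomial.ext _ _ fun s => ?_
  rw [coeff_auxOut, coeff_eulerFun, coeff_smul, coeff_auxOut, Finsupp.optionElim_apply_none,
    smul_eq_mul]

lemma sMinus_none_auxIn (q : ℂ) (m : ℕ) (Ψ : MvPolynomial (Fin N) ℂ) :
    sMinus q none (auxIn (m + 1) Ψ) = (-qNum q ((m + 1 : ℕ) : ℂ)) • auxIn m Ψ := by
  rw [sMinus, LinearMap.neg_apply, Module.End.mul_apply, eulerFun_none_auxIn, map_smul,
    divZ_none_auxIn_succ, neg_smul]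

lemma qNum_zero (q : ℂ) : qNum q 0 = 0 := by simp [qNum]

lemma sMinus_none_auxIn_zero (q : ℂ) (Ψ : MvPolynomial (Fin N) ℂ) :
    sMinus q none (auxIn 0 Ψ) = 0 := by
  rw [sMinus, LinearMap.neg_apply, Module.End.mul_apply, eulerFun_none_auxIn, Nat.cast_zero,
    qNum_zero, zero_smul, map_zero, neg_zero]

lemma auxOut_sMinus_none (q : ℂ) (n : ℕ) (f : MvPolynomial (Option (Fin N)) ℂ) :
    auxOut n (sMinus q none f) = (-qNum q ((n + 1 : ℕ) : ℂ)) • auxOut (n + 1) f := by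
  refine LinearMap.congr_fun (f := auxOut n ∘ₗ sMinus q none)
    (g := (-qNum q ((n + 1 : ℕ) : ℂ)) • auxOut (n + 1)) (lin_ext fun s => ?_) f
  rw [LinearMap.comp_apply, LinearMap.smul_apply, monomial_eq_auxIn]
  cases s none with
  | zero => rw [sMinus_none_auxIn_zero, map_zero, auxOut_auxIn, if_neg n.succ_ne_zero.symm, smul_zero]
  | succ m =>
    rw [sMinus_none_auxIn, map_smul, auxOut_auxIn, auxOut_auxIn]
    by_cases h : m = n
    · rw [h, if_pos rfl, if_pos rfl]
    · rw [if_neg h, if_neg (by omega), smul_zero, smul_zero]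

/-! ### Operators in the quantum space -/

/-- `B` acts on `ℂ[z₀, z_1, …]` as the operator `A` on the quantum space. -/
def LiftsTo (A : Op (Fin N)) (B : Op (Option (Fin N))) : Prop :=
  ∀ m Ψ, B (auxIn m Ψ) = auxIn m (A Ψ)

namespace LiftsTo

variable {A A' : Op (Fin N)} {B B' : Op (Option (Fin N))}

lemma one : LiftsTo (1 : Op (Fin N)) 1 := fun _ _ => rfl

lemma zero : LiftsTo (0 : Op (Fin N)) 0 := fun m _ => (map_zero (auxIn m)).symm

lemma mul (h : LiftsTo A B) (h' : LiftsTo A' B') : LiftsTo (A * A') (B * B') := fun m Ψ => by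
  rw [Module.End.mul_apply, h', h, Module.End.mul_apply]

lemma add (h : LiftsTo A B) (h' : LiftsTo A' B') : LiftsTo (A + A') (B + B') := fun m Ψ => by
  rw [LinearMap.add_apply, h', h, LinearMap.add_apply, map_add]

lemma neg (h : LiftsTo A B) : LiftsTo (-A) (-B) := fun m Ψ => by
  rw [LinearMap.neg_apply, h, LinearMap.neg_apply, map_neg]

lemma of_monomial (h : ∀ m s, B (monomial (s.optionElim m) 1) = auxIn m (A (monomial s 1))) :
    LiftsTo A B := fun m Ψ => by
  refine LinearMap.congr_fun (f := B ∘ₗ auxIn m) (g := auxIn m ∘ₗ A) (lin_ext fun s => ?_) Ψ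
  rw [LinearMap.comp_apply, LinearMap.comp_apply, auxIn_monomial, h]

lemma auxOut_apply (h : LiftsTo A B) (n : ℕ) (f : MvPolynomial (Option (Fin N)) ℂ) :
    auxOut n (B f) = A (auxOut n f) := by
  refine LinearMap.congr_fun (f := auxOut n ∘ₗ B) (g := A ∘ₗ auxOut n) (lin_ext fun s => ?_) f
  rw [LinearMap.comp_apply, LinearMap.comp_apply, monomial_eq_auxIn, h, auxOut_auxIn, auxOut_auxIn]
  split_ifs <;> simp

lemma auxCoeff_mul (h : LiftsTo A B) (C : Op (Option (Fin N))) (m n : ℕ) :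
    auxCoeff (C * B) m n = auxCoeff C m n * A := by
  refine LinearMap.ext fun Ψ => ?_
  rw [Module.End.mul_apply, auxCoeff_apply, auxCoeff_apply, Module.End.mul_apply, h]

lemma mul_auxCoeff (h : LiftsTo A B) (C : Op (Option (Fin N))) (m n : ℕ) :
    auxCoeff (B * C) m n = A * auxCoeff C m n := by
  refine LinearMap.ext fun Ψ => ?_
  rw [Module.End.mul_apply, auxCoeff_apply, auxCoeff_apply, Module.End.mul_apply, h.auxOut_apply]

lemma eulerFun (k : Fin N) (f : ℕ → ℂ) : LiftsTo (eulerFun k f) (eulerFun (some k) f) :=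
  of_monomial fun m s => by
    rw [eulerFun_monomial, eulerFun_monomial, auxIn_monomial, Finsupp.optionElim_apply_some]

lemma mulZ (k : Fin N) : LiftsTo (mulZ k) (mulZ (some k)) := fun m Ψ => by
  simp only [mulZ_apply, auxIn, LinearMap.comp_apply, LinearMap.mulLeft_apply,
    AlgHom.toLinearMap_apply, map_mul, rename_X]
  ring

lemma divZ (k : Fin N) : LiftsTo (divZ k) (divZ (some k)) :=
  of_monomial fun m s => by
    rw [XXZ.divZ, XXZ.divZ, onMonomials_monomial, onMonomials_monomial,
      Finsupp.optionElim_apply_some]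
    split_ifs with h
    · rw [map_zero]
    · rw [auxIn_monomial]
      refine congrArg (fun t => monomial t 1) (Finsupp.ext fun a => ?_)
      cases a <;> simp [Finsupp.single_apply]

lemma sMinus (q : ℂ) (k : Fin N) : LiftsTo (sMinus q k) (sMinus q (some k)) :=
  ((divZ k).mul (eulerFun k _)).neg

lemma lax (q ℓ : ℂ) (k : Fin N) (u : ℂ) (a b : Fin 2) :
    LiftsTo (lax q ℓ k u a b) (lax q ℓ (some k) u a b) := by
  have h : ∀ a b, LiftsTo (XXZ.lax q ℓ k u a b) (XXZ.lax q ℓ (some k) u a b) := by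
    simp only [Fin.forall_fin_two, lax_eq_laxPM, laxPM_zero_zero, laxPM_zero_one, laxPM_one_zero,
      laxPM_one_one]
    exact ⟨⟨eulerFun _ _, sMinus q k⟩, (mulZ k).mul (eulerFun _ _), eulerFun _ _⟩
  exact h a b

lemma chainLax (q : ℂ) (ℓ δ : Fin N → ℂ) (v : ℂ) (a b : Fin 2) :
    LiftsTo (chainLax id q ℓ δ v a b) (chainLax some q ℓ δ v a b) := by
  rw [XXZ.chainLax, XXZ.chainLax, List.ofFn_eq_map, List.ofFn_eq_map]
  induction List.finRange N generalizing a b with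
  | nil =>
    simp only [List.map_nil, List.prod_nil, Matrix.one_apply]
    split_ifs
    exacts [one, zero]
  | cons k l ih =>
    simp only [List.map_cons, List.prod_cons, Matrix.mul_apply, Fin.sum_univ_two]
    exact ((lax q _ _ _ _ _).mul (ih _ _)).add ((lax q _ _ _ _ _).mul (ih _ _))

end LiftsTo

end Aux

/-! ### Partial traces of similar matrices -/

section TraceRelations

open MvPolynomial

variable {N : ℕ}

lemma auxCoeff_add (A B : Op (Option (Fin N))) (m n : ℕ) :
    auxCoeff (A + B) m n = auxCoeff A m n + auxCoeff B m n :=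
  LinearMap.ext fun Ψ => map_add (auxOut n) (A (auxIn m Ψ)) (B (auxIn m Ψ))

lemma auxCoeff_smul (c : ℂ) (A : Op (Option (Fin N))) (m n : ℕ) :
    auxCoeff (c • A) m n = c • auxCoeff A m n :=
  LinearMap.ext fun Ψ => map_smul (auxOut n) c (A (auxIn m Ψ))

lemma auxCoeff_mul_mulZ (A : Op (Option (Fin N))) (m n : ℕ) :
    auxCoeff (A * mulZ none) m n = auxCoeff A (m + 1) n := LinearMap.ext fun Ψ => by
  rw [auxCoeff_apply, auxCoeff_apply, Module.End.mul_apply, mulZ_none_auxIn]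

lemma auxCoeff_mul_eulerFun (A : Op (Option (Fin N))) (f : ℕ → ℂ) (m n : ℕ) :
    auxCoeff (A * eulerFun none f) m n = f m • auxCoeff A m n := LinearMap.ext fun Ψ => by
  rw [LinearMap.smul_apply, auxCoeff_apply, auxCoeff_apply, Module.End.mul_apply,
    eulerFun_none_auxIn, map_smul, map_smul]

lemma auxCoeff_mul_sMinus (A : Op (Option (Fin N))) (q : ℂ) (m n : ℕ) :
    auxCoeff (A * sMinus q none) (m + 1) n = (-qNum q ((m + 1 : ℕ) : ℂ)) • auxCoeff A m n :=
  LinearMap.ext fun Ψ => by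
    rw [LinearMap.smul_apply, auxCoeff_apply, auxCoeff_apply, Module.End.mul_apply,
      sMinus_none_auxIn, map_smul, map_smul]

lemma auxCoeff_mul_sMinus_zero (A : Op (Option (Fin N))) (q : ℂ) (n : ℕ) :
    auxCoeff (A * sMinus q none) 0 n = 0 := LinearMap.ext fun Ψ => by
  rw [auxCoeff_apply, Module.End.mul_apply, sMinus_none_auxIn_zero, map_zero, map_zero,
    LinearMap.zero_apply]

lemma auxCoeff_mulZ_mul (A : Op (Option (Fin N))) (m n : ℕ) :
    auxCoeff (mulZ none * A) m (n + 1) = auxCoeff A m n := LinearMap.ext fun Ψ => by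
  rw [auxCoeff_apply, auxCoeff_apply, Module.End.mul_apply, auxOut_succ_mulZ_none]

lemma auxCoeff_mulZ_mul_zero (A : Op (Option (Fin N))) (m : ℕ) :
    auxCoeff (mulZ none * A) m 0 = 0 := LinearMap.ext fun Ψ => by
  rw [auxCoeff_apply, Module.End.mul_apply, auxOut_zero_mulZ_none, LinearMap.zero_apply]

lemma auxCoeff_eulerFun_mul (A : Op (Option (Fin N))) (f : ℕ → ℂ) (m n : ℕ) :
    auxCoeff (eulerFun none f * A) m n = f n • auxCoeff A m n := LinearMap.ext fun Ψ => by
  rw [LinearMap.smul_apply, auxCoeff_apply, auxCoeff_apply, Module.End.mul_apply,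
    auxOut_eulerFun_none]

lemma auxCoeff_sMinus_mul (A : Op (Option (Fin N))) (q : ℂ) (m n : ℕ) :
    auxCoeff (sMinus q none * A) m n = (-qNum q ((n + 1 : ℕ) : ℂ)) • auxCoeff A m (n + 1) :=
  LinearMap.ext fun Ψ => by
    rw [LinearMap.smul_apply, auxCoeff_apply, auxCoeff_apply, Module.End.mul_apply,
      auxOut_sMinus_none]

/-- Matrices similar by the gauge matrix have the same partial trace, and already the terms with a
fixed `d` agree, provided that the degree in `z₀` is counted from `d` in the first component and
from `d + 1` in the second one. -/
lemma auxCoeff_gauge {X : Matrix (Fin 2) (Fin 2) (Op (Option (Fin N)))}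
    {y₀ y₁ B : Op (Option (Fin N))} (h : X * gaugeG none = gaugeG none * !![y₀, B; 0, y₁]) :
    (∀ d, auxCoeff (X 0 0) d d + auxCoeff (X 1 1) (d + 1) (d + 1) =
      auxCoeff y₀ d d + auxCoeff y₁ (d + 1) (d + 1)) ∧
    auxCoeff (X 1 1) 0 0 = auxCoeff y₁ 0 0 := by
  have e := fun a b => congrFun (congrFun h a) b
  simp only [Matrix.mul_apply, Fin.sum_univ_two, Fin.forall_fin_two, gaugeG, Matrix.of_apply,
    Matrix.cons_val', Matrix.cons_val_zero, Matrix.cons_val_one, Matrix.cons_val_fin_one, mul_one,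
    mul_zero, one_mul, zero_mul, add_zero, zero_add] at e
  obtain ⟨⟨e00, e01⟩, -, e11⟩ := e
  rw [e01] at e00
  constructor
  · intro d
    rw [← e00, e11, auxCoeff_add, auxCoeff_add, auxCoeff_mul_mulZ, auxCoeff_mulZ_mul, add_assoc]
  · rw [e11, auxCoeff_add, auxCoeff_mulZ_mul_zero, zero_add]

/-- The determinant of the block of the Lax matrix `laxPM q none x y` acting on the span of
`(z₀^d, 0)` and `(0, z₀^(d+1))`. It does not depend on `d`. -/
lemma qNum_det (q x y d : ℂ) (hq0 : q ≠ 0) :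
    qNum q (x + d) * qNum q (y - (d + 1)) + qNum q (d + 1) * qNum q (x - y + d) =
      qNum q (x - 1) * qNum q y := by
  simp only [qNum_eq, Complex.cpow_add _ _ hq0, Complex.cpow_sub _ _ hq0, Complex.cpow_one]
  have h1 := cpow_ne_zero' hq0 x
  have h2 := cpow_ne_zero' hq0 y
  have h3 := cpow_ne_zero' hq0 d
  generalize (q - q⁻¹)⁻¹ = κ, q ^ x = a, q ^ y = b, q ^ d = c at *
  field_simp
  ring

/-- Matrices similar by a Lax matrix in the auxiliary variable have the same partial trace, term
by term in the sense of `auxCoeff_gauge`. -/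
lemma auxCoeff_laxPM (q : ℂ) (hq0 : q ≠ 0) {vp vm : ℂ} (hp : qNum q (vp - 1) ≠ 0)
    (hm : qNum q vm ≠ 0) {X Y : Matrix (Fin 2) (Fin 2) (Op (Option (Fin N)))}
    (h : X * laxPM q none vp vm = laxPM q none vp vm * Y) :
    (∀ d, auxCoeff (X 0 0) d d + auxCoeff (X 1 1) (d + 1) (d + 1) =
      auxCoeff (Y 0 0) d d + auxCoeff (Y 1 1) (d + 1) (d + 1)) ∧
    auxCoeff (X 1 1) 0 0 = auxCoeff (Y 1 1) 0 0 := by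
  have e := fun a b => congrFun (congrFun h a) b
  simp only [Matrix.mul_apply, Fin.sum_univ_two, Fin.forall_fin_two, laxPM_zero_zero,
    laxPM_zero_one, laxPM_one_zero, laxPM_one_one] at e
  obtain ⟨⟨e00, e01⟩, e10, e11⟩ := e
  constructor
  · intro d
    have f00 := congrArg (fun A => auxCoeff A d d) e00
    have f01 := congrArg (fun A => auxCoeff A (d + 1) d) e01
    have f10 := congrArg (fun A => auxCoeff A d (d + 1)) e10
    have f11 := congrArg (fun A => auxCoeff A (d + 1) (d + 1)) e11
    simp only [auxCoeff_add, ← mul_assoc, auxCoeff_mul_eulerFun, auxCoeff_mul_mulZ,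
      auxCoeff_mul_sMinus] at f00 f01 f10 f11
    simp only [mul_assoc, auxCoeff_eulerFun_mul, auxCoeff_sMinus_mul, auxCoeff_mulZ_mul]
      at f00 f01 f10 f11
    have hdet := qNum_det q vp vm d hq0
    push_cast at f00 f01 f10 f11
    have key : (qNum q (vp - 1) * qNum q vm) •
        (auxCoeff (X 0 0) d d + auxCoeff (X 1 1) (d + 1) (d + 1)) =
        (qNum q (vp - 1) * qNum q vm) •
        (auxCoeff (Y 0 0) d d + auxCoeff (Y 1 1) (d + 1) (d + 1)) := by
      -- the trace of the relation multiplied by the adjugate of the scalar block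
      rw [← hdet]
      linear_combination (norm := module) qNum q (vm - (d + 1)) • f00 - qNum q (vp - vm + d) • f01 +
        qNum q (d + 1) • f10 + qNum q (vp + d) • f11
    exact smul_right_injective _ (mul_ne_zero hp hm) key
  · have f11 := congrArg (fun A => auxCoeff A 0 0) e11
    simp only [auxCoeff_add, auxCoeff_mul_eulerFun, auxCoeff_mul_sMinus_zero, mul_assoc,
      auxCoeff_eulerFun_mul, auxCoeff_mulZ_mul_zero, zero_add, Nat.cast_zero, sub_zero] at f11
    exact smul_right_injective _ hm f11

variable {q : ℂ} {ℓ δ : Fin N → ℂ}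

/-- The term of degree `d` in `z₀` of the partial trace of the monodromy operator. -/
def chainQ (q : ℂ) (ℓ δ : Fin N → ℂ) (u₁ u₂ : ℂ) (d : ℕ) : Op (Fin N) :=
  auxCoeff (chainR q ℓ δ u₁ u₂) d d

lemma auxCoeff_scalar_mul_chainLax (A : Op (Option (Fin N))) (v : ℂ) (a : Fin 2) (d : ℕ) :
    auxCoeff ((Matrix.scalar (Fin 2) A * chainLax some q ℓ δ v) a a) d d =
      auxCoeff A d d * chainLax id q ℓ δ v a a := by
  rw [Matrix.scalar_apply, Matrix.diagonal_mul, (LiftsTo.chainLax q ℓ δ v a a).auxCoeff_mul]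

lemma auxCoeff_chainLax_mul_scalar (A : Op (Option (Fin N))) (v : ℂ) (a : Fin 2) (d : ℕ) :
    auxCoeff ((chainLax some q ℓ δ v * Matrix.scalar (Fin 2) A) a a) d d =
      chainLax id q ℓ δ v a a * auxCoeff A d d := by
  rw [Matrix.scalar_apply, Matrix.mul_diagonal, (LiftsTo.chainLax q ℓ δ v a a).mul_auxCoeff]

/-- The Baxter relation in `u₂`, graded by the degree in `z₀`. -/
theorem chainQ_mul_chainLax_baxter (hq0 : q ≠ 0) (hq : ∀ n : ℕ, 0 < n → q ^ n ≠ 1)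
    (hℓ : ∀ (k : Fin N) (j : ℕ), q ^ (4 * ℓ k + 2 * j) ≠ 1) (u₁ u₂ : ℂ) :
    (∀ d, chainQ q ℓ δ u₁ u₂ d * chainLax id q ℓ δ u₂ 0 0 +
        chainQ q ℓ δ u₁ u₂ (d + 1) * chainLax id q ℓ δ u₂ 1 1 =
      deltaPlus q ℓ δ u₂ • chainQ q ℓ δ u₁ (u₂ + 1) d +
        deltaMinus q ℓ δ u₂ • chainQ q ℓ δ u₁ (u₂ - 1) (d + 1)) ∧
    chainQ q ℓ δ u₁ u₂ 0 * chainLax id q ℓ δ u₂ 1 1 =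
      deltaMinus q ℓ δ u₂ • chainQ q ℓ δ u₁ (u₂ - 1) 0 := by
  obtain ⟨B, hB⟩ := chainR_mul_chainLax_mul_gaugeG (δ := δ) hq0 hq hℓ u₁ u₂
  have := auxCoeff_gauge hB
  simp only [auxCoeff_scalar_mul_chainLax, auxCoeff_smul] at this
  exact this

/-- The Baxter relation in `u₁`, graded by the degree in `z₀`. -/
theorem chainLax_mul_chainQ_baxter (hq0 : q ≠ 0) (hq : ∀ n : ℕ, 0 < n → q ^ n ≠ 1)
    {u₁ : ℂ} (u₂ : ℂ) (h1 : Regular q ℓ δ u₁) (h1' : Regular q ℓ δ (u₁ + 1)) :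
    (∀ d, chainLax id q ℓ δ u₁ 0 0 * chainQ q ℓ δ u₁ u₂ d +
        chainLax id q ℓ δ u₁ 1 1 * chainQ q ℓ δ u₁ u₂ (d + 1) =
      (deltaPlus q ℓ δ (u₁ - 1) * deltaMinus q ℓ δ u₁ / deltaMinus q ℓ δ (u₁ - 1)) •
          chainQ q ℓ δ (u₁ - 1) u₂ d +
        deltaMinus q ℓ δ u₁ • chainQ q ℓ δ (u₁ + 1) u₂ (d + 1)) ∧
    chainLax id q ℓ δ u₁ 1 1 * chainQ q ℓ δ u₁ u₂ 0 =
      deltaMinus q ℓ δ u₁ • chainQ q ℓ δ (u₁ + 1) u₂ 0 := by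
  obtain ⟨B, hB⟩ := chainLax_mul_chainR_mul_gaugeG hq0 hq u₂ h1 h1'
  have := auxCoeff_gauge hB
  simp only [auxCoeff_chainLax_mul_scalar, auxCoeff_smul] at this
  exact this

/-- Commutativity with the transfer matrix, graded by the degree in `z₀`, at a generic value of the
spectral parameter. -/
lemma chainQ_mul_chainLax_of_ne_zero (hq0 : q ≠ 0) (hq : ∀ n : ℕ, 0 < n → q ^ n ≠ 1)
    (hℓ : ∀ (k : Fin N) (j : ℕ), q ^ (4 * ℓ k + 2 * j) ≠ 1) {u₁ u₂ v : ℂ}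
    (h1 : Regular q ℓ δ u₁) (hp : qNum q (v - u₁) ≠ 0) (hm : qNum q (v - u₂) ≠ 0) :
    (∀ d, chainQ q ℓ δ u₁ u₂ d * chainLax id q ℓ δ v 0 0 +
        chainQ q ℓ δ u₁ u₂ (d + 1) * chainLax id q ℓ δ v 1 1 =
      chainLax id q ℓ δ v 0 0 * chainQ q ℓ δ u₁ u₂ d +
        chainLax id q ℓ δ v 1 1 * chainQ q ℓ δ u₁ u₂ (d + 1)) ∧
    chainQ q ℓ δ u₁ u₂ 0 * chainLax id q ℓ δ v 1 1 =
      chainLax id q ℓ δ v 1 1 * chainQ q ℓ δ u₁ u₂ 0 := by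
  have := auxCoeff_laxPM q hq0 (vp := 1 - u₁ + v) (vm := -u₂ + v)
    (by rwa [show 1 - u₁ + v - 1 = v - u₁ by ring]) (by rwa [neg_add_eq_sub])
    (chainR_intertwines hq0 hq hℓ u₂ v h1)
  simp only [auxCoeff_scalar_mul_chainLax, auxCoeff_chainLax_mul_scalar] at this
  exact this

end TraceRelations

/-! ### Conservation of the total degree -/

section Degree

open MvPolynomial

variable {σ : Type}

/-- The total Euler operator `∑_i z_i ∂_i`. -/
def degOp (σ : Type) : Op σ := onMonomials fun s => monomial s (s.degree : ℂ)

lemma degOp_monomial (s : σ →₀ ℕ) (c : ℂ) :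
    degOp σ (monomial s c) = (s.degree : ℂ) • monomial s c := by
  rw [monomial_eq_smul, map_smul, degOp, onMonomials_monomial, smul_comm, smul_monomial,
    smul_monomial, smul_monomial, smul_eq_mul, smul_eq_mul, smul_eq_mul, mul_one]

lemma coeff_degOp (s : σ →₀ ℕ) (f : MvPolynomial σ ℂ) :
    coeff s (degOp σ f) = (s.degree : ℂ) * coeff s f := by
  classical
  induction f using MvPolynomial.induction_on' with
  | monomial t c =>
    rw [degOp_monomial, coeff_smul, smul_eq_mul, coeff_monomial]
    split_ifs with h
    · rw [h]
    · simp
  | add a b ha hb => rw [map_add, coeff_add, ha, hb, coeff_add, mul_add]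

lemma commute_degOp_of_monomial {A : Op σ}
    (h : ∀ s, degOp σ (A (monomial s 1)) = (s.degree : ℂ) • A (monomial s 1)) :
    Commute A (degOp σ) := op_ext fun s => by
  rw [Module.End.mul_apply, Module.End.mul_apply, h, degOp_monomial, map_smul]

lemma degree_eq_of_mem_support {A : Op σ} (h : Commute A (degOp σ)) {s t : σ →₀ ℕ}
    (ht : coeff t (A (monomial s 1)) ≠ 0) : t.degree = s.degree := by
  have h1 := congrArg (coeff t) (LinearMap.congr_fun h (monomial s 1))
  rw [Module.End.mul_apply, Module.End.mul_apply, degOp_monomial, map_smul, coeff_smul,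
    coeff_degOp, smul_eq_mul] at h1
  exact_mod_cast (mul_right_cancel₀ ht h1).symm

lemma commute_eulerFun_degOp (i : σ) (f : ℕ → ℂ) : Commute (eulerFun i f) (degOp σ) :=
  commute_degOp_of_monomial fun s => by rw [eulerFun_monomial, degOp_monomial]

lemma degOp_mulZ (i : σ) : degOp σ * mulZ i = mulZ i * (degOp σ + 1) := op_ext fun s => by
  classical
  rw [Module.End.mul_apply, Module.End.mul_apply, LinearMap.add_apply, degOp_monomial,
    Module.End.one_apply, mulZ_apply, mulZ_apply, X, monomial_mul, degOp_monomial, mul_add,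
    mul_smul_comm, monomial_mul, map_add, Finsupp.degree_single]
  push_cast
  rw [add_smul, one_smul, add_comm]

/-- Division by `z_i` lowers the degree. The factor `f (z_i ∂_i)` is arbitrary, as `divZ` vanishes on
polynomials without `z_i`. -/
lemma divZ_eulerFun_degOp (i : σ) (f : ℕ → ℂ) :
    divZ i * eulerFun i f * degOp σ = (degOp σ + 1) * (divZ i * eulerFun i f) :=
  op_ext fun s => by
    classical
    simp only [Module.End.mul_apply, LinearMap.add_apply, Module.End.one_apply, degOp_monomial,
      map_smul, eulerFun_monomial]
    rw [monomial_eq_smul, map_smul, divZ, onMonomials_monomial]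
    split_ifs with h
    · simp
    · rw [map_smul, degOp_monomial]
      have : s.degree = (s - Finsupp.single i 1).degree + 1 := by
        conv_lhs => rw [← tsub_add_cancel_of_le (a := Finsupp.single i 1) (b := s)
          (by simpa [Nat.one_le_iff_ne_zero] using h)]
        rw [map_add, Finsupp.degree_single]
      rw [this]
      push_cast
      module

lemma commute_weylU_degOp (q : ℂ) (i j : σ) : Commute (weylU q i j) (degOp σ) := by
  have h := divZ_eulerFun_degOp i (fun a => 1 - q ^ (-2 * (a : ℂ)))
  rw [Commute, SemiconjBy, weylU, mul_assoc (mulZ j), mul_assoc, h, ← mul_assoc, ← degOp_mulZ,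
    mul_assoc]

lemma commute_sum_pow_degOp {A : Op σ} (hA : Commute A (degOp σ)) (i : σ) (c : ℕ → ℂ) :
    Commute (onMonomials fun s => ∑ n ∈ Finset.range (s i + 1), c n • (A ^ n) (monomial s 1))
      (degOp σ) := commute_degOp_of_monomial fun s => by
  rw [onMonomials_monomial, map_sum, Finset.smul_sum]
  refine Finset.sum_congr rfl fun n _ => ?_
  have h := LinearMap.congr_fun (hA.pow_left n) (monomial s 1)
  rw [Module.End.mul_apply, Module.End.mul_apply, degOp_monomial, map_smul] at h
  rw [map_smul, ← h, smul_comm]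

lemma commute_Rminus_degOp (q : ℂ) (i j : σ) (up um vm : ℂ) :
    Commute (Rminus q i j up um vm) (degOp σ) :=
  ((commute_sum_pow_degOp (commute_weylU_degOp q i j) i _).mul_left
    (commute_eulerFun_degOp i _)).mul_left
    (commute_sum_pow_degOp (commute_weylU_degOp q i j) i _)

lemma commute_perm_degOp [DecidableEq σ] (i j : σ) : Commute (perm i j) (degOp σ) :=
  commute_degOp_of_monomial fun s => by
    rw [perm, AlgHom.toLinearMap_apply, rename_monomial, degOp_monomial, Finsupp.degree_mapDomain]

lemma commute_siteR_degOp [DecidableEq σ] (q : ℂ) (i o : σ) (ℓ δ u₁ u₂ : ℂ) :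
    Commute (siteR q i o ℓ δ u₁ u₂) (degOp σ) := by
  rw [siteR, Rplus_eq_Rminus]
  exact (commute_perm_degOp i o).mul_left
    ((commute_Rminus_degOp _ _ _ _ _ _).mul_left (commute_Rminus_degOp _ _ _ _ _ _))

variable {N : ℕ}

lemma commute_chainR_degOp (q : ℂ) (ℓ δ : Fin N → ℂ) (u₁ u₂ : ℂ) :
    Commute (chainR q ℓ δ u₁ u₂) (degOp _) :=
  Commute.list_prod_left _ _ fun x hx => by
    obtain ⟨k, rfl⟩ := (List.mem_ofFn' _ _).mp hx
    exact commute_siteR_degOp _ _ _ _ _ _ _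

lemma degree_optionElim (s : Fin N →₀ ℕ) (m : ℕ) : (s.optionElim m).degree = m + s.degree := by
  simp [Finsupp.degree_eq_sum]

/-- Operators conserving the total degree have diagonal matrix elements with this property. -/
lemma commute_auxCoeff_degOp {A : Op (Option (Fin N))} (hA : Commute A (degOp _)) (d : ℕ) :
    Commute (auxCoeff A d d) (degOp (Fin N)) := commute_degOp_of_monomial fun s => by
  refine MvPolynomial.ext _ _ fun t => ?_
  rw [coeff_degOp, coeff_smul, smul_eq_mul, auxCoeff_apply, coeff_auxOut, auxIn_monomial]
  by_cases h : coeff (t.optionElim d) (A (monomial (s.optionElim d) 1)) = 0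
  · rw [h, mul_zero, mul_zero]
  · have := degree_eq_of_mem_support hA h
    rw [degree_optionElim, degree_optionElim, add_right_inj] at this
    rw [this]

lemma commute_chainQ_degOp (q : ℂ) (ℓ δ : Fin N → ℂ) (u₁ u₂ : ℂ) (d : ℕ) :
    Commute (chainQ q ℓ δ u₁ u₂ d) (degOp _) :=
  commute_auxCoeff_degOp (commute_chainR_degOp q ℓ δ u₁ u₂) d

/-- The Lax matrix conserves the total degree, if the first component of `ℂ²` is given degree one and
the second one degree zero. -/
lemma lax_mul_diagonal_degOp (q ℓ : ℂ) (i : σ) (u : ℂ) :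
    lax q ℓ i u * Matrix.diagonal ![degOp σ + 1, degOp σ] =
      Matrix.diagonal ![degOp σ + 1, degOp σ] * lax q ℓ i u := by
  have h0 := divZ_eulerFun_degOp i (fun a => qNum q a)
  have h1 := fun f => commute_eulerFun_degOp i f
  refine Matrix.ext fun a b => ?_
  rw [Matrix.mul_diagonal, Matrix.diagonal_mul, lax_eq_laxPM]
  revert a b
  simp only [Fin.forall_fin_two, laxPM_zero_zero, laxPM_zero_one, laxPM_one_zero, laxPM_one_one,
    Matrix.cons_val_zero, Matrix.cons_val_one, Matrix.cons_val_fin_one]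
  refine ⟨⟨?_, ?_⟩, ?_, (h1 _).eq⟩
  · exact ((h1 _).add_right (Commute.one_right _)).eq
  · rw [sMinus, op_neg, smul_mul_assoc, h0, mul_smul_comm]
  · rw [← mul_assoc, degOp_mulZ, mul_assoc, mul_assoc,
      ((h1 _).add_right (Commute.one_right _)).eq]

lemma commute_chainLax_degOp (q : ℂ) (ℓ δ : Fin N → ℂ) (v : ℂ) :
    Commute (chainLax id q ℓ δ v 0 0) (degOp _) ∧ Commute (chainLax id q ℓ δ v 1 1) (degOp _) := by
  have h : chainLax id q ℓ δ v * Matrix.diagonal ![degOp (Fin N) + 1, degOp (Fin N)] =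
      Matrix.diagonal ![degOp (Fin N) + 1, degOp (Fin N)] * chainLax id q ℓ δ v := by
    rw [chainLax, List.ofFn_eq_map]
    exact prod_map_semiconj _ _ _ _ fun k _ => lax_mul_diagonal_degOp _ _ _ _
  have h0 := congrFun (congrFun h 0) 0
  have h1 := congrFun (congrFun h 1) 1
  simp only [Matrix.mul_diagonal, Matrix.diagonal_mul, Matrix.cons_val_zero, Matrix.cons_val_one,
    Matrix.cons_val_fin_one] at h0 h1
  refine ⟨?_, h1⟩
  rw [mul_add, add_mul, mul_one, one_mul, add_left_inj] at h0
  exact h0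

end Degree

/-! ### Limits of families of operators -/

section Limits

open MvPolynomial Filter Topology

variable {σ X : Type}

lemma eq_sum_of_support_subset {f : MvPolynomial σ ℂ} {S : Finset (σ →₀ ℕ)}
    (h : f.support ⊆ S) : f = ∑ t ∈ S, coeff t f • (monomial t 1 : MvPolynomial σ ℂ) := by
  conv_lhs => rw [f.as_sum]
  rw [Finset.sum_subset h fun t _ ht => by rw [notMem_support_iff.mp ht, monomial_zero]]
  exact Finset.sum_congr rfl fun t _ => monomial_eq_smul t _

/-- A family of polynomials tends to `g` along `l`: the coefficients converge, and only finitely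
many monomials are involved. -/
def PolyTendsto (f : X → MvPolynomial σ ℂ) (l : Filter X) (g : MvPolynomial σ ℂ) : Prop :=
  ∃ S : Finset (σ →₀ ℕ), (∀ x, (f x).support ⊆ S) ∧ g.support ⊆ S ∧
    ∀ s, Tendsto (fun x => coeff s (f x)) l (𝓝 (coeff s g))

/-- A family of operators tends to `A` along `l` if it does so on every polynomial. -/
def OpTendsto (F : X → Op σ) (l : Filter X) (A : Op σ) : Prop :=
  ∀ Ψ, PolyTendsto (fun x => F x Ψ) l (A Ψ)

variable {l : Filter X}

namespace PolyTendsto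

lemma const (g : MvPolynomial σ ℂ) : PolyTendsto (fun _ : X => g) l g :=
  ⟨g.support, fun _ => subset_rfl, subset_rfl, fun _ => tendsto_const_nhds⟩

lemma add {f f' : X → MvPolynomial σ ℂ} {g g' : MvPolynomial σ ℂ} (h : PolyTendsto f l g)
    (h' : PolyTendsto f' l g') : PolyTendsto (fun x => f x + f' x) l (g + g') := by
  classical
  obtain ⟨S, h1, h2, h3⟩ := h
  obtain ⟨S', h1', h2', h3'⟩ := h'
  refine ⟨S ∪ S', fun x => support_add.trans (Finset.union_subset_union (h1 x) (h1' x)),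
    support_add.trans (Finset.union_subset_union h2 h2'), fun s => ?_⟩
  simpa only [coeff_add] using (h3 s).add (h3' s)

lemma smul {f : X → MvPolynomial σ ℂ} {g : MvPolynomial σ ℂ} {c : X → ℂ} {d : ℂ}
    (hc : Tendsto c l (𝓝 d)) (h : PolyTendsto f l g) :
    PolyTendsto (fun x => c x • f x) l (d • g) := by
  obtain ⟨S, h1, h2, h3⟩ := h
  refine ⟨S, fun x => support_smul.trans (h1 x), support_smul.trans h2, fun s => ?_⟩
  simpa only [coeff_smul, smul_eq_mul] using hc.mul (h3 s)

lemma sum {ι : Type*} (T : Finset ι) {f : ι → X → MvPolynomial σ ℂ} {g : ι → MvPolynomial σ ℂ}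
    (h : ∀ i ∈ T, PolyTendsto (f i) l (g i)) :
    PolyTendsto (fun x => ∑ i ∈ T, f i x) l (∑ i ∈ T, g i) := by
  classical
  induction T using Finset.induction_on with
  | empty => simpa using const (0 : MvPolynomial σ ℂ)
  | insert a T ha ih =>
    simp only [Finset.sum_insert ha]
    exact (h a (Finset.mem_insert_self _ _)).add
      (ih fun i hi => h i (Finset.mem_insert_of_mem hi))

end PolyTendsto

namespace OpTendsto

variable {F G : X → Op σ} {A B : Op σ}

lemma const (A : Op σ) : OpTendsto (fun _ : X => A) l A := fun _ => .const _

lemma add (hF : OpTendsto F l A) (hG : OpTendsto G l B) :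
    OpTendsto (fun x => F x + G x) l (A + B) := fun Ψ => (hF Ψ).add (hG Ψ)

lemma apply (hF : OpTendsto F l A) {f : X → MvPolynomial σ ℂ} {g : MvPolynomial σ ℂ}
    (h : PolyTendsto f l g) : PolyTendsto (fun x => F x (f x)) l (A g) := by
  obtain ⟨S, h1, h2, h3⟩ := h
  have e1 : ∀ x, F x (f x) = ∑ t ∈ S, coeff t (f x) • F x (monomial t 1) := fun x => by
    conv_lhs => rw [eq_sum_of_support_subset (h1 x)]
    simp only [map_sum, map_smul]
  have e2 : A g = ∑ t ∈ S, coeff t g • A (monomial t 1) := by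
    conv_lhs => rw [eq_sum_of_support_subset h2]
    simp only [map_sum, map_smul]
  rw [e2]
  simp only [e1]
  exact PolyTendsto.sum S fun t _ => (hF _).smul (h3 t)

lemma mul (hF : OpTendsto F l A) (hG : OpTendsto G l B) :
    OpTendsto (fun x => F x * G x) l (A * B) := fun Ψ => hF.apply (hG Ψ)

lemma of_monomial (h : ∀ s, PolyTendsto (fun x => F x (monomial s 1)) l (A (monomial s 1))) :
    OpTendsto F l A := fun Ψ => by
  have e : ∀ B : Op σ, B Ψ = ∑ t ∈ Ψ.support, coeff t Ψ • B (monomial t 1) := fun B => by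
    conv_lhs => rw [eq_sum_of_support_subset (subset_refl Ψ.support)]
    simp only [map_sum, map_smul]
  simp only [e]
  exact PolyTendsto.sum _ fun t _ => (h t).smul tendsto_const_nhds

lemma eulerFun (i : σ) {f : X → ℕ → ℂ} {g : ℕ → ℂ} (h : ∀ a, Tendsto (fun x => f x a) l (𝓝 (g a))) :
    OpTendsto (fun x => eulerFun i (f x)) l (eulerFun i g) := of_monomial fun s => by
  simp only [eulerFun_monomial, mul_one]
  simp only [monomial_eq_smul s (f _ _), monomial_eq_smul s (g _)]
  exact (PolyTendsto.const _).smul (h _)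

lemma sum_pow {c : X → ℕ → ℂ} {d : ℕ → ℂ} (h : ∀ n, Tendsto (fun x => c x n) l (𝓝 (d n)))
    (i : σ) (B : Op σ) :
    OpTendsto (fun x => onMonomials fun s => ∑ n ∈ Finset.range (s i + 1),
        c x n • (B ^ n) (monomial s 1)) l
      (onMonomials fun s => ∑ n ∈ Finset.range (s i + 1), d n • (B ^ n) (monomial s 1)) :=
  of_monomial fun s => by
    simp only [onMonomials_monomial]
    exact PolyTendsto.sum _ fun n _ => (PolyTendsto.const _).smul (h n)

/-- Families with the same values have the same limit. -/
lemma unique [l.NeBot] (hF : OpTendsto F l A) (hG : OpTendsto G l B)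
    (h : ∀ᶠ x in l, F x = G x) : A = B := by
  refine LinearMap.ext fun Ψ => MvPolynomial.ext _ _ fun s => ?_
  obtain ⟨-, -, -, h1⟩ := hF Ψ
  obtain ⟨-, -, -, h2⟩ := hG Ψ
  exact tendsto_nhds_unique_of_eventuallyEq (h1 s) (h2 s)
    (h.mono fun x hx => congrArg (fun B : Op σ => coeff s (B Ψ)) hx)

lemma list_prod {ι : Type*} {F : X → ι → Op σ} {A : ι → Op σ} (L : List ι)
    (h : ∀ k ∈ L, OpTendsto (fun x => F x k) l (A k)) :
    OpTendsto (fun x => (L.map (F x)).prod) l (L.map A).prod := by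
  induction L with
  | nil => exact const _
  | cons k L ih =>
    simp only [List.map_cons, List.prod_cons]
    exact (h k List.mem_cons_self).mul (ih fun k hk => h k (List.mem_cons_of_mem _ hk))

lemma list_prod_matrix {ι : Type*} {F : X → ι → Matrix (Fin 2) (Fin 2) (Op σ)}
    {A : ι → Matrix (Fin 2) (Fin 2) (Op σ)} (L : List ι)
    (h : ∀ k a b, OpTendsto (fun x => F x k a b) l (A k a b)) (a b : Fin 2) :
    OpTendsto (fun x => (L.map (F x)).prod a b) l ((L.map A).prod a b) := by
  induction L generalizing a b with
  | nil => exact const _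
  | cons k L ih =>
    simp only [List.map_cons, List.prod_cons, Matrix.mul_apply, Fin.sum_univ_two]
    exact ((h k _ _).mul (ih _ _)).add ((h k _ _).mul (ih _ _))

end OpTendsto

lemma tendsto_cpow {q : ℂ} (hq0 : q ≠ 0) {c : X → ℂ} {d : ℂ} (h : Tendsto c l (𝓝 d)) :
    Tendsto (fun x => q ^ c x) l (𝓝 (q ^ d)) := h.const_cpow (Or.inl hq0)

lemma tendsto_qNum {q : ℂ} (hq0 : q ≠ 0) {c : X → ℂ} {d : ℂ} (h : Tendsto c l (𝓝 d)) :
    Tendsto (fun x => qNum q (c x)) l (𝓝 (qNum q d)) :=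
  ((tendsto_cpow hq0 h).sub (tendsto_cpow hq0 h.neg)).div_const _

lemma opTendsto_lax {q : ℂ} (hq0 : q ≠ 0) (ℓ : ℂ) (i : σ) {c : X → ℂ} {d : ℂ}
    (h : Tendsto c l (𝓝 d)) (a b : Fin 2) :
    OpTendsto (fun x => lax q ℓ i (c x) a b) l (lax q ℓ i d a b) := by
  revert a b
  simp only [lax_eq_laxPM, Fin.forall_fin_two, laxPM_zero_zero, laxPM_zero_one, laxPM_one_zero,
    laxPM_one_one]
  refine ⟨⟨?_, .const _⟩, (OpTendsto.const _).mul ?_, ?_⟩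
  · exact .eulerFun i fun n => tendsto_qNum hq0 ((h.add_const _).add_const _)
  · simp only [add_sub_sub_cancel]
    exact .const _
  · exact .eulerFun i fun n => tendsto_qNum hq0 ((h.sub_const _).sub_const _)

lemma opTendsto_chainLax {q : ℂ} (hq0 : q ≠ 0) {N : ℕ} (ℓ : Fin N → ℂ) {δ' : X → Fin N → ℂ}
    {δ : Fin N → ℂ} (h' : ∀ k, Tendsto (fun x => δ' x k) l (𝓝 (δ k))) {c : X → ℂ} {d : ℂ}
    (h : Tendsto c l (𝓝 d)) (a b : Fin 2) :
    OpTendsto (fun x => chainLax id q ℓ (δ' x) (c x) a b) l (chainLax id q ℓ δ d a b) := by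
  simp only [chainLax, List.ofFn_eq_map]
  exact OpTendsto.list_prod_matrix _ (fun k a b => opTendsto_lax hq0 _ _ (h.add (h' k)) a b) a b

lemma opTendsto_Rminus {q : ℂ} (hq0 : q ≠ 0) (i j : σ)
    {cp cm c : X → ℂ} {up um vm : ℂ}
    (hp : Tendsto cp l (𝓝 up)) (hm : Tendsto cm l (𝓝 um)) (h : Tendsto c l (𝓝 vm))
    (hN : NoPole q up um) :
    OpTendsto (fun x => Rminus q i j (cp x) (cm x) (c x)) l (Rminus q i j up um vm) := by
  have hpoch : ∀ {c : X → ℂ} {d : ℂ}, Tendsto c l (𝓝 d) → ∀ n,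
      Tendsto (fun x => qPoch (q ^ c x) (q ^ 2) n) l (𝓝 (qPoch (q ^ d) (q ^ 2) n)) :=
    fun hc n => tendsto_finsetProd _ fun k _ =>
      tendsto_const_nhds.sub ((tendsto_cpow hq0 hc).const_mul _)
  refine (OpTendsto.mul (OpTendsto.mul ?_ ?_) ?_)
  · exact .sum_pow (fun n => ((tendsto_cpow hq0 ((hm.sub hp).add_const _)).pow n).div_const _) i _
  · refine .eulerFun i fun n => ?_
    refine (tendsto_cpow hq0 ((((h.sub hm).div_const _).const_mul _).mul_const _)).mul ?_
    refine (hpoch ((hp.const_mul _).sub (h.const_mul _)) n).div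
      (hpoch ((hp.const_mul _).sub (hm.const_mul _)) n) ?_
    have h0 := hN.qPoch_ne_zero hq0 0 n
    rwa [← mul_pow, ← Complex.cpow_add _ _ hq0, ← Complex.cpow_nat_mul, show
      ((2 : ℕ) : ℂ) * (up - 0 + (0 - um)) = 2 * up - 2 * um by push_cast; ring] at h0
  · exact .sum_pow (fun n => ((((tendsto_cpow hq0 ((h.sub hp).add_const _)).pow n).const_mul
      _).div_const _)) i _

variable {N : ℕ} {q : ℂ} {ℓ δ : Fin N → ℂ}

lemma opTendsto_chainR (hq0 : q ≠ 0)
    (hℓ : ∀ (k : Fin N) (j : ℕ), q ^ (4 * ℓ k + 2 * j) ≠ 1) {u₁ : ℂ} (u₂ : ℂ)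
    (h1 : Regular q ℓ δ u₁) {δ' : X → Fin N → ℂ} (h' : ∀ k, Tendsto (fun x => δ' x k) l (𝓝 (δ k))) :
    OpTendsto (fun x => chainR q ℓ (δ' x) u₁ u₂) l (chainR q ℓ δ u₁ u₂) := by
  simp only [chainR, List.ofFn_eq_map]
  refine OpTendsto.list_prod _ fun k _ => ?_
  simp only [siteR, Rplus_eq_Rminus]
  refine (OpTendsto.const _).mul (OpTendsto.mul ?_ ?_)
  · refine opTendsto_Rminus hq0 _ _ ((h' k).sub_const _).neg tendsto_const_nhds
      ((h' k).add_const _).neg ?_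
    intro j
    rw [show 2 * -(δ k - ℓ k) - 2 * -(1 - u₁) + 2 * (j : ℂ) =
      2 * (1 - u₁) - 2 * (δ k - ℓ k) + 2 * j by ring]
    exact h1.noPole k j
  · exact opTendsto_Rminus hq0 _ _ ((h' k).add_const _) ((h' k).sub_const _) tendsto_const_nhds
      (noPole_site hℓ δ k)

lemma OpTendsto.auxCoeff {F : X → Op (Option (Fin N))} {A : Op (Option (Fin N))}
    (h : OpTendsto F l A) (m n : ℕ) :
    OpTendsto (fun x => auxCoeff (F x) m n) l (auxCoeff A m n) := fun Ψ => by
  classical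
  obtain ⟨S, h1, h2, h3⟩ := h (auxIn m Ψ)
  have hS : ∀ f : MvPolynomial (Option (Fin N)) ℂ, f.support ⊆ S →
      (auxOut n f).support ⊆ S.image Finsupp.some := fun f hf s hs => by
    rw [mem_support_iff, coeff_auxOut, ← mem_support_iff] at hs
    exact Finset.mem_image.mpr ⟨_, hf hs, Finsupp.some_optionElim _ _⟩
  refine ⟨S.image Finsupp.some, fun x => hS _ (h1 x), hS _ h2, fun s => ?_⟩
  simpa only [auxCoeff_apply, coeff_auxOut] using h3 _

/-! ### Generic values of the parameters -/

lemma countable_cpow_eq_one (hq0 : q ≠ 0) (hq1 : q ≠ 1) (a : ℂ) {b : ℂ} (hb : b ≠ 0) :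
    {v : ℂ | q ^ (a + b * v) = 1}.Countable := by
  have hlog : Complex.log q ≠ 0 := fun h => hq1 (by
    rw [← Complex.exp_log hq0, h, Complex.exp_zero])
  have h1 : {z : ℂ | Complex.exp z = 1}.Countable :=
    (Set.countable_range fun n : ℤ => (n : ℂ) * (2 * Real.pi * Complex.I)).mono fun z hz => by
      obtain ⟨n, hn⟩ := Complex.exp_eq_one_iff.mp hz
      exact ⟨n, hn.symm⟩
  refine (h1.preimage_of_injOn (f := fun v => Complex.log q * (a + b * v)) ?_).mono ?_
  · intro x _ y _ hxy
    exact mul_left_cancel₀ hb (add_left_cancel (mul_left_cancel₀ hlog hxy))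
  · intro v hv
    rw [Set.mem_ofPred_eq, Complex.cpow_def_of_ne_zero hq0] at hv
    exact hv

lemma qNum_eq_zero_iff (hq0 : q ≠ 0) (hq : ∀ n : ℕ, 0 < n → q ^ n ≠ 1) (x : ℂ) :
    qNum q x = 0 ↔ q ^ (2 * x) = 1 := by
  have h1 : q - q⁻¹ ≠ 0 := fun h => hq 2 two_pos (by
    rw [sub_eq_zero] at h
    rw [pow_two]
    nth_rewrite 1 [h]
    exact inv_mul_cancel₀ hq0)
  have h2 := cpow_ne_zero' hq0 x
  rw [qNum_eq, mul_eq_zero, or_iff_right (inv_ne_zero h1), sub_eq_zero, two_mul,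
    Complex.cpow_add _ _ hq0, ← mul_eq_one_iff_eq_inv₀ h2]

lemma exists_filter_of_countable_compl {S : Set ℂ} (hS : S.Countable) (v : ℂ) :
    ∃ l : Filter ℂ, l.NeBot ∧ l ≤ 𝓝 v ∧ ∀ᶠ w in l, w ∉ S :=
  ⟨𝓝[Sᶜ] v, mem_closure_iff_nhdsWithin_neBot.mp (hS.dense_compl ℂ v), nhdsWithin_le_nhds,
    self_mem_nhdsWithin⟩

lemma countable_qNum_eq_zero (hq0 : q ≠ 0) (hq : ∀ n : ℕ, 0 < n → q ^ n ≠ 1) (u : ℂ) :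
    {v : ℂ | qNum q (v - u) = 0}.Countable :=
  (countable_cpow_eq_one hq0 (by simpa using hq 1 one_pos) (-2 * u) two_ne_zero).mono
    fun v hv => by
      rw [Set.mem_ofPred_eq, qNum_eq_zero_iff hq0 hq] at hv
      rw [Set.mem_ofPred_eq, ← hv]
      congr 1
      ring

/-- Commutativity with the transfer matrix, graded by the degree in `z₀`. The relation holds for
generic spectral parameters, and extends to all of them by continuity. -/
theorem chainQ_mul_chainLax (hq0 : q ≠ 0) (hq : ∀ n : ℕ, 0 < n → q ^ n ≠ 1)
    (hℓ : ∀ (k : Fin N) (j : ℕ), q ^ (4 * ℓ k + 2 * j) ≠ 1) {u₁ : ℂ} (u₂ v : ℂ)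
    (h1 : Regular q ℓ δ u₁) :
    (∀ d, chainQ q ℓ δ u₁ u₂ d * chainLax id q ℓ δ v 0 0 +
        chainQ q ℓ δ u₁ u₂ (d + 1) * chainLax id q ℓ δ v 1 1 =
      chainLax id q ℓ δ v 0 0 * chainQ q ℓ δ u₁ u₂ d +
        chainLax id q ℓ δ v 1 1 * chainQ q ℓ δ u₁ u₂ (d + 1)) ∧
    chainQ q ℓ δ u₁ u₂ 0 * chainLax id q ℓ δ v 1 1 =
      chainLax id q ℓ δ v 1 1 * chainQ q ℓ δ u₁ u₂ 0 := by
  obtain ⟨l, hl, hlv, hgen⟩ := exists_filter_of_countable_compl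
    ((countable_qNum_eq_zero hq0 hq u₁).union (countable_qNum_eq_zero hq0 hq u₂)) v
  have hgen' : ∀ᶠ w in l, qNum q (w - u₁) ≠ 0 ∧ qNum q (w - u₂) ≠ 0 :=
    hgen.mono fun w hw => by
      simpa only [Set.mem_union, Set.mem_ofPred_eq, not_or] using hw
  have ht : ∀ a, OpTendsto (fun w => chainLax id q ℓ δ w a a) l (chainLax id q ℓ δ v a a) :=
    fun a => opTendsto_chainLax hq0 ℓ (δ' := fun _ => δ) (c := fun w => w)
      (fun _ => tendsto_const_nhds) hlv a a
  constructor
  · intro d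
    refine OpTendsto.unique (l := l)
      (((OpTendsto.const (chainQ q ℓ δ u₁ u₂ d)).mul (ht 0)).add
        ((OpTendsto.const (chainQ q ℓ δ u₁ u₂ (d + 1))).mul (ht 1)))
      (((ht 0).mul (.const _)).add ((ht 1).mul (.const _))) ?_
    exact hgen'.mono fun w hw => (chainQ_mul_chainLax_of_ne_zero hq0 hq hℓ h1 hw.1 hw.2).1 d
  · refine OpTendsto.unique (l := l) ((OpTendsto.const (chainQ q ℓ δ u₁ u₂ 0)).mul (ht 1))
      ((ht 1).mul (.const _)) ?_
    exact hgen'.mono fun w hw => (chainQ_mul_chainLax_of_ne_zero hq0 hq hℓ h1 hw.1 hw.2).2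

end Limits

/-! ### Coefficientwise convergent series of operators -/

section Series

open MvPolynomial

variable {N : ℕ}

/-- The monomials of total degree `n`. -/
def degFinset (N n : ℕ) : Finset (Fin N →₀ ℕ) := Finset.finsuppAntidiag Finset.univ n

lemma mem_degFinset {n : ℕ} {s : Fin N →₀ ℕ} : s ∈ degFinset N n ↔ s.degree = n := by
  simp [degFinset, Finset.mem_finsuppAntidiag, Finsupp.degree_eq_sum]

lemma support_subset_degFinset {A : Op (Fin N)} (h : Commute A (degOp _)) (s : Fin N →₀ ℕ) :
    (A (monomial s 1)).support ⊆ degFinset N s.degree := fun _ ht =>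
  mem_degFinset.mpr (degree_eq_of_mem_support h (mem_support_iff.mp ht))

/-- Matrix elements of a product with an operator conserving the degree. -/
lemma coeff_mul_monomial (A : Op (Fin N)) {B : Op (Fin N)} (h : Commute B (degOp _))
    (s t : Fin N →₀ ℕ) : coeff t ((A * B) (monomial s 1)) =
      ∑ r ∈ degFinset N s.degree, coeff t (A (monomial r 1)) * coeff r (B (monomial s 1)) := by
  rw [Module.End.mul_apply]
  conv_lhs => rw [eq_sum_of_support_subset (support_subset_degFinset h s)]
  simp only [map_sum, map_smul, coeff_sum, coeff_smul, smul_eq_mul]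
  exact Finset.sum_congr rfl fun r _ => mul_comm _ _

/-- The series of operators `∑_d F d` converges coefficientwise to `T`. -/
def HasOpSum (F : ℕ → Op (Fin N)) (T : Op (Fin N)) : Prop :=
  ∀ Ψ s, HasSum (fun d => coeff s (F d Ψ)) (coeff s (T Ψ))

lemma hasSum_antidiagonal {f g : ℕ → ℂ} {a b : ℂ} (hf : HasSum f a) (hg : HasSum g b) :
    HasSum (fun d => ∑ x ∈ Finset.HasAntidiagonal.antidiagonal d, f x.1 * g x.2) (a * b) := by
  have hf' := hf.summable.norm
  have hg' := hg.summable.norm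
  rw [← hf.tsum_eq, ← hg.tsum_eq,
    tsum_mul_tsum_eq_tsum_sum_antidiagonal_of_summable_norm hf' hg']
  exact (summable_norm_sum_mul_antidiagonal_of_summable_norm hf' hg').of_norm.hasSum

namespace HasOpSum

variable {F G : ℕ → Op (Fin N)} {T U : Op (Fin N)}

lemma unique (h : HasOpSum F T) (h' : HasOpSum F U) : T = U :=
  LinearMap.ext fun Ψ => MvPolynomial.ext _ _ fun s => (h Ψ s).unique (h' Ψ s)

lemma smul (c : ℂ) (h : HasOpSum F T) : HasOpSum (fun d => c • F d) (c • T) := fun Ψ s => by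
  simpa only [LinearMap.smul_apply, coeff_smul] using (h Ψ s).const_smul c

lemma mul_const (h : HasOpSum F T) (A : Op (Fin N)) : HasOpSum (fun d => F d * A) (T * A) :=
  fun Ψ s => h (A Ψ) s

lemma of_monomial (h : ∀ t s, HasSum (fun d => coeff s (F d (monomial t 1)))
    (coeff s (T (monomial t 1)))) : HasOpSum F T := fun Ψ s => by
  have e : ∀ B : Op (Fin N), coeff s (B Ψ) =
      ∑ t ∈ Ψ.support, coeff t Ψ * coeff s (B (monomial t 1)) := fun B => by
    conv_lhs => rw [eq_sum_of_support_subset (subset_refl Ψ.support)]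
    simp only [map_sum, map_smul, coeff_sum, coeff_smul, smul_eq_mul]
  simp only [e]
  exact hasSum_sum fun t _ => (h t s).mul_left _

lemma commute_degOp (h : HasOpSum F T) (hF : ∀ d, Commute (F d) (degOp _)) :
    Commute T (degOp _) := commute_degOp_of_monomial fun s => MvPolynomial.ext _ _ fun t => by
  rw [coeff_degOp, coeff_smul, smul_eq_mul]
  by_cases hst : t.degree = s.degree
  · rw [hst]
  · have h0 : (fun d => coeff t (F d (monomial s 1))) = fun _ => 0 := funext fun d =>
      not_not.mp fun hne => hst (degree_eq_of_mem_support (hF d) hne)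
    have h1 := h (monomial s 1) t
    rw [h0] at h1
    rw [h1.unique hasSum_zero, mul_zero, mul_zero]

lemma const_mul (h : HasOpSum F T) (hF : ∀ d, Commute (F d) (degOp _)) (A : Op (Fin N)) :
    HasOpSum (fun d => A * F d) (A * T) := of_monomial fun t s => by
  simp only [coeff_mul_monomial A (hF _), coeff_mul_monomial A (h.commute_degOp hF)]
  exact hasSum_sum fun r _ => (h _ _).mul_left _

/-- The Cauchy product. -/
lemma mul (h : HasOpSum F T) (h' : HasOpSum G U) (hG : ∀ d, Commute (G d) (degOp _)) :
    HasOpSum (fun d => ∑ x ∈ Finset.HasAntidiagonal.antidiagonal d, F x.1 * G x.2) (T * U) :=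
  of_monomial fun t s => by
    simp only [LinearMap.sum_apply, coeff_sum, coeff_mul_monomial _ (hG _),
      coeff_mul_monomial _ (h'.commute_degOp hG)]
    simp only [Finset.sum_comm (s := Finset.HasAntidiagonal.antidiagonal _)]
    exact hasSum_sum fun r _ => hasSum_antidiagonal
      (f := fun d => coeff s (F d (monomial r 1))) (g := fun d => coeff r (G d (monomial t 1)))
      (h _ _) (h' _ _)

/-- Summation of a relation between series in which the second terms are shifted. -/
lemma add_eq_add {a b a' b' : ℕ → Op (Fin N)} {A B A' B' : Op (Fin N)} (ha : HasOpSum a A)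
    (hb : HasOpSum b B) (ha' : HasOpSum a' A') (hb' : HasOpSum b' B')
    (h : ∀ d, a d + b (d + 1) = a' d + b' (d + 1)) (h0 : b 0 = b' 0) : A + B = A' + B' := by
  refine LinearMap.ext fun Ψ => MvPolynomial.ext _ _ fun s => ?_
  have h1 := (ha Ψ s).add ((hasSum_nat_add_iff' 1).mpr (hb Ψ s))
  have h2 := (ha' Ψ s).add ((hasSum_nat_add_iff' 1).mpr (hb' Ψ s))
  simp only [← coeff_add, ← LinearMap.add_apply, h] at h1
  simp only [← coeff_add, ← LinearMap.add_apply] at h2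
  have h3 := h1.unique h2
  rw [Finset.sum_range_one, Finset.sum_range_one, h0] at h3
  rw [LinearMap.add_apply, LinearMap.add_apply, coeff_add, coeff_add]
  linear_combination h3

end HasOpSum

variable {q : ℂ} {ℓ δ : Fin N → ℂ}

lemma hasAuxTrace_iff (A : Op (Option (Fin N))) (T : Op (Fin N)) :
    HasAuxTrace A T ↔ HasOpSum (fun d => auxCoeff A d d) T := Iff.rfl

lemma auxTrace_spec {A : Op (Option (Fin N))} (h : ∃ T, HasAuxTrace A T) :
    HasAuxTrace A (auxTrace A) := by
  rw [auxTrace, dif_pos h]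
  exact h.choose_spec

lemma mem_domainQ {u₁ u₂ : ℂ} : (u₁, u₂) ∈ domainQ q ℓ δ ↔
    Regular q ℓ δ u₁ ∧ ∃ T, HasAuxTrace (chainR q ℓ δ u₁ u₂) T := by
  rw [domainQ, Set.mem_ofPred_eq, monodromy_eq_chainR]

lemma hasOpSum_baxterQ {u₁ u₂ : ℂ} (h : (u₁, u₂) ∈ domainQ q ℓ δ) :
    HasOpSum (chainQ q ℓ δ u₁ u₂) (baxterQ q ℓ δ u₁ u₂) := by
  rw [baxterQ, genTransfer, monodromy_eq_chainR]
  exact auxTrace_spec (mem_domainQ.mp h).2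

/-- The Baxter relation in `u₂`. -/
theorem baxterQ_mul_transfer_baxter (hq0 : q ≠ 0) (hq : ∀ n : ℕ, 0 < n → q ^ n ≠ 1)
    (hℓ : ∀ (k : Fin N) (j : ℕ), q ^ (4 * ℓ k + 2 * j) ≠ 1) {u₁ u : ℂ}
    (h : (u₁, u) ∈ domainQ q ℓ δ) (hp : (u₁, u + 1) ∈ domainQ q ℓ δ)
    (hm : (u₁, u - 1) ∈ domainQ q ℓ δ) :
    baxterQ q ℓ δ u₁ u * transfer q ℓ δ u =
      deltaPlus q ℓ δ u • baxterQ q ℓ δ u₁ (u + 1) +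
        deltaMinus q ℓ δ u • baxterQ q ℓ δ u₁ (u - 1) := by
  have hrel := chainQ_mul_chainLax_baxter (δ := δ) hq0 hq hℓ u₁ u
  rw [transfer_eq, mul_add]
  exact ((hasOpSum_baxterQ h).mul_const _).add_eq_add ((hasOpSum_baxterQ h).mul_const _)
    ((hasOpSum_baxterQ hp).smul _) ((hasOpSum_baxterQ hm).smul _) hrel.1 hrel.2

/-- The Baxter relation in `u₁`. -/
theorem transfer_mul_baxterQ_baxter (hq0 : q ≠ 0) (hq : ∀ n : ℕ, 0 < n → q ^ n ≠ 1) {u u₂ : ℂ}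
    (h : (u, u₂) ∈ domainQ q ℓ δ) (hm : (u - 1, u₂) ∈ domainQ q ℓ δ)
    (hp : (u + 1, u₂) ∈ domainQ q ℓ δ) :
    transfer q ℓ δ u * baxterQ q ℓ δ u u₂ =
      (deltaPlus q ℓ δ (u - 1) * deltaMinus q ℓ δ u / deltaMinus q ℓ δ (u - 1)) •
          baxterQ q ℓ δ (u - 1) u₂ +
        deltaMinus q ℓ δ u • baxterQ q ℓ δ (u + 1) u₂ := by
  have hrel := chainLax_mul_chainQ_baxter (δ := δ) hq0 hq u₂ (mem_domainQ.mp h).1 (mem_domainQ.mp hp).1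
  have hd := commute_chainQ_degOp q ℓ δ u u₂
  rw [transfer_eq, add_mul]
  exact ((hasOpSum_baxterQ h).const_mul hd _).add_eq_add ((hasOpSum_baxterQ h).const_mul hd _)
    ((hasOpSum_baxterQ hm).smul _) ((hasOpSum_baxterQ hp).smul _) hrel.1 hrel.2

/-- Commutativity with the transfer matrix. -/
theorem baxterQ_mul_transfer (hq0 : q ≠ 0) (hq : ∀ n : ℕ, 0 < n → q ^ n ≠ 1)
    (hℓ : ∀ (k : Fin N) (j : ℕ), q ^ (4 * ℓ k + 2 * j) ≠ 1) {u₁ u₂ : ℂ} (v : ℂ)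
    (h : (u₁, u₂) ∈ domainQ q ℓ δ) :
    baxterQ q ℓ δ u₁ u₂ * transfer q ℓ δ v = transfer q ℓ δ v * baxterQ q ℓ δ u₁ u₂ := by
  have hrel := chainQ_mul_chainLax hq0 hq hℓ u₂ v (mem_domainQ.mp h).1
  have hd := commute_chainQ_degOp q ℓ δ u₁ u₂
  rw [transfer_eq, add_mul, mul_add]
  exact ((hasOpSum_baxterQ h).mul_const _).add_eq_add ((hasOpSum_baxterQ h).mul_const _)
    ((hasOpSum_baxterQ h).const_mul hd _) ((hasOpSum_baxterQ h).const_mul hd _) hrel.1 hrel.2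

lemma deltaMinus_ne_zero (hq0 : q ≠ 0) (hq : ∀ n : ℕ, 0 < n → q ^ n ≠ 1) {u : ℂ}
    (h : Regular q ℓ δ u) : deltaMinus q ℓ δ (u - 1) ≠ 0 :=
  Finset.prod_ne_zero_iff.mpr fun k _ h0 => h k 0 (by
    rw [← neg_neg (u - 1 + δ k - ℓ k), qNum_neg, neg_eq_zero, qNum_eq_zero_iff hq0 hq] at h0
    rw [← h0]
    congr 1
    push_cast
    ring)

end Series

/-! ### Power series commuting with a pencil of simple spectrum -/

section Commutant

open Polynomial

lemma constantCoeff_aeval {R : Type*} [Ring R] [Algebra ℂ R] (T : PowerSeries R) (p : ℂ[X]) :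
    PowerSeries.constantCoeff (aeval T p) = aeval (PowerSeries.constantCoeff T) p := by
  induction p using Polynomial.induction_on' with
  | add p r hp hr => rw [map_add, map_add, hp, hr, map_add]
  | monomial n c =>
    rw [aeval_monomial, aeval_monomial, map_mul, map_pow]
    rfl

/-- Let every element commuting with `D` be a polynomial in `D`. Then formal power series commuting
with `D + x A` commute with each other: up to a multiple of `x`, such a series is a polynomial in
`D + x A`. -/
theorem powerSeries_commute_of_commute_pencil {R : Type*} [Ring R] [Algebra ℂ R] {D : R}
    (hD : ∀ B, Commute B D → ∃ p : ℂ[X], B = aeval D p) (A : R) {P P' : PowerSeries R}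
    (hP : Commute P (PowerSeries.C D + PowerSeries.X * PowerSeries.C A))
    (hP' : Commute P' (PowerSeries.C D + PowerSeries.X * PowerSeries.C A)) : Commute P P' := by
  set T := PowerSeries.C D + PowerSeries.X * PowerSeries.C A with hT
  have hT0 : PowerSeries.constantCoeff T = D := by simp [hT]
  have hX : ∀ {f g : PowerSeries R}, PowerSeries.X * f = PowerSeries.X * g → f = g :=
    fun {f g} h => PowerSeries.ext fun n => by
      rw [← PowerSeries.coeff_succ_X_mul, h, PowerSeries.coeff_succ_X_mul]
  suffices h : ∀ n, ∀ P, Commute P T → PowerSeries.coeff n (P * P') = PowerSeries.coeff n (P' * P) from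
    PowerSeries.ext fun n => h n P hP
  intro n
  induction n with
  | zero =>
    intro P hP
    have h0 := congrArg PowerSeries.constantCoeff hP.eq
    have h0' := congrArg PowerSeries.constantCoeff hP'.eq
    rw [map_mul, map_mul, hT0] at h0 h0'
    obtain ⟨p, hp⟩ := hD _ h0
    obtain ⟨p', hp'⟩ := hD _ h0'
    rw [PowerSeries.coeff_zero_eq_constantCoeff_apply, PowerSeries.coeff_zero_eq_constantCoeff_apply,
      map_mul, map_mul, hp, hp', ← map_mul, ← map_mul, mul_comm]
  | succ n ih =>
    intro P hP
    have h0 := congrArg PowerSeries.constantCoeff hP.eq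
    rw [map_mul, map_mul, hT0] at h0
    obtain ⟨p, hp⟩ := hD _ h0
    have hpT : ∀ {S}, Commute S T → Commute S (aeval T p) := fun hS => by
      clear hp
      induction p using Polynomial.induction_on' with
      | add p r hp hr => rw [map_add]; exact hp.add_right hr
      | monomial n c =>
        rw [aeval_monomial]
        exact (Algebra.commute_algebraMap_right c _).mul_right (hS.pow_right n)
    obtain ⟨P₁, hP₁⟩ : PowerSeries.X ∣ P - aeval T p :=
      PowerSeries.X_dvd_iff.mpr (by rw [map_sub, constantCoeff_aeval, hT0, hp, sub_self])
    rw [sub_eq_iff_eq_add] at hP₁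
    have hc : Commute P₁ T := by
      have h1 : Commute (P - aeval T p) T := hP.sub_left (hpT (Commute.refl T)).symm
      rw [hP₁, add_sub_cancel_right] at h1
      refine hX ?_
      rw [← mul_assoc, h1.eq, ← mul_assoc, (PowerSeries.commute_X T).eq, mul_assoc]
    rw [hP₁, add_mul, mul_add, map_add, map_add, (hpT hP').eq, mul_assoc, ← mul_assoc P',
      (PowerSeries.commute_X P').eq, mul_assoc, PowerSeries.coeff_succ_X_mul,
      PowerSeries.coeff_succ_X_mul, ih P₁ hc]

/-- A matrix commuting with a triangular matrix with distinct diagonal entries is a polynomial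
in it. -/
theorem exists_eq_aeval_of_commute {ι : Type*} [Fintype ι] [LinearOrder ι] {D : Matrix ι ι ℂ}
    (hD : ∀ i j, i < j → D i j = 0) (hinj : Function.Injective fun i => D i i)
    {B : Matrix ι ι ℂ} (hB : Commute B D) : ∃ p : ℂ[X], B = aeval D p := by
  have hev : ∀ i, ∃ v : ι → ℂ, v ≠ 0 ∧ D.mulVec v = D i i • v := fun i => by
    have hdet : (D - D i i • (1 : Matrix ι ι ℂ)).det = 0 := by
      rw [Matrix.det_of_isLowerTriangular]
      · refine Finset.prod_eq_zero (Finset.mem_univ i) ?_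
        simp
      · intro a b hab
        have hab' : a < b := hab
        simp [hD a b hab', hab'.ne]
    obtain ⟨v, hv, h0⟩ := Matrix.exists_mulVec_eq_zero_iff.mpr hdet
    refine ⟨v, hv, ?_⟩
    rwa [Matrix.sub_mulVec, Matrix.smul_mulVec, Matrix.one_mulVec, sub_eq_zero] at h0
  choose v hv hDv using hev
  have hli : LinearIndependent ℂ v :=
    Module.End.eigenvectors_linearIndependent' (Matrix.toLin' D) (fun i => D i i) hinj v fun i =>
      ⟨Module.End.mem_eigenspace_iff.mpr (by rw [Matrix.toLin'_apply, hDv]), hv i⟩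
  let b := basisOfLinearIndependentOfCardEqFinrank' v hli (by simp)
  have hb : ∀ i, b i = v i := fun i => by simp [b]
  have hBv : ∀ i, B.mulVec (v i) = b.repr (B.mulVec (v i)) i • v i := fun i => by
    have h1 : D.mulVec (B.mulVec (v i)) = D i i • B.mulVec (v i) := by
      rw [Matrix.mulVec_mulVec, ← hB.eq, ← Matrix.mulVec_mulVec, hDv, Matrix.mulVec_smul]
    have h2 : ∀ j, j ≠ i → b.repr (B.mulVec (v i)) j = 0 := fun j hj => by
      have h3 := congrArg (fun w => b.repr w j) h1
      have h4 : ∀ w, b.repr (D.mulVec w) j = D j j * b.repr w j := fun w => by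
        conv_lhs => rw [← b.sum_repr w]
        simp only [Matrix.mulVec_sum, Matrix.mulVec_smul, hb, hDv, map_sum, map_smul]
        simp only [← hb, b.repr_self]
        simp [Finsupp.single_apply, mul_comm]
      simp only [h4, map_smul, Finsupp.smul_apply, smul_eq_mul] at h3
      by_contra hne
      exact hj (hinj (mul_right_cancel₀ hne h3))
    conv_lhs => rw [← b.sum_repr (B.mulVec (v i))]
    rw [Finset.sum_eq_single i (fun j _ hj => by rw [h2 j hj, zero_smul])
      (fun h => absurd (Finset.mem_univ i) h), hb]
  refine ⟨Lagrange.interpolate Finset.univ (fun i => D i i)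
    fun i => b.repr (B.mulVec (v i)) i, ?_⟩
  apply Matrix.toLin'.injective
  refine b.ext fun i => ?_
  have hpow : ∀ p : ℂ[X], (aeval D p).mulVec (v i) = p.eval (D i i) • v i := fun p => by
    induction p using Polynomial.induction_on' with
    | add p r hp hr => rw [map_add, Matrix.add_mulVec, hp, hr, eval_add, add_smul]
    | monomial n c =>
      rw [aeval_monomial, eval_monomial, Algebra.algebraMap_eq_smul_one, smul_one_mul,
        Matrix.smul_mulVec, mul_smul]
      congr 1
      induction n with
      | zero => simp
      | succ n ih => rw [pow_succ, ← Matrix.mulVec_mulVec, hDv, Matrix.mulVec_smul, ih, smul_smul,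
          pow_succ']
  rw [Matrix.toLin'_apply, Matrix.toLin'_apply, hb, hpow, hBv,
    Lagrange.eval_interpolate_at_node _ hinj.injOn (Finset.mem_univ i)]

end Commutant

/-! ### Triangularity of the lower right entry of the chain of Lax matrices -/

section Triangular

open MvPolynomial

variable {σ : Type}

lemma coeff_divZ (i : σ) (s : σ →₀ ℕ) (f : MvPolynomial σ ℂ) :
    coeff s (divZ i f) = coeff (s + Finsupp.single i 1) f := by
  classical
  induction f using MvPolynomial.induction_on' with
  | monomial t c =>
    rw [monomial_eq_smul, map_smul, coeff_smul, coeff_smul, divZ, onMonomials_monomial,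
      coeff_monomial]
    by_cases h : t i = 0
    · rw [if_pos h, if_neg, coeff_zero]
      rintro rfl
      simp at h
    · rw [if_neg h, coeff_monomial]
      congr 2
      rw [eq_iff_iff]
      have hle : Finsupp.single i 1 ≤ t := by simpa [Nat.one_le_iff_ne_zero] using h
      exact tsub_eq_iff_eq_add_of_le hle
  | add a b ha hb => rw [map_add, coeff_add, ha, hb, coeff_add]

/-- A nonzero matrix element of an entry of the Lax matrix only changes the degree in `z_k`; it is
unchanged by the lower right entry, and raised by the lower left entry. -/
lemma coeff_lax_ne_zero {q ℓ u : ℂ} {k : σ} {a b : Fin 2} {t : σ →₀ ℕ} {f : MvPolynomial σ ℂ}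
    (h : coeff t (lax q ℓ k u a b f) ≠ 0) : ∃ r, coeff r f ≠ 0 ∧ (∀ j, j ≠ k → t j = r j) ∧
      (a = 1 → b = 1 → t = r) ∧ (a = 1 → b = 0 → t k = r k + 1) := by
  classical
  revert a b
  simp only [lax_eq_laxPM, Fin.forall_fin_two, laxPM_zero_zero, laxPM_zero_one, laxPM_one_zero,
    laxPM_one_one]
  refine ⟨⟨fun h => ?_, fun h => ?_⟩, fun h => ?_, fun h => ?_⟩
  · rw [coeff_eulerFun] at h
    exact ⟨t, right_ne_zero_of_mul h, fun _ _ => rfl, by simp, by simp⟩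
  · rw [sMinus, LinearMap.neg_apply, coeff_neg, neg_ne_zero, Module.End.mul_apply, coeff_divZ,
      coeff_eulerFun] at h
    refine ⟨_, right_ne_zero_of_mul h, fun j hj => ?_, by simp, by simp⟩
    simp [hj.symm]
  · rw [Module.End.mul_apply, mulZ_apply, coeff_X_mul'] at h
    split_ifs at h with hk
    · rw [coeff_eulerFun] at h
      refine ⟨_, right_ne_zero_of_mul h, fun j hj => ?_, by simp, fun _ _ => ?_⟩
      · simp [hj.symm]
      · have := Finsupp.mem_support_iff.mp hk
        simp
        omega
    · exact absurd rfl h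
  · rw [coeff_eulerFun] at h
    exact ⟨t, right_ne_zero_of_mul h, fun _ _ => rfl, by simp, by simp⟩

variable {N : ℕ} {q : ℂ} {ℓ δ : Fin N → ℂ}

lemma coeff_prod_lax_ne_zero (v : ℂ) (L : List (Fin N)) {a b : Fin 2} {s t : Fin N →₀ ℕ}
    (h : coeff t ((L.map fun k => lax q (ℓ k) k (v + δ k)).prod a b (monomial s 1)) ≠ 0)
    {j : Fin N} (hj : j ∉ L) : t j = s j := by
  classical
  induction L generalizing a b t with
  | nil =>
    rw [List.map_nil, List.prod_nil, Matrix.one_apply] at h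
    split_ifs at h
    · rw [Module.End.one_apply, coeff_monomial] at h
      rw [of_not_not fun hne => h (if_neg hne)]
    · simp at h
  | cons k L ih =>
    rw [List.mem_cons, not_or] at hj
    rw [List.map_cons, List.prod_cons, Matrix.mul_apply, Fin.sum_univ_two, LinearMap.add_apply,
      coeff_add, Module.End.mul_apply, Module.End.mul_apply] at h
    have h' : ∃ c : Fin 2, coeff t (lax q (ℓ k) k (v + δ k) a c
        ((L.map fun k => lax q (ℓ k) k (v + δ k)).prod c b (monomial s 1))) ≠ 0 := by
      by_contra! hc
      exact h (by rw [hc 0, hc 1, add_zero])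
    obtain ⟨c, hc⟩ := h'
    obtain ⟨r, hr, h1, -, -⟩ := coeff_lax_ne_zero hc
    rw [h1 j hj.1, ih hr hj.2]

/-- The lower right entry of a product of Lax matrices is triangular with respect to the
lexicographic order of the exponents: the first site at which a term leaves the second component
raises the degree. -/
lemma coeff_prod_lax_one_one (v : ℂ) (L : List (Fin N)) (hL : L.Pairwise (· < ·))
    (s : Fin N →₀ ℕ) :
    coeff s ((L.map fun k => lax q (ℓ k) k (v + δ k)).prod 1 1 (monomial s 1)) =
      (L.map fun k => qNum q (v + δ k - (s k + ℓ k))).prod ∧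
    ∀ t, t ≠ s → coeff t ((L.map fun k => lax q (ℓ k) k (v + δ k)).prod 1 1 (monomial s 1)) ≠ 0 →
      ∃ i ∈ L, s i < t i ∧ ∀ j < i, t j = s j := by
  classical
  induction L with
  | nil =>
    refine ⟨by simp, fun t ht h => absurd ?_ h⟩
    rw [List.map_nil, List.prod_nil, Matrix.one_apply_eq, Module.End.one_apply, coeff_monomial,
      if_neg ht.symm]
  | cons k L ih =>
    rw [List.pairwise_cons] at hL
    obtain ⟨ih1, ih2⟩ := ih hL.2
    have hkL : k ∉ L := fun hk => lt_irrefl _ (hL.1 k hk)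
    have hexp : ∀ t, coeff t (((k :: L).map fun k => lax q (ℓ k) k (v + δ k)).prod 1 1
        (monomial s 1)) = coeff t (lax q (ℓ k) k (v + δ k) 1 0
          ((L.map fun k => lax q (ℓ k) k (v + δ k)).prod 0 1 (monomial s 1))) +
        qNum q (v + δ k - (t k + ℓ k)) *
          coeff t ((L.map fun k => lax q (ℓ k) k (v + δ k)).prod 1 1 (monomial s 1)) := fun t => by
      rw [List.map_cons, List.prod_cons, Matrix.mul_apply, Fin.sum_univ_two, LinearMap.add_apply,
        coeff_add, Module.End.mul_apply, Module.End.mul_apply]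
      congr 1
      exact coeff_eulerFun k (fun a => qNum q (v + δ k - (a + ℓ k))) t _
    have hraise : ∀ t, coeff t (lax q (ℓ k) k (v + δ k) 1 0
          ((L.map fun k => lax q (ℓ k) k (v + δ k)).prod 0 1 (monomial s 1))) ≠ 0 →
        t k = s k + 1 ∧ ∀ j < k, t j = s j := fun t ht => by
      obtain ⟨r, hr, h1, -, h3⟩ := coeff_lax_ne_zero ht
      refine ⟨by rw [h3 rfl rfl, coeff_prod_lax_ne_zero v L hr hkL], fun j hj => ?_⟩
      rw [h1 j hj.ne, coeff_prod_lax_ne_zero v L hr fun hjL => lt_asymm hj (hL.1 j hjL)]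
    constructor
    · rw [hexp, of_not_not fun hne => (Nat.lt_succ_self (s k)).ne (hraise s hne).1, zero_add, ih1,
        List.map_cons, List.prod_cons]
    · intro t hts ht
      rw [hexp] at ht
      by_cases h0 : coeff t (lax q (ℓ k) k (v + δ k) 1 0
          ((L.map fun k => lax q (ℓ k) k (v + δ k)).prod 0 1 (monomial s 1))) = 0
      · rw [h0, zero_add] at ht
        obtain ⟨i, hi, h⟩ := ih2 t hts (right_ne_zero_of_mul ht)
        exact ⟨i, List.mem_cons_of_mem _ hi, h⟩
      · obtain ⟨h1, h2⟩ := hraise t h0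
        exact ⟨k, List.mem_cons_self, by omega, h2⟩

lemma coeff_chainLax_one_one_self (v : ℂ) (s : Fin N →₀ ℕ) :
    coeff s (chainLax id q ℓ δ v 1 1 (monomial s 1)) =
      ∏ k, qNum q (v + δ k - (s k + ℓ k)) := by
  rw [chainLax, List.ofFn_eq_map, ← prod_finRange]
  exact (coeff_prod_lax_one_one v _ (List.pairwise_lt_finRange N) s).1

lemma coeff_chainLax_one_one_eq_zero (v : ℂ) {s t : Fin N →₀ ℕ} (h : toLex t < toLex s) :
    coeff t (chainLax id q ℓ δ v 1 1 (monomial s 1)) = 0 := by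
  by_contra hne
  rw [chainLax, List.ofFn_eq_map] at hne
  obtain ⟨i, -, hi, hj⟩ := (coeff_prod_lax_one_one v _ (List.pairwise_lt_finRange N) s).2 t
    (fun hts => by rw [hts] at h; exact lt_irrefl _ h) hne
  have : toLex s < toLex t := Finsupp.Lex.lt_iff.mpr ⟨i, fun j hji => (hj j hji).symm, hi⟩
  exact lt_asymm h this

end Triangular

/-! ### Commutativity of the graded operators -/

section Blocks

open MvPolynomial Filter Topology

variable {N : ℕ}

/-- The exponents of total degree `n`, ordered lexicographically. -/
def DegIndex (N n : ℕ) : Type :=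
  {x : Lex (Fin N →₀ ℕ) // x ∈ (degFinset N n).map toLex.toEmbedding}

instance (N n : ℕ) : Fintype (DegIndex N n) :=
  Finset.Subtype.fintype ((degFinset N n).map toLex.toEmbedding)

instance (N n : ℕ) : LinearOrder (DegIndex N n) :=
  Subtype.instLinearOrder fun x : Lex (Fin N →₀ ℕ) => x ∈ (degFinset N n).map toLex.toEmbedding

lemma DegIndex.degree {n : ℕ} (s : DegIndex N n) : (ofLex s.1).degree = n := by
  obtain ⟨r, hr, h⟩ := Finset.mem_map.mp s.2
  rw [← h]
  exact mem_degFinset.mp hr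

/-- The exponent `s` as an index of its degree. -/
def DegIndex.of (s : Fin N →₀ ℕ) {n : ℕ} (h : s.degree = n) : DegIndex N n :=
  ⟨toLex s, Finset.mem_map.mpr ⟨s, mem_degFinset.mpr h, rfl⟩⟩

/-- The matrix of an operator on the polynomials of degree `n`. -/
def degBlock (n : ℕ) (A : Op (Fin N)) : Matrix (DegIndex N n) (DegIndex N n) ℂ :=
  Matrix.of fun t s => coeff (ofLex t.1) (A (monomial (ofLex s.1) 1))

lemma degBlock_add (n : ℕ) (A B : Op (Fin N)) : degBlock n (A + B) = degBlock n A + degBlock n B :=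
  Matrix.ext fun t s => by
    simp only [degBlock, Matrix.of_apply, Matrix.add_apply, LinearMap.add_apply, coeff_add]

lemma degBlock_sum (n : ℕ) {ι : Type*} (T : Finset ι) (F : ι → Op (Fin N)) :
    degBlock n (∑ i ∈ T, F i) = ∑ i ∈ T, degBlock n (F i) := Matrix.ext fun t s => by
  simp only [degBlock, Matrix.of_apply, Matrix.sum_apply, LinearMap.sum_apply, coeff_sum]

lemma degBlock_mul (n : ℕ) (A : Op (Fin N)) {B : Op (Fin N)} (hB : Commute B (degOp _)) :
    degBlock n (A * B) = degBlock n A * degBlock n B := Matrix.ext fun t s => by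
  rw [Matrix.mul_apply]
  simp only [degBlock, Matrix.of_apply]
  rw [coeff_mul_monomial A hB, s.degree]
  refine Eq.trans ?_ (Finset.sum_coe_sort ((degFinset N n).map toLex.toEmbedding)
    fun r => coeff (ofLex t.1) (A (monomial (ofLex r) 1)) *
      coeff (ofLex r) (B (monomial (ofLex s.1) 1))).symm
  rw [Finset.sum_map]
  rfl

lemma op_ext_degBlock {A B : Op (Fin N)} (hA : Commute A (degOp _)) (hB : Commute B (degOp _))
    (h : ∀ n, degBlock n A = degBlock n B) : A = B :=
  op_ext fun s => MvPolynomial.ext _ _ fun t => by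
    by_cases hts : t.degree = s.degree
    · exact congrFun (congrFun (h s.degree) (DegIndex.of t hts)) (DegIndex.of s rfl)
    · rw [not_not.mp fun hne => hts (degree_eq_of_mem_support hA hne),
        not_not.mp fun hne => hts (degree_eq_of_mem_support hB hne)]

variable {q : ℂ} {ℓ δ : Fin N → ℂ}

/-- The zeros of the diagonal matrix elements of the lower right entry of the chain of Lax matrices
at different sites never coincide. -/
def Separated (q : ℂ) (ℓ δ : Fin N → ℂ) : Prop :=
  ∀ j k, j ≠ k → ∀ m : ℤ, q ^ (2 * (ℓ k - δ k - ℓ j + δ j + m)) ≠ 1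

/-- The matrix element `∏_k [v + δ_k - s_k - ℓ_k]_q`, up to a factor depending only on `v` and the
degree of `s`, as a polynomial in `q^(2v)`. -/
def diagPoly (q : ℂ) (ℓ δ : Fin N → ℂ) (s : Fin N →₀ ℕ) : Polynomial ℂ :=
  ∏ k, (Polynomial.C (q ^ (2 * (δ k - (s k + ℓ k)))) * Polynomial.X - 1)

lemma cpow_two_mul_intCast_ne_one (hq : ∀ n : ℕ, 0 < n → q ^ n ≠ 1) {m : ℤ} (hm : m ≠ 0) :
    q ^ (2 * (m : ℂ)) ≠ 1 := by
  rw [show 2 * (m : ℂ) = ((2 * m : ℤ) : ℂ) by push_cast; ring, Complex.cpow_intCast]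
  obtain ⟨n, hn | hn⟩ := Int.eq_nat_or_neg (2 * m)
  · rw [hn, zpow_natCast]
    exact hq n (by omega)
  · rw [hn, zpow_neg, zpow_natCast, Ne, inv_eq_one]
    exact hq n (by omega)

/-- For separated inhomogeneities the polynomial determines the exponent, as no zero can come from
factors at two different sites. -/
lemma diagPoly_injective (hq0 : q ≠ 0) (hq : ∀ n : ℕ, 0 < n → q ^ n ≠ 1)
    (hsep : Separated q ℓ δ) : Function.Injective (diagPoly q ℓ δ) := by
  intro s t hst
  by_contra hne
  obtain ⟨k, hk⟩ : ∃ k, s k ≠ t k := by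
    by_contra! h
    exact hne (Finsupp.ext h)
  -- evaluate at a zero of the `k`-th factor of the first polynomial
  have h0 : (diagPoly q ℓ δ s).eval (q ^ (-(2 * (δ k - (s k + ℓ k))))) = 0 := by
    rw [diagPoly, Polynomial.eval_prod]
    refine Finset.prod_eq_zero (Finset.mem_univ k) ?_
    simp [← Complex.cpow_add _ _ hq0]
  rw [hst, diagPoly, Polynomial.eval_prod, Finset.prod_eq_zero_iff] at h0
  obtain ⟨j, -, hj⟩ := h0
  simp only [Polynomial.eval_sub, Polynomial.eval_mul, Polynomial.eval_C, Polynomial.eval_X,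
    Polynomial.eval_one, ← Complex.cpow_add _ _ hq0, sub_eq_zero] at hj
  by_cases hjk : j = k
  · subst hjk
    refine cpow_two_mul_intCast_ne_one hq (m := (s j : ℤ) - t j) (by omega) ?_
    rw [← hj]
    congr 1
    push_cast
    ring
  · refine hsep j k hjk ((s k : ℤ) - t j) ?_
    rw [← hj]
    congr 1
    push_cast
    ring

lemma cpow_sum (hq0 : q ≠ 0) (c : Fin N → ℂ) : q ^ (∑ k, c k) = ∏ k, q ^ c k := by
  rw [Complex.cpow_def_of_ne_zero hq0, Finset.mul_sum, Complex.exp_sum]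
  simp only [Complex.cpow_def_of_ne_zero hq0]

lemma prod_qNum_eq (hq0 : q ≠ 0) (v : ℂ) (s : Fin N →₀ ℕ) :
    ∏ k, qNum q (v + δ k - (s k + ℓ k)) =
      ((q - q⁻¹)⁻¹ ^ N * (q ^ (N * v + ∑ k, (δ k - ℓ k) - s.degree))⁻¹) *
        (diagPoly q ℓ δ s).eval (q ^ (2 * v)) := by
  have h : ∀ k, qNum q (v + δ k - (s k + ℓ k)) = (q - q⁻¹)⁻¹ *
      (q ^ (v + δ k - (s k + ℓ k)))⁻¹ * (q ^ (2 * (δ k - (s k + ℓ k))) * q ^ (2 * v) - 1) :=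
    fun k => by
    rw [qNum_eq, ← Complex.cpow_add _ _ hq0, show 2 * (δ k - (s k + ℓ k)) + 2 * v =
      (v + δ k - (s k + ℓ k)) + (v + δ k - (s k + ℓ k)) by ring, Complex.cpow_add _ _ hq0]
    have := cpow_ne_zero' hq0 (v + δ k - (s k + ℓ k))
    generalize (q - q⁻¹)⁻¹ = κ
    field_simp
  have hsum : (N * v + ∑ k, (δ k - ℓ k) - s.degree : ℂ) = ∑ k, (v + δ k - (s k + ℓ k)) := by
    rw [Finsupp.degree_eq_sum]
    simp only [Finset.sum_sub_distrib, Finset.sum_add_distrib, Finset.sum_const, Finset.card_univ,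
      Fintype.card_fin, nsmul_eq_mul, Nat.cast_sum]
    ring
  simp only [h, Finset.prod_mul_distrib, Finset.prod_const, Finset.card_univ, Fintype.card_fin,
    Finset.prod_inv_distrib]
  rw [hsum, cpow_sum hq0, diagPoly, Polynomial.eval_prod]
  simp

/-- For separated inhomogeneities there is a spectral parameter at which the diagonal matrix elements of
the lower right entry are distinct in degree `n`: choose `q^(2v)` off the zeros of the differences of
the polynomials `diagPoly`. -/
lemma exists_injective_diagonal (hq0 : q ≠ 0) (hq : ∀ n : ℕ, 0 < n → q ^ n ≠ 1)
    (hsep : Separated q ℓ δ) (n : ℕ) : ∃ v, ∀ s t : Fin N →₀ ℕ, s.degree = n → t.degree = n →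
      ∏ k, qNum q (v + δ k - (s k + ℓ k)) = ∏ k, qNum q (v + δ k - (t k + ℓ k)) → s = t := by
  classical
  let P : Polynomial ℂ := Polynomial.X * ∏ x ∈ (degFinset N n ×ˢ degFinset N n).filter
    (fun x => x.1 ≠ x.2), (diagPoly q ℓ δ x.1 - diagPoly q ℓ δ x.2)
  have hP : P ≠ 0 := mul_ne_zero Polynomial.X_ne_zero <| Finset.prod_ne_zero_iff.mpr fun x hx =>
    sub_ne_zero.mpr fun h => (Finset.mem_filter.mp hx).2 (diagPoly_injective hq0 hq hsep h)
  obtain ⟨y, hy⟩ : ∃ y, P.eval y ≠ 0 := by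
    by_contra! h
    exact hP (Polynomial.zero_of_eval_zero P h)
  rw [Polynomial.eval_mul, Polynomial.eval_X, Polynomial.eval_prod] at hy
  have hy0 : y ≠ 0 := left_ne_zero_of_mul hy
  have hlog : Complex.log q ≠ 0 := fun h => hq 1 one_pos (by
    rw [pow_one, ← Complex.exp_log hq0, h, Complex.exp_zero])
  refine ⟨Complex.log y / (2 * Complex.log q), fun s t hs ht h => ?_⟩
  have hv : q ^ (2 * (Complex.log y / (2 * Complex.log q))) = y := by
    rw [Complex.cpow_def_of_ne_zero hq0, show Complex.log q * (2 * (Complex.log y /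
      (2 * Complex.log q))) = Complex.log y by field_simp, Complex.exp_log hy0]
  rw [prod_qNum_eq hq0, prod_qNum_eq hq0, hs, ht, hv] at h
  have hκ : (q - q⁻¹)⁻¹ ≠ 0 := inv_ne_zero fun h => hq 2 two_pos (by
    rw [sub_eq_zero] at h
    rw [pow_two]
    nth_rewrite 1 [h]
    exact inv_mul_cancel₀ hq0)
  have h' := mul_left_cancel₀ (mul_ne_zero (pow_ne_zero _ hκ)
    (inv_ne_zero (cpow_ne_zero' hq0 _))) h
  by_contra hne
  refine Finset.prod_ne_zero_iff.mp (right_ne_zero_of_mul hy) (s, t) ?_ ?_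
  · exact Finset.mem_filter.mpr ⟨Finset.mem_product.mpr ⟨mem_degFinset.mpr hs,
      mem_degFinset.mpr ht⟩, hne⟩
  · rw [Polynomial.eval_sub, h', sub_self]

/-- The graded commutativity with the transfer matrix, as a commutativity of formal power series: the
generating series of the terms of `Q` commutes with the pencil formed by the diagonal entries of the
chain of Lax matrices. -/
lemma degBlock_chainQ_commute (hq0 : q ≠ 0) (hq : ∀ n : ℕ, 0 < n → q ^ n ≠ 1)
    (hℓ : ∀ (k : Fin N) (j : ℕ), q ^ (4 * ℓ k + 2 * j) ≠ 1) {u₁ : ℂ} (u₂ v : ℂ)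
    (h1 : Regular q ℓ δ u₁) (n : ℕ) :
    Commute (PowerSeries.mk fun d => degBlock n (chainQ q ℓ δ u₁ u₂ d))
      (PowerSeries.C (degBlock n (chainLax id q ℓ δ v 1 1)) +
        PowerSeries.X * PowerSeries.C (degBlock n (chainLax id q ℓ δ v 0 0))) := by
  obtain ⟨hrel, hrel0⟩ := chainQ_mul_chainLax (δ := δ) hq0 hq hℓ u₂ v h1
  obtain ⟨hA, hD⟩ := commute_chainLax_degOp q ℓ δ v
  have hQ := commute_chainQ_degOp q ℓ δ u₁ u₂
  refine PowerSeries.ext fun d => ?_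
  rw [mul_add, add_mul, ← mul_assoc, mul_assoc PowerSeries.X]
  cases d with
  | zero =>
    have := congrArg (degBlock n) hrel0
    rw [degBlock_mul n _ hD, degBlock_mul n _ (hQ 0)] at this
    simpa using this
  | succ d =>
    have := congrArg (degBlock n) (hrel d)
    rw [degBlock_add, degBlock_add, degBlock_mul n _ hD, degBlock_mul n _ hA,
      degBlock_mul n _ (hQ _), degBlock_mul n _ (hQ _)] at this
    rw [map_add, map_add, PowerSeries.coeff_mul_C, PowerSeries.coeff_mul_C, PowerSeries.coeff_C_mul,
      PowerSeries.coeff_succ_mul_X, PowerSeries.coeff_succ_X_mul, PowerSeries.coeff_C_mul,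
      PowerSeries.coeff_mk, PowerSeries.coeff_mk, add_comm, this, add_comm]

/-- Commutativity of the operators `Q`, graded by the degree in `z₀`, for separated
inhomogeneities. -/
lemma sum_antidiagonal_chainQ_comm_of_separated (hq0 : q ≠ 0) (hq : ∀ n : ℕ, 0 < n → q ^ n ≠ 1)
    (hℓ : ∀ (k : Fin N) (j : ℕ), q ^ (4 * ℓ k + 2 * j) ≠ 1) {u₁ v₁ : ℂ} (u₂ v₂ : ℂ)
    (hu : Regular q ℓ δ u₁) (hv : Regular q ℓ δ v₁) (hsep : Separated q ℓ δ) (d : ℕ) :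
    ∑ x ∈ Finset.HasAntidiagonal.antidiagonal d,
        chainQ q ℓ δ u₁ u₂ x.1 * chainQ q ℓ δ v₁ v₂ x.2 =
      ∑ x ∈ Finset.HasAntidiagonal.antidiagonal d,
        chainQ q ℓ δ v₁ v₂ x.1 * chainQ q ℓ δ u₁ u₂ x.2 := by
  have hQ := commute_chainQ_degOp q ℓ δ u₁ u₂
  have hQ' := commute_chainQ_degOp q ℓ δ v₁ v₂
  refine op_ext_degBlock (Commute.sum_left _ _ _ fun x _ => (hQ _).mul_left (hQ' _))
    (Commute.sum_left _ _ _ fun x _ => (hQ' _).mul_left (hQ _)) fun n => ?_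
  obtain ⟨v, hinj⟩ := exists_injective_diagonal hq0 hq hsep n
  have hD : ∀ B, Commute B (degBlock n (chainLax id q ℓ δ v 1 1)) →
      ∃ p, B = Polynomial.aeval (degBlock n (chainLax id q ℓ δ v 1 1)) p := fun B hB => by
    refine exists_eq_aeval_of_commute (fun t s hts => ?_) (fun s t hst => ?_) hB
    · exact coeff_chainLax_one_one_eq_zero v hts
    · simp only [degBlock, Matrix.of_apply, coeff_chainLax_one_one_self] at hst
      exact Subtype.ext (hinj _ _ s.degree t.degree hst)
  have key := powerSeries_commute_of_commute_pencil hD _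
    (degBlock_chainQ_commute hq0 hq hℓ u₂ v hu n) (degBlock_chainQ_commute hq0 hq hℓ v₂ v hv n)
  have := congrArg (PowerSeries.coeff d) key.eq
  rw [PowerSeries.coeff_mul, PowerSeries.coeff_mul] at this
  simpa only [PowerSeries.coeff_mk, degBlock_sum, degBlock_mul n _ (hQ _),
    degBlock_mul n _ (hQ' _)] using this

lemma opTendsto_sum {X σ ι : Type} {l : Filter X} (T : Finset ι) {F : ι → X → Op σ} {A : ι → Op σ}
    (h : ∀ i ∈ T, OpTendsto (F i) l (A i)) :
    OpTendsto (fun x => ∑ i ∈ T, F i x) l (∑ i ∈ T, A i) := fun Ψ => by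
  simp only [LinearMap.sum_apply]
  exact PolyTendsto.sum T fun i hi => h i hi Ψ

/-- The inhomogeneities `δ_k + (k + 1) ε` are separated for all but countably many `ε`, as the
factors `k + 1` are pairwise different. -/
lemma countable_not_separated (hq0 : q ≠ 0) (hq1 : q ≠ 1) (ℓ δ : Fin N → ℂ) :
    {ε : ℂ | ¬ Separated q ℓ fun k => δ k + (k + 1 : ℕ) * ε}.Countable := by
  have h : ∀ j k : Fin N, ∀ m : ℤ, {ε : ℂ | j ≠ k ∧ q ^ (2 * (ℓ k - δ k - ℓ j + δ j + m) +
      2 * ((j : ℂ) - k) * ε) = 1}.Countable := fun j k m => by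
    by_cases hjk : j = k
    · simp [hjk]
    · refine (countable_cpow_eq_one hq0 hq1 (2 * (ℓ k - δ k - ℓ j + δ j + m))
        (b := 2 * ((j : ℂ) - k)) (mul_ne_zero two_ne_zero (sub_ne_zero.mpr fun h => hjk
          (Fin.ext (by exact_mod_cast h))))).mono fun ε hε => hε.2
  refine (Set.countable_iUnion fun j => Set.countable_iUnion fun k =>
    Set.countable_iUnion fun m => h j k m).mono fun ε hε => ?_
  simp only [Separated, Set.mem_ofPred_eq, not_forall, not_not] at hε
  obtain ⟨j, k, hjk, m, hm⟩ := hε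
  refine Set.mem_iUnion.mpr ⟨j, Set.mem_iUnion.mpr ⟨k, Set.mem_iUnion.mpr ⟨m, hjk, ?_⟩⟩⟩
  rw [← hm]
  congr 1
  push_cast
  ring

/-- A fixed `u₁` stays regular for all but countably many `ε`, as the factors `k + 1` do not vanish. -/
lemma countable_not_regular (hq0 : q ≠ 0) (hq1 : q ≠ 1) (ℓ δ : Fin N → ℂ) (u₁ : ℂ) :
    {ε : ℂ | ¬ Regular q ℓ (fun k => δ k + (k + 1 : ℕ) * ε) u₁}.Countable := by
  have h : ∀ (k : Fin N) (j : ℕ), {ε : ℂ | q ^ (2 + 2 * ℓ k - 2 * u₁ - 2 * δ k + 2 * j +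
      (-2 * ((k + 1 : ℕ) : ℂ)) * ε) = 1}.Countable := fun k j =>
    countable_cpow_eq_one hq0 hq1 _
      (mul_ne_zero (neg_ne_zero.mpr two_ne_zero) (Nat.cast_ne_zero.mpr k.val.succ_ne_zero))
  refine (Set.countable_iUnion fun k => Set.countable_iUnion fun j => h k j).mono fun ε hε => ?_
  simp only [Regular, Set.mem_ofPred_eq, not_forall, not_not] at hε
  obtain ⟨k, j, hm⟩ := hε
  refine Set.mem_iUnion.mpr ⟨k, Set.mem_iUnion.mpr ⟨j, ?_⟩⟩
  rw [Set.mem_ofPred_eq, ← hm]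
  congr 1
  ring

/-- Commutativity of the operators `Q`, graded by the degree in `z₀`. It holds for separated
inhomogeneities, and extends to all of them by continuity. -/
theorem sum_antidiagonal_chainQ_comm (hq0 : q ≠ 0) (hq : ∀ n : ℕ, 0 < n → q ^ n ≠ 1)
    (hℓ : ∀ (k : Fin N) (j : ℕ), q ^ (4 * ℓ k + 2 * j) ≠ 1) {u₁ v₁ : ℂ} (u₂ v₂ : ℂ)
    (hu : Regular q ℓ δ u₁) (hv : Regular q ℓ δ v₁) (d : ℕ) :
    ∑ x ∈ Finset.HasAntidiagonal.antidiagonal d,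
        chainQ q ℓ δ u₁ u₂ x.1 * chainQ q ℓ δ v₁ v₂ x.2 =
      ∑ x ∈ Finset.HasAntidiagonal.antidiagonal d,
        chainQ q ℓ δ v₁ v₂ x.1 * chainQ q ℓ δ u₁ u₂ x.2 := by
  have hq1 : q ≠ 1 := by simpa using hq 1 one_pos
  obtain ⟨l, hl, hlv, hgen⟩ := exists_filter_of_countable_compl
    (((countable_not_separated hq0 hq1 ℓ δ).union (countable_not_regular hq0 hq1 ℓ δ u₁)).union
      (countable_not_regular hq0 hq1 ℓ δ v₁)) 0
  have hδ : ∀ k : Fin N, Tendsto (fun ε : ℂ => δ k + ((k + 1 : ℕ) : ℂ) * ε) l (𝓝 (δ k)) :=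
    fun k => by
    have h : Tendsto (fun ε : ℂ => δ k + ((k + 1 : ℕ) : ℂ) * ε) (𝓝 0)
        (𝓝 (δ k + ((k + 1 : ℕ) : ℂ) * 0)) := (Continuous.tendsto (by fun_prop) 0)
    rw [mul_zero, add_zero] at h
    exact h.mono_left hlv
  have hQ : ∀ {w₁ : ℂ} (w₂ : ℂ) (e : ℕ), Regular q ℓ δ w₁ → OpTendsto
      (fun ε : ℂ => chainQ q ℓ (fun k => δ k + ((k + 1 : ℕ) : ℂ) * ε) w₁ w₂ e) l
      (chainQ q ℓ δ w₁ w₂ e) := fun w₂ e hw =>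
    (opTendsto_chainR hq0 hℓ w₂ hw (δ' := fun ε k => δ k + ((k + 1 : ℕ) : ℂ) * ε) hδ).auxCoeff e e
  refine OpTendsto.unique (l := l)
    (opTendsto_sum _ fun x _ => (hQ u₂ x.1 hu).mul (hQ v₂ x.2 hv))
    (opTendsto_sum _ fun x _ => (hQ v₂ x.1 hv).mul (hQ u₂ x.2 hu)) (hgen.mono fun ε hε => ?_)
  simp only [Set.mem_union, Set.mem_ofPred_eq, not_or, not_not] at hε
  exact sum_antidiagonal_chainQ_comm_of_separated hq0 hq hℓ u₂ v₂ hε.1.2 hε.2 hε.1.1 d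

/-- The operators `Q` commute. -/
theorem baxterQ_mul_baxterQ (hq0 : q ≠ 0) (hq : ∀ n : ℕ, 0 < n → q ^ n ≠ 1)
    (hℓ : ∀ (k : Fin N) (j : ℕ), q ^ (4 * ℓ k + 2 * j) ≠ 1) {u₁ u₂ v₁ v₂ : ℂ}
    (hu : (u₁, u₂) ∈ domainQ q ℓ δ) (hv : (v₁, v₂) ∈ domainQ q ℓ δ) :
    baxterQ q ℓ δ u₁ u₂ * baxterQ q ℓ δ v₁ v₂ = baxterQ q ℓ δ v₁ v₂ * baxterQ q ℓ δ u₁ u₂ := by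
  have h1 := (hasOpSum_baxterQ hu).mul (hasOpSum_baxterQ hv) (commute_chainQ_degOp q ℓ δ v₁ v₂)
  have h2 := (hasOpSum_baxterQ hv).mul (hasOpSum_baxterQ hu) (commute_chainQ_degOp q ℓ δ u₁ u₂)
  simp only [sum_antidiagonal_chainQ_comm hq0 hq hℓ u₂ v₂ (mem_domainQ.mp hu).1
    (mem_domainQ.mp hv).1] at h1
  exact h1.unique h2

end Blocks

/-! ### Growth of the matrix elements in the auxiliary space -/

section Growth

open MvPolynomial Filter Topology

/-- A sequence whose ratios of consecutive terms converge grows at most geometrically. -/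
lemma exists_bound_of_ratio {g c : ℕ → ℂ} {c₀ : ℂ} {r : ℝ} (hg : ∀ n, g (n + 1) = c n * g n)
    (hc : Tendsto c atTop (𝓝 c₀)) (hr : ‖c₀‖ < r) : ∃ C, ∀ n, ‖g n‖ ≤ C * r ^ n := by
  have hr0 : 0 < r := (norm_nonneg _).trans_lt hr
  obtain ⟨M, hM⟩ := eventually_atTop.mp (hc.norm.eventually_le_const hr)
  have h1 : ∀ n, ‖g (M + n)‖ ≤ ‖g M‖ / r ^ M * r ^ (M + n) := fun n => by
    induction n with
    | zero => rw [add_zero, div_mul_cancel₀ _ (pow_ne_zero _ hr0.ne')]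
    | succ n ih =>
      rw [← add_assoc, hg, norm_mul, pow_succ, ← mul_assoc, mul_comm]
      exact mul_le_mul ih (hM _ (Nat.le_add_right _ _)) (norm_nonneg _) (by positivity)
  refine ⟨‖g M‖ / r ^ M + ∑ n ∈ Finset.range M, ‖g n‖ / r ^ n, fun n => ?_⟩
  rw [add_mul]
  rcases lt_or_ge n M with h | h
  · refine le_add_of_nonneg_of_le (by positivity) ?_
    calc ‖g n‖ = ‖g n‖ / r ^ n * r ^ n := (div_mul_cancel₀ _ (pow_ne_zero _ hr0.ne')).symm
      _ ≤ _ := by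
        gcongr
        exact Finset.single_le_sum (f := fun n => ‖g n‖ / r ^ n) (fun _ _ => by positivity)
          (Finset.mem_range.mpr h)
  · obtain ⟨n, rfl⟩ := Nat.exists_eq_add_of_le h
    exact (h1 n).trans (le_add_of_nonneg_right (by positivity))

/-- The ratio of consecutive coefficients of `ℛ⁻_ij`. -/
lemma rCoeff_succ {p α β : ℂ} (hp : ∀ n : ℕ, 0 < n → p ^ n ≠ 1)
    (hC : ∀ n, qPoch (α ^ 2 * β ^ 2) p n ≠ 0) (m b : ℕ) :
    rCoeff p α β m (b + 1) = α * ((1 - p ^ b * p ^ (m + 1)) * (1 - p ^ b * β ^ 2) /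
      ((1 - p ^ b * (p ^ m * (α ^ 2 * β ^ 2))) * (1 - p ^ b * p))) * rCoeff p α β m b := by
  have h1 := hC (m + b + 1)
  rw [qPoch_succ] at h1
  have h2 : qCoeff p (β ^ 2) (b + 1) =
      qCoeff p (β ^ 2) b * ((1 - p ^ b * β ^ 2) / (1 - p ^ b * p)) := by
    have h := qCoeff_succ hp (β ^ 2) b
    have h0 : 1 - p ^ b * p ≠ 0 := by
      rw [← pow_succ]; exact sub_ne_zero.mpr (hp (b + 1) b.succ_pos).symm
    rw [pow_succ p] at h
    rw [← mul_div_assoc, eq_div_iff h0, h]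
  have h3 : qNorm p (α ^ 2 * β ^ 2) (m + b + 1) = qNorm p (α ^ 2 * β ^ 2) (m + b) *
      ((1 - p ^ b * p ^ (m + 1)) / (1 - p ^ b * (p ^ m * (α ^ 2 * β ^ 2)))) := by
    rw [qNorm, qNorm, qPoch_succ, qPoch_succ, div_mul_div_comm]
    congr 2 <;> ring
  rw [rCoeff, rCoeff, ← add_assoc, h2, h3, mul_div_mul_comm]
  ring

lemma tendsto_one_sub_div {p x y : ℂ} (hp : ‖p‖ < 1) :
    Tendsto (fun b : ℕ => (1 - p ^ b * x) / (1 - p ^ b * y)) atTop (𝓝 1) := by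
  have h : ∀ z : ℂ, Tendsto (fun b : ℕ => 1 - p ^ b * z) atTop (𝓝 1) := fun z => by
    simpa using ((tendsto_pow_atTop_nhds_zero_of_norm_lt_one hp).mul_const z).const_sub 1
  have h1 := (h x).div (h y) one_ne_zero
  rw [div_one] at h1
  exact h1

lemma tendsto_one_sub_div' {p x y : ℂ} (hp : 1 < ‖p‖) (hy : y ≠ 0) :
    Tendsto (fun b : ℕ => (1 - p ^ b * x) / (1 - p ^ b * y)) atTop (𝓝 (x / y)) := by
  have hp0 : p ≠ 0 := fun h => by simp [h] at hp; linarith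
  have h0 : Tendsto (fun b : ℕ => (p⁻¹) ^ b) atTop (𝓝 0) :=
    tendsto_pow_atTop_nhds_zero_of_norm_lt_one (by rw [norm_inv]; exact inv_lt_one_of_one_lt₀ hp)
  have h : ∀ z : ℂ, Tendsto (fun b : ℕ => (p⁻¹) ^ b - z) atTop (𝓝 (-z)) := fun z => by
    simpa using h0.sub_const z
  have h1 := (h x).div (h y) (neg_ne_zero.mpr hy)
  rw [neg_div_neg_eq] at h1
  refine h1.congr fun b => ?_
  have hz : ∀ z, p ^ b * (p⁻¹ ^ b - z) = 1 - p ^ b * z := fun z => by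
    rw [mul_sub, ← mul_pow, mul_inv_cancel₀ hp0, one_pow]
  rw [Pi.div_apply, ← hz, ← hz, mul_div_mul_left _ _ (pow_ne_zero b hp0)]

/-- The ratios in `rCoeff_succ` tend to `α` if `|p| < 1` and to `α⁻¹` if `|p| > 1`. -/
lemma exists_rCoeff_bound {p α β : ℂ} (hp : ∀ n : ℕ, 0 < n → p ^ n ≠ 1) (hp0 : p ≠ 0) (hα : α ≠ 0)
    (hβ : β ≠ 0) (hC : ∀ n, qPoch (α ^ 2 * β ^ 2) p n ≠ 0) {r : ℝ}
    (hr : (‖p‖ < 1 ∧ ‖α‖ < r) ∨ (1 < ‖p‖ ∧ ‖α⁻¹‖ < r)) (m : ℕ) :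
    ∃ C, 0 ≤ C ∧ ∀ b, ‖rCoeff p α β m b‖ ≤ C * r ^ (m + b) := by
  have hr0 : 0 < r := by
    rcases hr with ⟨-, h⟩ | ⟨-, h⟩ <;> exact (norm_nonneg _).trans_lt h
  obtain ⟨C, h⟩ : ∃ C, ∀ b, ‖rCoeff p α β m b‖ ≤ C * r ^ b := by
    rcases hr with ⟨h1, h2⟩ | ⟨h1, h2⟩
    · refine exists_bound_of_ratio (rCoeff_succ hp hC m) (c₀ := α) ?_ h2
      simp only [mul_div_mul_comm]
      simpa using ((tendsto_one_sub_div h1).mul (tendsto_one_sub_div h1)).const_mul α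
    · refine exists_bound_of_ratio (rCoeff_succ hp hC m) (c₀ := α⁻¹) ?_ h2
      simp only [mul_div_mul_comm]
      have hy : p ^ m * (α ^ 2 * β ^ 2) ≠ 0 := by positivity
      have := ((tendsto_one_sub_div' h1 (x := p ^ (m + 1)) hy).mul
        (tendsto_one_sub_div' h1 (x := β ^ 2) hp0)).const_mul α
      convert this using 2
      field_simp
      ring
  refine ⟨max C 0 / r ^ m, by positivity, fun b => (h b).trans ?_⟩
  rw [pow_add, ← mul_assoc, div_mul_cancel₀ _ (pow_ne_zero _ hr0.ne')]
  gcongr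
  exact le_max_left _ _

variable {σ : Type} {q : ℂ} {i j : σ}

/-- `ℛ⁻_ij` on monomials. -/
lemma Rminus_monomial (hq0 : q ≠ 0) (hq : ∀ n : ℕ, 0 < n → q ^ n ≠ 1) (hij : i ≠ j)
    {up um : ℂ} (vm : ℂ) (hC : NoPole q up um) (s : σ →₀ ℕ) :
    Rminus q i j up um vm (monomial s 1) = ∑ x ∈ Finset.HasAntidiagonal.antidiagonal (s i),
      rCoeff (q ^ 2) (q ^ (up - vm)) (q ^ (vm - um)) x.1 x.2 •
        monomial (s.erase i + Finsupp.single i x.1 + Finsupp.single j x.2) 1 := by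
  have hs : (monomial s (1 : ℂ)) = monomial (s.erase i) 1 * X i ^ s i := by
    rw [X_pow_eq_monomial, monomial_mul, one_mul, Finsupp.erase_add_single]
  have hsupp : (monomial (s.erase i) (1 : ℂ)) ∈ supported ℂ ({i}ᶜ : Set σ) := by
    rw [mem_supported, vars_monomial one_ne_zero]
    intro k hk
    rw [Set.mem_compl_singleton_iff]
    rintro rfl
    simp at hk
  rw [hs, apply_mul_of_commute (S := {i}) (LinearAway.Rminus q j up um vm) hsupp,
    Rminus_X_pow_eq_sum hq0 (sq_pow_ne_one hq) hij up um vm (hC.qPoch_ne_zero hq0 vm),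
    Finset.mul_sum]
  refine Finset.sum_congr rfl fun x _ => ?_
  rw [mul_smul_comm, X_pow_eq_monomial, X_pow_eq_monomial, monomial_mul, monomial_mul, one_mul,
    one_mul, add_assoc]

/-- The exponent of `z^s` after an application of `ℛ⁻_ij` that leaves `z_i` with degree `x.1` and
adds `x.2` to the degree in `z_j`. -/
def transferExp (i j : σ) (x : ℕ × ℕ) (s : σ →₀ ℕ) : σ →₀ ℕ :=
  s.erase i + Finsupp.single i x.1 + Finsupp.single j x.2

lemma transferExp_left (hij : i ≠ j) (x : ℕ × ℕ) (s : σ →₀ ℕ) : transferExp i j x s i = x.1 := by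
  simp [transferExp, hij.symm]

lemma transferExp_right (hij : i ≠ j) (x : ℕ × ℕ) (s : σ →₀ ℕ) :
    transferExp i j x s j = s j + x.2 := by
  simp [transferExp, hij.symm]

lemma transferExp_of_ne {k : σ} (hi : k ≠ i) (hj : k ≠ j) (x : ℕ × ℕ) (s : σ →₀ ℕ) :
    transferExp i j x s k = s k := by
  simp [transferExp, hi, hj]

variable [DecidableEq σ]

/-- The local operator `ℝ_{k0}` on monomials. -/
lemma siteR_monomial (hq0 : q ≠ 0) (hq : ∀ n : ℕ, 0 < n → q ^ n ≠ 1) (hij : i ≠ j)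
    {ℓ δ u₁ : ℂ} (u₂ : ℂ) (h1 : NoPole q (δ + ℓ) (δ - ℓ)) (h2 : NoPole q (1 - u₁) (δ - ℓ))
    (s : σ →₀ ℕ) :
    siteR q i j ℓ δ u₁ u₂ (monomial s 1) =
      ∑ x ∈ Finset.HasAntidiagonal.antidiagonal (s i),
        rCoeff (q ^ 2) (q ^ (δ + ℓ - -u₂)) (q ^ (-u₂ - (δ - ℓ))) x.1 x.2 •
          ∑ y ∈ Finset.HasAntidiagonal.antidiagonal (s j + x.2),
            rCoeff (q ^ 2) (q ^ (-(δ - ℓ) - -(δ + ℓ))) (q ^ (-(δ + ℓ) - -(1 - u₁))) y.1 y.2 •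
              monomial ((transferExp j i y (transferExp i j x s)).equivMapDomain (Equiv.swap i j))
                1 := by
  have h2' : NoPole q (-(δ - ℓ)) (-(1 - u₁)) := fun n => by
    rw [show 2 * -(δ - ℓ) - 2 * -(1 - u₁) + 2 * (n : ℂ) = 2 * (1 - u₁) - 2 * (δ - ℓ) + 2 * n by
      ring]
    exact h2 n
  rw [siteR, Rplus_eq_Rminus, Module.End.mul_apply, Module.End.mul_apply,
    Rminus_monomial hq0 hq hij _ h1, map_sum, map_sum]
  refine Finset.sum_congr rfl fun x _ => ?_
  rw [map_smul, map_smul, Rminus_monomial hq0 hq hij.symm _ h2', map_sum]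
  change _ • ∑ y ∈ Finset.HasAntidiagonal.antidiagonal (transferExp i j x s j), _ = _
  rw [transferExp_right hij]
  congr 1
  refine Finset.sum_congr rfl fun y _ => ?_
  rw [map_smul, perm_monomial]
  rfl

lemma coeff_siteR_monomial (hq0 : q ≠ 0) (hq : ∀ n : ℕ, 0 < n → q ^ n ≠ 1) (hij : i ≠ j)
    {ℓ δ u₁ : ℂ} (u₂ : ℂ) (h1 : NoPole q (δ + ℓ) (δ - ℓ)) (h2 : NoPole q (1 - u₁) (δ - ℓ))
    (s t : σ →₀ ℕ) :
    coeff t (siteR q i j ℓ δ u₁ u₂ (monomial s 1)) =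
      ∑ x ∈ Finset.HasAntidiagonal.antidiagonal (s i),
        rCoeff (q ^ 2) (q ^ (δ + ℓ - -u₂)) (q ^ (-u₂ - (δ - ℓ))) x.1 x.2 *
          ∑ y ∈ Finset.HasAntidiagonal.antidiagonal (s j + x.2),
            rCoeff (q ^ 2) (q ^ (-(δ - ℓ) - -(δ + ℓ))) (q ^ (-(δ + ℓ) - -(1 - u₁))) y.1 y.2 *
              if (transferExp j i y (transferExp i j x s)).equivMapDomain (Equiv.swap i j) = t
                then 1 else 0 := by
  simp only [siteR_monomial hq0 hq hij u₂ h1 h2, coeff_sum, coeff_smul, smul_eq_mul, coeff_monomial]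

/-- The local operator `ℝ_{k0}` only changes the degrees in `z_k` and `z_0`. -/
lemma eq_of_coeff_siteR_ne_zero (hq0 : q ≠ 0) (hq : ∀ n : ℕ, 0 < n → q ^ n ≠ 1) (hij : i ≠ j)
    {ℓ δ u₁ : ℂ} (u₂ : ℂ) (h1 : NoPole q (δ + ℓ) (δ - ℓ)) (h2 : NoPole q (1 - u₁) (δ - ℓ))
    {s t : σ →₀ ℕ} (h : coeff t (siteR q i j ℓ δ u₁ u₂ (monomial s 1)) ≠ 0) {k : σ} (hi : k ≠ i)
    (hj : k ≠ j) : t k = s k := by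
  rw [coeff_siteR_monomial hq0 hq hij u₂ h1 h2] at h
  obtain ⟨x, -, hx⟩ := Finset.exists_ne_zero_of_sum_ne_zero h
  obtain ⟨y, -, hy⟩ := Finset.exists_ne_zero_of_sum_ne_zero (right_ne_zero_of_mul hx)
  have ht := of_not_not fun hne => right_ne_zero_of_mul hy (if_neg hne)
  rw [← ht, Finsupp.equivMapDomain_apply, Equiv.symm_swap, Equiv.swap_apply_of_ne_of_ne hi hj,
    transferExp_of_ne hj hi, transferExp_of_ne hi hj]

/-- Geometric growth of the matrix elements of `ℝ_{k0}` in the degree in `z_0`, at fixed degrees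
in `z_k`. -/
lemma exists_siteR_bound (hq0 : q ≠ 0) (hq : ∀ n : ℕ, 0 < n → q ^ n ≠ 1) (hij : i ≠ j)
    {ℓ δ u₁ : ℂ} (u₂ : ℂ) (h1 : NoPole q (δ + ℓ) (δ - ℓ)) (h2 : NoPole q (1 - u₁) (δ - ℓ)) {r : ℝ}
    (hr : (‖q‖ < 1 ∧ ‖q ^ (2 * ℓ)‖ < r) ∨ (1 < ‖q‖ ∧ ‖(q ^ (2 * ℓ))⁻¹‖ < r)) (a b : ℕ) :
    ∃ C, 0 ≤ C ∧ ∀ s t : σ →₀ ℕ, s i = a → t i = b →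
      ‖coeff t (siteR q i j ℓ δ u₁ u₂ (monomial s 1))‖ ≤ C * r ^ s j := by
  have hr0 : 0 < r := by
    rcases hr with ⟨-, h⟩ | ⟨-, h⟩ <;> exact (norm_nonneg _).trans_lt h
  have h2' : NoPole q (-(δ - ℓ)) (-(1 - u₁)) := fun n => by
    rw [show 2 * -(δ - ℓ) - 2 * -(1 - u₁) + 2 * (n : ℂ) = 2 * (1 - u₁) - 2 * (δ - ℓ) + 2 * n by
      ring]
    exact h2 n
  obtain ⟨C, hC0, hC⟩ := exists_rCoeff_bound (r := r) (sq_pow_ne_one hq) (pow_ne_zero 2 hq0)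
    (cpow_ne_zero' hq0 (-(δ - ℓ) - -(δ + ℓ))) (cpow_ne_zero' hq0 (-(δ + ℓ) - -(1 - u₁)))
    (h2'.qPoch_ne_zero hq0 _) (by
      rw [norm_pow, show -(δ - ℓ) - -(δ + ℓ) = 2 * ℓ by ring]
      exact hr.imp (fun h => ⟨pow_lt_one₀ (norm_nonneg _) h.1 two_ne_zero, h.2⟩)
        fun h => ⟨one_lt_pow₀ h.1 two_ne_zero, h.2⟩) b
  refine ⟨∑ x ∈ Finset.HasAntidiagonal.antidiagonal a,
    ‖rCoeff (q ^ 2) (q ^ (δ + ℓ - -u₂)) (q ^ (-u₂ - (δ - ℓ))) x.1 x.2‖ * (C * r ^ x.2),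
    Finset.sum_nonneg fun _ _ => by positivity, fun s t hs ht => ?_⟩
  rw [coeff_siteR_monomial hq0 hq hij u₂ h1 h2, hs, Finset.sum_mul]
  refine (norm_sum_le _ _).trans (Finset.sum_le_sum fun x _ => ?_)
  rw [norm_mul, mul_assoc]
  refine mul_le_mul_of_nonneg_left ?_ (norm_nonneg _)
  have hterm : ∀ y ∈ Finset.HasAntidiagonal.antidiagonal (s j + x.2),
      ‖rCoeff (q ^ 2) (q ^ (-(δ - ℓ) - -(δ + ℓ))) (q ^ (-(δ + ℓ) - -(1 - u₁))) y.1 y.2 *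
        if (transferExp j i y (transferExp i j x s)).equivMapDomain (Equiv.swap i j) = t
          then 1 else 0‖ ≤ if y = (b, s j + x.2 - b) then C * r ^ x.2 * r ^ s j else 0 := by
    intro y hy
    have hy' := Finset.HasAntidiagonal.mem_antidiagonal.mp hy
    by_cases he : (transferExp j i y (transferExp i j x s)).equivMapDomain (Equiv.swap i j) = t
    · have hb : y.1 = b := by
        rw [← ht, ← he, Finsupp.equivMapDomain_apply, Equiv.symm_swap, Equiv.swap_apply_left,
          transferExp_left hij.symm]
      rw [if_pos he, mul_one, if_pos (Prod.ext hb (by omega)), mul_assoc, ← pow_add,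
        add_comm x.2, ← hy', hb]
      exact hC _
    · rw [if_neg he, mul_zero, norm_zero]
      split_ifs <;> positivity
  refine (norm_sum_le _ _).trans ((Finset.sum_le_sum hterm).trans ?_)
  rw [Finset.sum_ite_eq']
  split_ifs
  · exact le_rfl
  · positivity

end Growth

/-! ### Convergence of the trace -/

section Convergence

open MvPolynomial Filter Topology

variable {N : ℕ} {q : ℂ} {ℓ δ : Fin N → ℂ} {u₁ : ℂ}

lemma commute_prod_siteR_degOp (u₂ : ℂ) (L : List (Fin N)) :
    Commute (L.map fun k => siteR q (some k) none (ℓ k) (δ k) u₁ u₂).prod (degOp _) :=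
  Commute.list_prod_left _ _ fun x hx => by
    obtain ⟨k, -, rfl⟩ := List.mem_map.mp hx
    exact commute_siteR_degOp _ _ _ _ _ _ _

/-- The expansion of a matrix element of a product over the intermediate states. -/
lemma coeff_mul_monomial_eq_sum {σ : Type} (A B : Op σ) (s t : σ →₀ ℕ) :
    coeff t ((A * B) (monomial s 1)) = ∑ r ∈ (B (monomial s 1)).support,
      coeff r (B (monomial s 1)) * coeff t (A (monomial r 1)) := by
  rw [Module.End.mul_apply]
  conv_lhs => rw [eq_sum_of_support_subset (subset_refl (B (monomial s 1)).support)]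
  simp only [map_sum, map_smul, coeff_sum, coeff_smul, smul_eq_mul]

/-- A product of local operators only changes the degrees in `z₀` and in the variables of its sites. -/
lemma eq_of_coeff_prod_siteR_ne_zero (hq0 : q ≠ 0) (hq : ∀ n : ℕ, 0 < n → q ^ n ≠ 1)
    (hℓ : ∀ (k : Fin N) (j : ℕ), q ^ (4 * ℓ k + 2 * j) ≠ 1) (h1 : Regular q ℓ δ u₁) (u₂ : ℂ)
    (L : List (Fin N)) {s t : Option (Fin N) →₀ ℕ}
    (h : coeff t ((L.map fun k => siteR q (some k) none (ℓ k) (δ k) u₁ u₂).prod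
      (monomial s 1)) ≠ 0) {k : Fin N} (hk : k ∉ L) : t (some k) = s (some k) := by
  classical
  induction L generalizing t with
  | nil =>
    rw [List.map_nil, List.prod_nil, Module.End.one_apply, coeff_monomial] at h
    rw [of_not_not fun hne => h (if_neg hne)]
  | cons l L ih =>
    rw [List.mem_cons, not_or] at hk
    rw [List.map_cons, List.prod_cons, coeff_mul_monomial_eq_sum] at h
    obtain ⟨r, -, hr⟩ := Finset.exists_ne_zero_of_sum_ne_zero h
    rw [eq_of_coeff_siteR_ne_zero hq0 hq (Option.some_ne_none l) u₂ (noPole_site hℓ δ l)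
      (h1.noPole l) (right_ne_zero_of_mul hr) (fun h => hk.1 (Option.some_injective _ h))
      (Option.some_ne_none k), ih (left_ne_zero_of_mul hr) hk.2]

/-- Geometric growth of the matrix elements of the monodromy operator in the degree in `z_0`. The
exponents at the sites and the conservation of the degree determine the intermediate states. -/
lemma exists_prod_siteR_bound (hq0 : q ≠ 0) (hq : ∀ n : ℕ, 0 < n → q ^ n ≠ 1)
    (hℓ : ∀ (k : Fin N) (j : ℕ), q ^ (4 * ℓ k + 2 * j) ≠ 1) (h1 : Regular q ℓ δ u₁) (u₂ : ℂ)
    {r : Fin N → ℝ} (hr : ∀ k, (‖q‖ < 1 ∧ ‖q ^ (2 * ℓ k)‖ < r k) ∨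
      (1 < ‖q‖ ∧ ‖(q ^ (2 * ℓ k))⁻¹‖ < r k)) (L : List (Fin N)) (hL : L.Nodup)
    (s t : Fin N →₀ ℕ) : ∃ C, 0 ≤ C ∧ ∀ m n : ℕ,
      ‖coeff (t.optionElim n) ((L.map fun k => siteR q (some k) none (ℓ k) (δ k) u₁ u₂).prod
        (monomial (s.optionElim m) 1))‖ ≤ C * (L.map r).prod ^ m := by
  classical
  have hr0 : ∀ k, 0 < r k := fun k => by
    rcases hr k with ⟨-, h⟩ | ⟨-, h⟩ <;> exact (norm_nonneg _).trans_lt h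
  induction L generalizing t with
  | nil =>
    refine ⟨1, zero_le_one, fun m n => ?_⟩
    rw [List.map_nil, List.prod_nil, Module.End.one_apply, coeff_monomial, List.map_nil,
      List.prod_nil, one_pow, mul_one]
    split_ifs <;> simp
  | cons k L ih =>
    rw [List.nodup_cons] at hL
    -- the only possible exponents at the sites in the intermediate state
    set w : Fin N →₀ ℕ := t.update k (s k) with hw
    obtain ⟨C, hC0, hC⟩ := ih hL.2 w
    obtain ⟨C', hC0', hC'⟩ := exists_siteR_bound hq0 hq (Option.some_ne_none k) u₂
      (noPole_site hℓ δ k) (h1.noPole k) (hr k) (s k) (t k)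
    have hLr : 0 ≤ (L.map r).prod := List.prod_nonneg fun x hx => by
      obtain ⟨l, -, rfl⟩ := List.mem_map.mp hx
      exact (hr0 l).le
    have := hr0 k
    refine ⟨C * C' * (r k ^ s.degree / r k ^ w.degree), by positivity, fun m n => ?_⟩
    rw [List.map_cons, List.prod_cons, List.map_cons, List.prod_cons, coeff_mul_monomial_eq_sum]
    have huniq : ∀ v : Option (Fin N) →₀ ℕ, coeff v ((L.map fun k => siteR q (some k) none (ℓ k)
        (δ k) u₁ u₂).prod (monomial (s.optionElim m) 1)) * coeff (t.optionElim n)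
          (siteR q (some k) none (ℓ k) (δ k) u₁ u₂ (monomial v 1)) ≠ 0 →
        v = w.optionElim (v none) ∧ v none + w.degree = m + s.degree := fun v hv => by
      have h3 : v = w.optionElim (v none) := Finsupp.ext fun l => by
        cases l with
        | none => rw [Finsupp.optionElim_apply_none]
        | some l =>
          rw [Finsupp.optionElim_apply_some, hw, Finsupp.coe_update, Function.update_apply]
          split_ifs with hlk
          · rw [eq_of_coeff_prod_siteR_ne_zero hq0 hq hℓ h1 u₂ L (left_ne_zero_of_mul hv)
              (by rw [hlk]; exact hL.1), Finsupp.optionElim_apply_some, hlk]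
          · rw [← eq_of_coeff_siteR_ne_zero hq0 hq (Option.some_ne_none k) u₂ (noPole_site hℓ δ k)
              (h1.noPole k) (right_ne_zero_of_mul hv) (fun h => hlk (Option.some_injective _ h))
              (Option.some_ne_none l), Finsupp.optionElim_apply_some]
      refine ⟨h3, ?_⟩
      have h4 := degree_eq_of_mem_support (commute_prod_siteR_degOp u₂ L) (left_ne_zero_of_mul hv)
      rwa [h3, degree_optionElim, degree_optionElim] at h4
    by_cases hzero : ∑ v ∈ ((L.map fun k => siteR q (some k) none (ℓ k) (δ k) u₁ u₂).prod
        (monomial (s.optionElim m) 1)).support, coeff v ((L.map fun k => siteR q (some k) none (ℓ k)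
        (δ k) u₁ u₂).prod (monomial (s.optionElim m) 1)) * coeff (t.optionElim n)
          (siteR q (some k) none (ℓ k) (δ k) u₁ u₂ (monomial v 1)) = 0
    · rw [hzero, norm_zero]
      positivity
    · obtain ⟨v, hvs, hv⟩ := Finset.exists_ne_zero_of_sum_ne_zero hzero
      obtain ⟨hv1, hv2⟩ := huniq v hv
      rw [Finset.sum_eq_single v (fun v' _ hne => of_not_not fun hv' => hne (by
        obtain ⟨h1, h2⟩ := huniq v' hv'
        rw [h1, hv1]
        congr 1
        omega)) (fun h => absurd hvs h), norm_mul]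
      have hb1 := hC m (v none)
      rw [← hv1] at hb1
      have hb2 := hC' v (t.optionElim n) (by
        rw [hv1, Finsupp.optionElim_apply_some, hw, Finsupp.coe_update, Function.update_self])
        (Finsupp.optionElim_apply_some _ _ _)
      have hpow : r k ^ v none = r k ^ m * (r k ^ s.degree / r k ^ w.degree) := by
        rw [← mul_div_assoc, ← pow_add, ← hv2, pow_add,
          mul_div_cancel_right₀ _ (pow_ne_zero _ this.ne')]
      rw [hpow] at hb2
      refine (mul_le_mul hb1 hb2 (norm_nonneg _) (by positivity)).trans (le_of_eq ?_)
      rw [mul_pow]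
      ring

lemma exists_lt_prod_lt_one {x : Fin N → ℝ} (hx : ∏ k, x k < 1) :
    ∃ r : Fin N → ℝ, (∀ k, x k < r k) ∧ ∏ k, r k < 1 := by
  have h : Tendsto (fun ε : ℝ => ∏ k, (x k + ε)) (𝓝[>] 0) (𝓝 (∏ k, x k)) := by
    have : Tendsto (fun ε : ℝ => ∏ k, (x k + ε)) (𝓝 0) (𝓝 (∏ k, (x k + 0))) :=
      Continuous.tendsto (by fun_prop) 0
    simp only [add_zero] at this
    exact this.mono_left nhdsWithin_le_nhds
  obtain ⟨ε, h1, h2⟩ := ((h.eventually_lt_const hx).and self_mem_nhdsWithin).exists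
  exact ⟨fun k => x k + ε, fun k => lt_add_of_pos_right _ h2, h1⟩

/-- The trace over the auxiliary space converges geometrically. -/
theorem mem_domainQ_of_norm_lt_one (hq0 : q ≠ 0) (hq : ∀ n : ℕ, 0 < n → q ^ n ≠ 1)
    (hℓ : ∀ (k : Fin N) (j : ℕ), q ^ (4 * ℓ k + 2 * j) ≠ 1)
    (hconv : (‖q‖ < 1 ∧ ‖q ^ (∑ k, ℓ k)‖ < 1) ∨ (1 < ‖q‖ ∧ 1 < ‖q ^ (∑ k, ℓ k)‖))
    (h1 : Regular q ℓ δ u₁) (u₂ : ℂ) : (u₁, u₂) ∈ domainQ q ℓ δ := by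
  have hsq : ∀ x : ℂ, ‖q ^ (2 * x)‖ = ‖q ^ x‖ ^ 2 := fun x => by
    rw [two_mul, Complex.cpow_add _ _ hq0, norm_mul, sq]
  have hprod : ∏ k, ‖q ^ (2 * ℓ k)‖ = ‖q ^ (∑ k, ℓ k)‖ ^ 2 := by
    rw [← hsq, Finset.mul_sum, cpow_sum hq0, norm_prod]
  obtain ⟨r, hr, hr1⟩ : ∃ r : Fin N → ℝ, (∀ k, (‖q‖ < 1 ∧ ‖q ^ (2 * ℓ k)‖ < r k) ∨
      (1 < ‖q‖ ∧ ‖(q ^ (2 * ℓ k))⁻¹‖ < r k)) ∧ ∏ k, r k < 1 := by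
    rcases hconv with ⟨h2, h3⟩ | ⟨h2, h3⟩
    · obtain ⟨r, hr, hr1⟩ := exists_lt_prod_lt_one (x := fun k => ‖q ^ (2 * ℓ k)‖) (by
        rw [hprod]; exact pow_lt_one₀ (norm_nonneg _) h3 two_ne_zero)
      exact ⟨r, fun k => Or.inl ⟨h2, hr k⟩, hr1⟩
    · obtain ⟨r, hr, hr1⟩ := exists_lt_prod_lt_one (x := fun k => ‖(q ^ (2 * ℓ k))⁻¹‖) (by
        simp only [norm_inv]
        rw [Finset.prod_inv_distrib, hprod]
        exact inv_lt_one_of_one_lt₀ (one_lt_pow₀ h3 two_ne_zero))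
      exact ⟨r, fun k => Or.inr ⟨h2, hr k⟩, hr1⟩
  have hr0 : 0 ≤ ∏ k, r k := Finset.prod_nonneg fun k _ => by
    rcases hr k with ⟨-, h⟩ | ⟨-, h⟩ <;> exact ((norm_nonneg _).trans_lt h).le
  have hsum : ∀ s t : Fin N →₀ ℕ,
      Summable fun d => coeff t (chainQ q ℓ δ u₁ u₂ d (monomial s 1)) := fun s t => by
    obtain ⟨C, -, hC⟩ := exists_prod_siteR_bound hq0 hq hℓ h1 u₂ hr (List.finRange N)
      (List.nodup_finRange N) s t
    rw [← List.ofFn_eq_map, ← List.ofFn_eq_map, List.prod_ofFn] at hC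
    refine Summable.of_norm_bounded
      ((summable_geometric_of_lt_one hr0 hr1).mul_left C) fun d => ?_
    rw [chainQ, auxCoeff_apply, coeff_auxOut, auxIn_monomial]
    exact hC d d
  refine mem_domainQ.mpr ⟨h1, onMonomials fun s => ∑ t ∈ degFinset N s.degree,
    (∑' d, coeff t (chainQ q ℓ δ u₁ u₂ d (monomial s 1))) • monomial t 1, ?_⟩
  rw [hasAuxTrace_iff]
  refine HasOpSum.of_monomial fun s t => ?_
  classical
  rw [onMonomials_monomial, coeff_sum]
  simp only [coeff_smul, coeff_monomial, smul_eq_mul, mul_ite, mul_one, mul_zero]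
  rw [Finset.sum_ite_eq']
  split_ifs with h
  · exact (hsum s t).hasSum
  · have h0 : (fun d => coeff t (auxCoeff (chainR q ℓ δ u₁ u₂) d d (monomial s 1))) = fun _ => 0 :=
      funext fun d => of_not_not fun hne => h (mem_degFinset.mpr
        (degree_eq_of_mem_support (commute_chainQ_degOp q ℓ δ u₁ u₂ d) hne))
    rw [h0]
    exact hasSum_zero

/-- The parameters `u₁`, `u₂` determine `u` and `ℓ₀`. -/
lemma genTransfer_eq_baxterQ (q : ℂ) (ℓ δ : Fin N → ℂ) (u ℓ₀ : ℂ) :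
    genTransfer q ℓ δ u ℓ₀ = baxterQ q ℓ δ (1 + u - ℓ₀) (u + ℓ₀) := by
  rw [baxterQ, show (1 + u - ℓ₀ + (u + ℓ₀) - 1) / 2 = u by ring,
    show (1 + (u + ℓ₀) - (1 + u - ℓ₀)) / 2 = ℓ₀ by ring]

end Convergence

end XXZ

end

theorem mainTheorem1 {N : ℕ} (q : ℂ) (ℓ δ : Fin N → ℂ)
    (hq0 : q ≠ 0) (hq : ∀ n : ℕ, 0 < n → q ^ n ≠ 1)
    (hℓ : ∀ (k : Fin N) (j : ℕ), q ^ (4 * ℓ k + 2 * j) ≠ 1) :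
    -- `Q(u, ℓ₀)` is `Q(u₁ | u₂)` with `u₁ = 1 + u - ℓ₀` and `u₂ = u + ℓ₀`
    (∀ u ℓ₀ : ℂ,
      XXZ.genTransfer q ℓ δ u ℓ₀ = XXZ.baxterQ q ℓ δ (1 + u - ℓ₀) (u + ℓ₀)) ∧
    -- the trace exists at all regular parameters, in the region of convergence
    (((‖q‖ < 1 ∧ ‖q ^ (∑ k, ℓ k)‖ < 1) ∨ (1 < ‖q‖ ∧ 1 < ‖q ^ (∑ k, ℓ k)‖)) →
      ∀ u₁ u₂ : ℂ, XXZ.Regular q ℓ δ u₁ → (u₁, u₂) ∈ XXZ.domainQ q ℓ δ) ∧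
    -- commutativity
    (∀ u₁ u₂ v₁ v₂ : ℂ, (u₁, u₂) ∈ XXZ.domainQ q ℓ δ → (v₁, v₂) ∈ XXZ.domainQ q ℓ δ →
      XXZ.baxterQ q ℓ δ u₁ u₂ * XXZ.baxterQ q ℓ δ v₁ v₂ =
        XXZ.baxterQ q ℓ δ v₁ v₂ * XXZ.baxterQ q ℓ δ u₁ u₂) ∧
    (∀ u₁ u₂ v : ℂ, (u₁, u₂) ∈ XXZ.domainQ q ℓ δ →
      XXZ.baxterQ q ℓ δ u₁ u₂ * XXZ.transfer q ℓ δ v =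
        XXZ.transfer q ℓ δ v * XXZ.baxterQ q ℓ δ u₁ u₂) ∧
    -- Baxter relation with respect to `u₂`
    (∀ u₁ u : ℂ, (u₁, u) ∈ XXZ.domainQ q ℓ δ → (u₁, u + 1) ∈ XXZ.domainQ q ℓ δ →
      (u₁, u - 1) ∈ XXZ.domainQ q ℓ δ →
      XXZ.baxterQ q ℓ δ u₁ u * XXZ.transfer q ℓ δ u =
        XXZ.deltaPlus q ℓ δ u • XXZ.baxterQ q ℓ δ u₁ (u + 1) +
          XXZ.deltaMinus q ℓ δ u • XXZ.baxterQ q ℓ δ u₁ (u - 1)) ∧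
    -- Baxter relation with respect to `u₁`
    (∀ u u₂ : ℂ, (u, u₂) ∈ XXZ.domainQ q ℓ δ → (u - 1, u₂) ∈ XXZ.domainQ q ℓ δ →
      (u + 1, u₂) ∈ XXZ.domainQ q ℓ δ →
      XXZ.deltaMinus q ℓ δ (u - 1) ≠ 0 ∧
      XXZ.transfer q ℓ δ u * XXZ.baxterQ q ℓ δ u u₂ =
        (XXZ.deltaPlus q ℓ δ (u - 1) * XXZ.deltaMinus q ℓ δ u / XXZ.deltaMinus q ℓ δ (u - 1)) •
            XXZ.baxterQ q ℓ δ (u - 1) u₂ +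
          XXZ.deltaMinus q ℓ δ u • XXZ.baxterQ q ℓ δ (u + 1) u₂) := by
  refine ⟨XXZ.genTransfer_eq_baxterQ q ℓ δ,
    fun h u₁ u₂ h1 => XXZ.mem_domainQ_of_norm_lt_one hq0 hq hℓ h h1 u₂,
    fun u₁ u₂ v₁ v₂ hu hv => XXZ.baxterQ_mul_baxterQ hq0 hq hℓ hu hv,
    fun u₁ u₂ v hu => XXZ.baxterQ_mul_transfer hq0 hq hℓ v hu,
    fun u₁ u h hp hm => XXZ.baxterQ_mul_transfer_baxter hq0 hq hℓ h hp hm,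
    fun u u₂ h hm hp => ⟨XXZ.deltaMinus_ne_zero hq0 hq (XXZ.mem_domainQ.mp h).1,
      XXZ.transfer_mul_baxterQ_baxter hq0 hq h hm hp⟩⟩
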